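/- Let $X$ be a connected finite simplicial complex of dimension $n$ and $\varphi:\pi_1(X)\to\pi$ a homomorphism to an arbitrary group. Let $\tilde X_\varphi$ be the Galois covering associated to $\ker\varphi$, with Galois group $\Gamma=\pi_1(X)/\ker\varphi$. Choose a continuous piecewise smooth Riemannian metric $g$ on $X$ (smooth on each closed simplex, compatible with passing to faces). Let $L^2(\tilde X_\varphi)$ be the Hilbert space of square-integrable functions with respect to the $n$-dimensional volume of the lifted metric, with the $\Gamma$-action $(\gamma\cdot f)(x)=f(\gamma^{-1}x)$, and let $\mathcal N$ be the set of $\Gamma$-equivariant Lipschitz maps $F$ from $\tilde X_\varphi$ to the unit sphere of $L^2(\tilde X_\varphi)$ all of whose values are non-negative functions. For $F\in\mathcal N$ let $g^F_x(v_1,v_2)=\langle D_xF(v_1),D_xF(v_2)\rangle$, defined where $F$ is differentiable in the interiors of the $n$-simplices; it descends to $X$. Its volume form is set to be $0$ where $g^F$ is degenerate or undefined. The spherical volume is $T_\varphi(X)=\inf_{F\in\mathcal N}\operatorname{Vol}(X,g^F)$. A simplicial map $f:X\to Y$ of $n$-dimensional complexes is $(n,d)$-monotone (strictly $(n,d)$-monotone)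 if the preimage of every open $n$-simplex of $Y$ consists of at most (exactly) $d$ open $n$-simplices of $X$. An extension of $(X,\varphi)$ is a pair $(X',\varphi')$ obtained by finitely many steps in which a cell $D^k$, $1\le k<n$, is attached along a simplicial map $h:S^{k-1}\to X$ from a triangulated sphere, where $X'=X\cup_hD^k$ is triangulated with $X$ as a subcomplex and $\varphi':\pi_1(X')\to\pi$ satisfies $\varphi'\circ i_*=\varphi$ for the inclusion $i:X\hookrightarrow X'$. **Theorem.** For every choice of Riemannian metrics on the complexes involved, $T$ takes finite values and satisfies the following, for all groups $\pi$. 1. (Weak comparison axiom) Let $X,Y$ be connected finite simplicial complexes of dimension $n$ with homomorphisms $\varphi:\pi_1(X)\to\pi$, $\psi:\pi_1(Y)\to\pi$. If there is a strictly $(n,d)$-monotone map $f:X\to Y$ with $\varphi=\psi\circ f_*$ inducing an isomorphism $\pi_1(X)/\ker\varphi\cong\pi_1(Y)/\ker\psi$, then $T_\varphi(X)\le d\cdot T_\psi(Y)$. 2. (Covering axiom) If $f:X\to Y$ is a simplicial $d$-sheeted covering map of connected finite simplicial complexes and $\psi:\pi_1(Y)\to\pi$ is a homomorphism, then $T_{\psi\circ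 f_*}(X)\le d\cdot T_\psi(Y)$. 3. (Zero axiom) If $X,Y$ are connected finite simplicial complexes of dimension $n$, $\psi:\pi_1(Y)\to\pi$ is a homomorphism and $f:X\to Y$ is $(n,0)$-monotone, then $T_{\psi\circ f_*}(X)=0$. 4. (Extension axiom) If $\varphi:\pi_1(X)\to\pi$ is surjective and $(X',\varphi')$ is an extension of $(X,\varphi)$, then $T_{\varphi'}(X')=T_\varphi(X)$. -/

import Mathlib

open MeasureTheory Set
open scoped ENNReal NNReal ContDiff

universe u v

noncomputable section

namespace SphericalVolume

/-! ## Simplicial complexes, their realizations, and simplicial maps -/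

/-- The geometric realization of an abstract simplicial complex, in barycentric coordinates. -/
@[ext]
structure Realization {V : Type*} (K : AbstractSimplicialComplex V) where
  coord : V →₀ ℝ
  nonneg : ∀ v, 0 ≤ coord v
  sum_eq_one : (coord.sum fun _ r => r) = 1
  exists_face : ∃ σ ∈ K.faces, coord.support ⊆ σ

/-- The topology of convergence of barycentric coordinates. For finite (and for locally finite)
complexes this is the usual topology of the realization. -/
instance {V : Type*} (K : AbstractSimplicialComplex V) : TopologicalSpace (Realization K) :=
  TopologicalSpace.induced (fun x => (x.coord : V → ℝ)) inferInstance

theorem Realization.continuous_iff {V X : Type*} [TopologicalSpace X]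
    {K : AbstractSimplicialComplex V} {f : X → Realization K} :
    Continuous f ↔ ∀ v, Continuous fun t => (f t).coord v := by
  rw [continuous_induced_rng, continuous_pi_iff]
  rfl

theorem Realization.continuous_coord {V : Type*} {K : AbstractSimplicialComplex V} (v : V) :
    Continuous fun x : Realization K => x.coord v :=
  Realization.continuous_iff.1 continuous_id v

/-- A vertex as a point of the realization. -/
def Realization.vertex {V : Type*} (K : AbstractSimplicialComplex V) (v : V) : Realization K :=
  ⟨Finsupp.single v 1, by
    classical
    intro w
    rw [Finsupp.single_apply]; split_ifs <;> norm_num,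
    by simp, {v}, K.singleton_mem v, Finsupp.support_single_subset⟩

/-- The point `(1 - t) x + t y` on the segment between two points of a common simplex. -/
def Realization.combo {V : Type*} {K : AbstractSimplicialComplex V} (x y : Realization K)
    (h : ∃ σ ∈ K.faces, x.coord.support ⊆ σ ∧ y.coord.support ⊆ σ) (t : unitInterval) : Realization K :=
  ⟨(1 - (t : ℝ)) • x.coord + (t : ℝ) • y.coord, by
      intro w
      have h0 := t.2.1
      have h1 : (0 : ℝ) ≤ 1 - t := by linarith [t.2.2]
      have hx0 := x.nonneg w
      have hy0 := y.nonneg w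
      simp only [Finsupp.add_apply, Finsupp.smul_apply, smul_eq_mul]
      positivity, by
      rw [Finsupp.sum_add_index' (by simp) (by simp), Finsupp.sum_smul_index' (by simp),
        Finsupp.sum_smul_index' (by simp)]
      have hx1 := x.sum_eq_one
      have hy1 := y.sum_eq_one
      simp only [Finsupp.sum] at hx1 hy1 ⊢
      simp only [smul_eq_mul, ← Finset.mul_sum, hx1, hy1]
      ring, by
      classical
      obtain ⟨σ, hσ, hx, hy⟩ := h
      exact ⟨σ, hσ, Finsupp.support_add.trans (Finset.union_subset
        (Finsupp.support_smul.trans hx) (Finsupp.support_smul.trans hy))⟩⟩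

/-- The straight path along an edge (or the constant path, if `v = w`). -/
def Realization.edgePath {V : Type*} {K : AbstractSimplicialComplex V} {v w : V}
    (h : ∃ σ ∈ K.faces, v ∈ σ ∧ w ∈ σ) : Path (vertex K v) (vertex K w) where
  toFun := Realization.combo (vertex K v) (vertex K w) (by
    obtain ⟨σ, hσ, hv, hw⟩ := h
    exact ⟨σ, hσ, Finsupp.support_single_subset.trans (by simpa using hv),
      Finsupp.support_single_subset.trans (by simpa using hw)⟩)
  continuous_toFun := by
    rw [Realization.continuous_iff]
    intro u
    simp only [Realization.combo, Finsupp.add_apply, Finsupp.smul_apply, smul_eq_mul]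
    fun_prop
  source' := Realization.ext (by simp [Realization.combo])
  target' := Realization.ext (by simp [Realization.combo])

/-- Two paths in a common closed simplex with the same endpoints are homotopic. -/
theorem Realization.homotopic_of_subset {V : Type*} {K : AbstractSimplicialComplex V}
    {σ : Finset V} (hσ : σ ∈ K.faces) {x y : Realization K} (p q : Path x y)
    (hp : ∀ t, (p t).coord.support ⊆ σ) (hq : ∀ t, (q t).coord.support ⊆ σ) : p.Homotopic q := by
  refine ⟨{ toFun := fun s => Realization.combo (p s.2) (q s.2) ⟨σ, hσ, hp _, hq _⟩ s.1
            continuous_toFun := ?_, map_zero_left := ?_, map_one_left := ?_, prop' := ?_ }⟩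
  · rw [Realization.continuous_iff]
    intro u
    simp only [Realization.combo, Finsupp.add_apply, Finsupp.smul_apply, smul_eq_mul]
    have h1 : Continuous fun s : unitInterval × unitInterval => (p s.2).coord u :=
      (Realization.continuous_coord u).comp (p.continuous.comp continuous_snd)
    have h2 : Continuous fun s : unitInterval × unitInterval => (q s.2).coord u :=
      (Realization.continuous_coord u).comp (q.continuous.comp continuous_snd)
    fun_prop
  · intro t
    exact Realization.ext (by simp [Realization.combo])
  · intro t
    exact Realization.ext (by simp [Realization.combo])
  · rintro s t (rfl | rfl) <;>
    exact Realization.ext (by simp [Realization.combo, ← add_smul])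

open scoped Classical in
/-- A simplicial map: a map of vertices that maps simplices onto simplices. -/
structure SimplicialMap {V W : Type*} (K : AbstractSimplicialComplex V)
    (L : AbstractSimplicialComplex W) where
  toFun : V → W
  image_mem : ∀ σ ∈ K.faces, σ.image toFun ∈ L.faces

/-- The map of realizations induced by a simplicial map (affine on every simplex). -/
def SimplicialMap.map {V W : Type*} {K : AbstractSimplicialComplex V}
    {L : AbstractSimplicialComplex W} (f : SimplicialMap K L) (x : Realization K) :
    Realization L :=
  ⟨Finsupp.mapDomain f.toFun x.coord, by
      classical
      intro w
      rw [Finsupp.mapDomain, Finsupp.sum_apply]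
      refine Finset.sum_nonneg fun v _ => ?_
      change 0 ≤ (Finsupp.single (f.toFun v) (x.coord v)) w
      rw [Finsupp.single_apply]
      split_ifs
      · exact x.nonneg v
      · exact le_rfl, by
      rw [Finsupp.sum_mapDomain_index (by simp) (by simp)]
      exact x.sum_eq_one, by
      classical
      obtain ⟨σ, hσ, hx⟩ := x.exists_face
      refine ⟨σ.image f.toFun, ?_, Finsupp.mapDomain_support.trans (Finset.image_subset_image hx)⟩
      convert f.image_mem σ hσ⟩

theorem SimplicialMap.continuous_map {V W : Type*} [Finite V] {K : AbstractSimplicialComplex V}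
    {L : AbstractSimplicialComplex W} (f : SimplicialMap K L) : Continuous f.map := by
  classical
  cases nonempty_fintype V
  rw [Realization.continuous_iff]
  intro w
  have h : (fun x : Realization K => (f.map x).coord w) =
      fun x => ∑ v, if f.toFun v = w then x.coord v else 0 := by
    funext x
    simp only [SimplicialMap.map, Finsupp.mapDomain]
    rw [Finsupp.sum_apply, Finsupp.sum_fintype _ _ (by simp)]
    exact Finset.sum_congr rfl fun v _ => Finsupp.single_apply
  rw [h]
  refine continuous_finsetSum _ fun v _ => ?_
  split_ifs
  · exact Realization.continuous_coord v
  · exact continuous_const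

/-- The dimension of a finite simplicial complex. -/
def dimension {V : Type*} (K : AbstractSimplicialComplex V) : ℕ :=
  ⨆ σ : K.faces, (σ.1.card - 1)

open scoped Classical in
/-- The `n`-simplices `σ` of `K` whose interior is mapped to the interior of the simplex `τ`. -/
def SimplicialMap.simplicesOver {V W : Type*} {K : AbstractSimplicialComplex V}
    {L : AbstractSimplicialComplex W} (f : SimplicialMap K L) (n : ℕ) (τ : Finset W) :
    Set (Finset V) :=
  {σ | σ ∈ K.faces ∧ σ.card = n + 1 ∧ σ.image f.toFun = τ}

/-- `(n,d)`-monotone maps: the preimage of every open `n`-simplex consists of at most `d` open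
`n`-simplices. -/
def SimplicialMap.IsMonotone {V W : Type*} {K : AbstractSimplicialComplex V}
    {L : AbstractSimplicialComplex W} (f : SimplicialMap K L) (n d : ℕ) : Prop :=
  ∀ τ ∈ L.faces, τ.card = n + 1 → (f.simplicesOver n τ).encard ≤ d

/-- Strictly `(n,d)`-monotone maps: the preimage of every open `n`-simplex consists of exactly `d`
open `n`-simplices. -/
def SimplicialMap.IsStrictlyMonotone {V W : Type*} {K : AbstractSimplicialComplex V}
    {L : AbstractSimplicialComplex W} (f : SimplicialMap K L) (n d : ℕ) : Prop :=
  ∀ τ ∈ L.faces, τ.card = n + 1 → (f.simplicesOver n τ).encard = d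

/-! ## Charts and measurable structure -/

/-- The `n`-simplices of `K` together with an ordering of their vertices. -/
structure OrderedSimplex {V : Type*} (K : AbstractSimplicialComplex V) (n : ℕ) where
  vert : Fin (n + 1) ↪ V
  mem_faces : Finset.univ.map vert ∈ K.faces

/-- The simplex `{t ∈ ℝⁿ | tᵢ ≥ 0, ∑ tᵢ ≤ 1}`. -/
def corner (n : ℕ) : Set (Fin n → ℝ) := {t | (∀ i, 0 ≤ t i) ∧ ∑ i, t i ≤ 1}

/-- The parametrization of a closed simplex with ordered vertices `e 0, …, e n`: the point with
barycentric coordinate `1 - ∑ tᵢ` at `e 0` and `tᵢ` at `e (i + 1)`. -/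
def chart {V : Type*} {K : AbstractSimplicialComplex V} {n : ℕ} (e : OrderedSimplex K n)
    (t : corner n) : Realization K :=
  ⟨Finsupp.single (e.vert 0) (1 - ∑ i, t.1 i) +
      ∑ i, Finsupp.single (e.vert i.succ) (t.1 i), by
      classical
      intro v
      rw [Finsupp.add_apply, Finsupp.finsetSum_apply]
      refine add_nonneg ?_ (Finset.sum_nonneg fun i _ => ?_)
      · rw [Finsupp.single_apply]
        split_ifs
        · linarith [t.2.2]
        · exact le_rfl
      · rw [Finsupp.single_apply]
        split_ifs
        · exact t.2.1 i
        · exact le_rfl, by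
      rw [Finsupp.sum_add_index' (by simp) (by simp), ← Finsupp.sum_finsetSum_index (by simp)
        (by simp), Finsupp.sum_single_index rfl]
      simp, by
      classical
      refine ⟨_, e.mem_faces, Finsupp.support_add.trans (Finset.union_subset
        (Finsupp.support_single_subset.trans (by simp)) ?_)⟩
      refine Finsupp.support_finsetSum.trans ?_
      intro v hv
      obtain ⟨i, -, hi⟩ := Finset.mem_biUnion.1 hv
      have := Finset.mem_singleton.1 (Finsupp.support_single_subset hi)
      simp [this]⟩

/-- The Borel structure on the realization of a countable locally finite complex: a set is
measurable if its preimages in all closed simplices are Borel sets. -/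
instance {V : Type*} (K : AbstractSimplicialComplex V) : MeasurableSpace (Realization K) :=
  ⨅ (n : ℕ) (e : OrderedSimplex K n), MeasurableSpace.map (chart e) inferInstance

/-! ## Riemannian metrics on finite simplicial complexes -/

/-- The closed simplex with vertex set `σ` in barycentric coordinates. -/
def closedSimplex {V : Type*} [Fintype V] (σ : Finset V) : Set (V → ℝ) :=
  {x | (∀ v, 0 ≤ x v) ∧ ∑ v, x v = 1 ∧ ∀ v ∉ σ, x v = 0}

/-- The tangent space of the simplex with vertex set `σ` (at any of its points). -/
def tangent {V : Type*} [Fintype V] (σ : Finset V) : Set (V → ℝ) :=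
  {w | ∑ v, w v = 0 ∧ ∀ v ∉ σ, w v = 0}

/-- A continuous piecewise smooth Riemannian metric on a finite simplicial complex: a smooth
Riemannian metric on every closed simplex, such that the metric on a simplex restricts on each face
to the metric of that face. Only the values of `form σ x` on tangent vectors of the simplex `σ` at
points `x` of `σ` matter. -/
structure RiemannianMetric {V : Type*} [Fintype V] (K : AbstractSimplicialComplex V) where
  form : Finset V → (V → ℝ) → LinearMap.BilinForm ℝ (V → ℝ)
  symm : ∀ σ ∈ K.faces, ∀ x ∈ closedSimplex σ, ∀ v ∈ tangent σ, ∀ w ∈ tangent σ,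
    form σ x v w = form σ x w v
  pos : ∀ σ ∈ K.faces, ∀ x ∈ closedSimplex σ, ∀ v ∈ tangent σ, v ≠ 0 → 0 < form σ x v v
  smooth : ∀ σ ∈ K.faces, ∀ v ∈ tangent σ, ∀ w ∈ tangent σ,
    ContDiffOn ℝ ∞ (fun x => form σ x v w) (closedSimplex σ)
  restrict : ∀ σ ∈ K.faces, ∀ τ ∈ K.faces, τ ⊆ σ → ∀ x ∈ closedSimplex τ,
    ∀ v ∈ tangent τ, ∀ w ∈ tangent τ, form σ x v w = form τ x v w

/-- The metric for which every simplex is a regular Euclidean simplex. -/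
instance {V : Type*} [Fintype V] (K : AbstractSimplicialComplex V) :
    Inhabited (RiemannianMetric K) := by
  classical
  exact ⟨{
    form := fun _ _ => Matrix.toBilin' 1
    symm := fun _ _ _ _ v _ w _ => by simp [Matrix.toBilin'_apply', dotProduct_comm]
    pos := fun _ _ _ _ v _ hv => by
      simp only [Matrix.toBilin'_apply', Matrix.one_mulVec]
      exact (dotProduct_self_star_nonneg v).lt_of_ne' (by simpa using hv)
    smooth := fun _ _ _ _ _ _ => contDiffOn_const
    restrict := fun _ _ _ _ _ _ _ _ _ _ _ => rfl }⟩

open scoped Classical in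
/-- The Riemannian volume density `√det (g(∂ᵢ, ∂ⱼ))` in the chart of the simplex with ordered
vertices `e 0, …, e n`. -/
def RiemannianMetric.density {V : Type*} [Fintype V] {K : AbstractSimplicialComplex V}
    (g : RiemannianMetric K) {n : ℕ} (e : Fin (n + 1) → V) (t : Fin n → ℝ) : ℝ :=
  √(Matrix.det (Matrix.of fun i j : Fin n =>
    g.form (Finset.univ.image e)
      (Pi.single (e 0) (1 - ∑ k, t k) + ∑ k, Pi.single (e k.succ) (t k))
      (Pi.single (e i.succ) 1 - Pi.single (e 0) 1)
      (Pi.single (e j.succ) 1 - Pi.single (e 0) 1)))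

/-! ## Connected finite complexes with a homomorphism from the fundamental group -/

/-- A connected finite simplicial complex `X` with a base point, and a group homomorphism
`φ : π₁(X) → π`. -/
structure MarkedComplex (π : Type v) [Group π] where
  V : Type u
  [fintype : Fintype V]
  K : AbstractSimplicialComplex V
  [connected : PathConnectedSpace (Realization K)]
  base : Realization K
  hom : FundamentalGroup (Realization K) base →* π

namespace MarkedComplex

variable {π : Type v} [Group π]

instance (A : MarkedComplex.{u} π) : Fintype A.V := A.fintype

instance (A : MarkedComplex.{u} π) : PathConnectedSpace (Realization A.K) := A.connected

/-- The dimension of the underlying complex. -/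
def dim (A : MarkedComplex.{u} π) : ℕ := dimension A.K

/-! ### The Galois covering associated to the kernel of the homomorphism -/

/-- Two homotopy classes of paths from the base point to `x` are equivalent if they differ by an
element of the kernel of `φ`. -/
def pathSetoid (A : MarkedComplex.{u} π) (x : Realization A.K) :
    Setoid (Path.Homotopic.Quotient A.base x) where
  r p q := A.hom (FundamentalGroup.fromPath (p.trans q.symm)) = 1
  iseqv := by
    refine ⟨fun p => ?_, fun {p q} h => ?_, fun {p q r} h h' => ?_⟩
    · rw [Path.Homotopic.Quotient.trans_symm]
      exact map_one A.hom
    · have : FundamentalGroup.fromPath (q.trans p.symm) =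
          (FundamentalGroup.fromPath (p.trans q.symm))⁻¹ := by
        refine eq_inv_of_mul_eq_one_left ?_
        rw [FundamentalGroup.mul_def, FundamentalGroup.one_def]
        change (p.trans q.symm).trans (q.trans p.symm) = _
        rw [Path.Homotopic.Quotient.trans_assoc, ← Path.Homotopic.Quotient.trans_assoc q.symm,
          Path.Homotopic.Quotient.symm_trans, Path.Homotopic.Quotient.refl_trans,
          Path.Homotopic.Quotient.trans_symm]
      rw [this, map_inv, h, inv_one]
    · have : FundamentalGroup.fromPath (p.trans r.symm) =
          FundamentalGroup.fromPath (q.trans r.symm) *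
            FundamentalGroup.fromPath (p.trans q.symm) := by
        rw [FundamentalGroup.mul_def]
        change _ = (p.trans q.symm).trans (q.trans r.symm)
        rw [Path.Homotopic.Quotient.trans_assoc, ← Path.Homotopic.Quotient.trans_assoc q.symm,
          Path.Homotopic.Quotient.symm_trans, Path.Homotopic.Quotient.refl_trans]
      rw [this, map_mul, h, h', one_mul]

/-- The vertices of the Galois covering: pairs of a vertex `v` of `X` and a class, modulo `ker φ`,
of paths from the base point to `v`. -/
structure CoverVertex (A : MarkedComplex.{u} π) where
  vert : A.V
  path : Quotient (A.pathSetoid (Realization.vertex A.K vert))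

/-- The vertices `a` and `b` of the Galois covering are the endpoints of a lift of the straight
path between the vertices of `X` below them. -/
def IsEdgeLift (A : MarkedComplex.{u} π) (a b : A.CoverVertex) : Prop :=
  ∃ (h : ∃ σ ∈ A.K.faces, a.vert ∈ σ ∧ b.vert ∈ σ)
    (p : Path.Homotopic.Quotient A.base (Realization.vertex A.K a.vert)),
    a.path = Quotient.mk _ p ∧
    b.path = Quotient.mk _ (p.trans (Path.Homotopic.Quotient.mk (Realization.edgePath h)))

theorem edgePath_self {V : Type*} {K : AbstractSimplicialComplex V} {v : V}
    (h : ∃ σ ∈ K.faces, v ∈ σ ∧ v ∈ σ) :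
    Realization.edgePath h = Path.refl (Realization.vertex K v) := by
  refine Path.ext (funext fun t => Realization.ext ?_)
  change (1 - (t : ℝ)) • Finsupp.single v (1 : ℝ) + (t : ℝ) • Finsupp.single v 1 =
    Finsupp.single v 1
  rw [← add_smul, sub_add_cancel, one_smul]

theorem isEdgeLift_self (A : MarkedComplex.{u} π) (a : A.CoverVertex) : A.IsEdgeLift a a := by
  obtain ⟨v, q⟩ := a
  obtain ⟨p, rfl⟩ := Quotient.exists_rep q
  refine ⟨⟨{v}, A.K.singleton_mem v, by simp, by simp⟩, p, rfl, ?_⟩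
  rw [edgePath_self, Path.Homotopic.Quotient.mk_refl, Path.Homotopic.Quotient.trans_refl]

open scoped Classical in
/-- The Galois covering of `X` associated to `ker φ`, with the lifted simplicial structure. -/
def cover (A : MarkedComplex.{u} π) : AbstractSimplicialComplex A.CoverVertex where
  faces := {s | s.image CoverVertex.vert ∈ A.K.faces ∧ ∀ a ∈ s, ∀ b ∈ s, A.IsEdgeLift a b}
  isRelLowerSet_faces := by
    rintro s ⟨hs, hab⟩
    refine ⟨Finset.image_nonempty.1 (A.K.isRelLowerSet_faces hs).1, fun t hts ht => ⟨?_, ?_⟩⟩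
    · exact (A.K.isRelLowerSet_faces hs).2 (Finset.image_subset_image hts) (ht.image _)
    · exact fun a ha b hb => hab a (hts ha) b (hts hb)
  singleton_mem a := by
    refine ⟨by simpa using A.K.singleton_mem a.vert, fun b hb c hc => ?_⟩
    rw [Finset.mem_singleton.1 hb, Finset.mem_singleton.1 hc]
    exact A.isEdgeLift_self a

/-- The covering projection. -/
def coverProj (A : MarkedComplex.{u} π) : SimplicialMap A.cover A.K where
  toFun := CoverVertex.vert
  image_mem := fun _ h => h.1

/-- The action on vertices of the deck transformation given by `α ∈ π₁(X)`: precomposition of paths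
with the loop `α`. The elements of `ker φ` act trivially, so that this is an action of the Galois
group `π₁(X) / ker φ`. -/
def deckVertex (A : MarkedComplex.{u} π) (α : FundamentalGroup (Realization A.K) A.base)
    (a : A.CoverVertex) : A.CoverVertex :=
  ⟨a.vert, Quotient.map (fun p => (FundamentalGroup.toPath α).trans p) (by
    intro p q h
    change A.hom (FundamentalGroup.fromPath _) = 1
    have : FundamentalGroup.fromPath (((FundamentalGroup.toPath α).trans p).trans
        ((FundamentalGroup.toPath α).trans q).symm) =
        α⁻¹ * FundamentalGroup.fromPath (p.trans q.symm) * α := by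
      simp only [FundamentalGroup.mul_def, FundamentalGroup.inv_def]
      have hs : ((FundamentalGroup.toPath α).trans q).symm =
          q.symm.trans (FundamentalGroup.toPath α).symm := by
        have h1 : ((FundamentalGroup.toPath α).trans q).trans
            (q.symm.trans (FundamentalGroup.toPath α).symm) =
              Path.Homotopic.Quotient.refl _ := by
          rw [Path.Homotopic.Quotient.trans_assoc, ← Path.Homotopic.Quotient.trans_assoc q,
            Path.Homotopic.Quotient.trans_symm, Path.Homotopic.Quotient.refl_trans,
            Path.Homotopic.Quotient.trans_symm]
        have h2 := congrArg (fun r => (((FundamentalGroup.toPath α).trans q).symm).trans r) h1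
        simp only [Path.Homotopic.Quotient.trans_refl] at h2
        rw [← Path.Homotopic.Quotient.trans_assoc, Path.Homotopic.Quotient.symm_trans,
          Path.Homotopic.Quotient.refl_trans] at h2
        exact h2.symm
      rw [hs]
      change _ = (FundamentalGroup.toPath α).trans
        ((p.trans q.symm).trans (FundamentalGroup.toPath α).symm)
      simp only [Path.Homotopic.Quotient.trans_assoc]
    have h' : A.hom (FundamentalGroup.fromPath (p.trans q.symm)) = 1 := h
    rw [this, map_mul, map_mul, h', mul_one, map_inv, inv_mul_cancel]) a.path⟩

/-- The simplicial deck transformation of the Galois covering given by `α ∈ π₁(X)`. -/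
def deck (A : MarkedComplex.{u} π) (α : FundamentalGroup (Realization A.K) A.base) :
    SimplicialMap A.cover A.cover where
  toFun := A.deckVertex α
  image_mem := by
    classical
    rintro s ⟨hs, hab⟩
    refine ⟨?_, ?_⟩
    · have : (s.image (A.deckVertex α)).image CoverVertex.vert = s.image CoverVertex.vert := by
        rw [Finset.image_image]; rfl
      convert hs using 1
    · intro a ha b hb
      obtain ⟨a, ha', rfl⟩ := Finset.mem_image.1 ha
      obtain ⟨b, hb', rfl⟩ := Finset.mem_image.1 hb
      obtain ⟨h, p, hp, hq⟩ := hab a ha' b hb'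
      refine ⟨h, (FundamentalGroup.toPath α).trans p, ?_, ?_⟩
      · simp only [deckVertex, hp]; rfl
      · simp only [deckVertex, hq, Path.Homotopic.Quotient.trans_assoc]; rfl

theorem exists_lift (A : MarkedComplex.{u} π) {n : ℕ} (e : OrderedSimplex A.K n) :
    ∃ e' : OrderedSimplex A.cover n, ∀ i, (e'.vert i).vert = e.vert i := by
  classical
  have hm : ∀ i, e.vert i ∈ Finset.univ.map e.vert := fun i => by simp
  have hE : ∀ i j, ∃ σ ∈ A.K.faces, e.vert i ∈ σ ∧ e.vert j ∈ σ := fun i j => ⟨_, e.mem_faces, hm i, hm j⟩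
  let p : Path.Homotopic.Quotient A.base (Realization.vertex A.K (e.vert 0)) :=
    Path.Homotopic.Quotient.mk (PathConnectedSpace.somePath _ _)
  let q : ∀ i, Path.Homotopic.Quotient A.base (Realization.vertex A.K (e.vert i)) := fun i =>
    p.trans (Path.Homotopic.Quotient.mk (Realization.edgePath (hE 0 i)))
  let f : Fin (n + 1) → A.CoverVertex := fun i => ⟨e.vert i, Quotient.mk _ (q i)⟩
  have hf : Function.Injective f := fun i j h => e.vert.injective (congrArg CoverVertex.vert h)
  have hs : ∀ i j (t), ((Realization.edgePath (hE i j)) t).coord.support ⊆ Finset.univ.map e.vert := by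
    intro i j t
    change ((1 - (t : ℝ)) • Finsupp.single (e.vert i) 1 +
      (t : ℝ) • Finsupp.single (e.vert j) 1 : A.V →₀ ℝ).support ⊆ _
    exact Finsupp.support_add.trans (Finset.union_subset
      (Finsupp.support_smul.trans (Finsupp.support_single_subset.trans (by simp)))
      (Finsupp.support_smul.trans (Finsupp.support_single_subset.trans (by simp))))
  refine ⟨⟨⟨f, hf⟩, ?_, ?_⟩, fun i => rfl⟩
  · convert e.mem_faces using 1
    rw [Finset.map_eq_image, Finset.image_image, Finset.map_eq_image]
    rfl
  · intro a ha b hb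
    obtain ⟨i, -, rfl⟩ := Finset.mem_map.1 ha
    obtain ⟨j, -, rfl⟩ := Finset.mem_map.1 hb
    refine ⟨hE i j, q i, rfl, ?_⟩
    change Quotient.mk _ (q j) = Quotient.mk _ ((q i).trans _)
    refine congrArg (Quotient.mk _) ?_
    change p.trans _ = (p.trans _).trans _
    rw [Path.Homotopic.Quotient.trans_assoc]
    refine congrArg p.trans ?_
    rw [← Path.Homotopic.Quotient.mk_trans]
    refine Path.Homotopic.Quotient.eq.2
      (Realization.homotopic_of_subset e.mem_faces _ _ (hs 0 j) ?_)
    intro t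
    rw [Path.trans_apply]
    split_ifs
    · exact hs 0 i _
    · exact hs i j _

/-- A lift to the Galois covering of a simplex of `X` with ordered vertices. -/
def lift (A : MarkedComplex.{u} π) {n : ℕ} (e : OrderedSimplex A.K n) : OrderedSimplex A.cover n :=
  Classical.choose (A.exists_lift e)

/-! ### The lifted metric: volume and distance -/

/-- The Riemannian volume of the lifted metric on the Galois covering: the sum over all
`n`-simplices of their Riemannian volumes, where `n` is the dimension. (Every `n`-simplex occurs
with its `(n+1)!` orderings, each of which contributes the same measure.) -/
def riemannianVolume (A : MarkedComplex.{u} π) (g : RiemannianMetric A.K) : Measure (Realization A.cover) :=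
  (Nat.factorial (A.dim + 1) : ℝ≥0∞)⁻¹ • Measure.sum fun e : OrderedSimplex A.cover A.dim =>
    Measure.map (chart e)
      ((Measure.comap Subtype.val (MeasureTheory.volume : Measure (Fin A.dim → ℝ))).withDensity
        fun t => ENNReal.ofReal (g.density (fun i => (e.vert i).vert) t.1))

/-- The Hilbert space of square-integrable functions on the Galois covering. -/
abbrev L2 (A : MarkedComplex.{u} π) (g : RiemannianMetric A.K) : Type u := Lp ℝ 2 (A.riemannianVolume g)

open scoped Classical in
/-- `HasCurve A g x y ℓ`: there is a piecewise continuously differentiable curve of length `ℓ`, with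
respect to the lifted metric, from `x` to `y` in the Galois covering. Each piece lies in a closed
simplex `σ` and is described by its projection `c` to `X`. -/
inductive HasCurve (A : MarkedComplex.{u} π) (g : RiemannianMetric A.K) :
    Realization A.cover → Realization A.cover → ℝ → Prop
  | refl (x : Realization A.cover) : HasCurve A g x x 0
  | step {x y z : Realization A.cover} {ℓ : ℝ} (h : HasCurve A g x y ℓ)
      (σ : Finset A.CoverVertex) (hσ : σ ∈ A.cover.faces) (c : ℝ → A.V → ℝ)
      (hc : ContDiffOn ℝ 1 c (Icc 0 1))
      (hmem : ∀ t ∈ Icc (0 : ℝ) 1, c t ∈ closedSimplex (σ.image CoverVertex.vert))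
      (hy : y.coord.support ⊆ σ) (hy' : ⇑(A.coverProj.map y).coord = c 0)
      (hz : z.coord.support ⊆ σ) (hz' : ⇑(A.coverProj.map z).coord = c 1) :
      HasCurve A g x z (ℓ + ∫ t in (0 : ℝ)..1, √(g.form (σ.image CoverVertex.vert) (c t)
        (derivWithin c (Icc 0 1) t) (derivWithin c (Icc 0 1) t)))

/-- The distance on the Galois covering with respect to the lifted metric. -/
def dist (A : MarkedComplex.{u} π) (g : RiemannianMetric A.K) (x y : Realization A.cover) : ℝ≥0∞ :=
  ⨅ (ℓ : ℝ) (_ : HasCurve A g x y ℓ), ENNReal.ofReal ℓ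

/-! ### The spherical volume -/

/-- The set `𝒩` of equivariant, Lipschitz continuous, non-negative maps from the Galois covering
to the unit sphere of its `L²` space. The Galois group acts on functions by
`(γ · f)(y) = f(γ⁻¹ y)`. -/
structure IsAdmissible (A : MarkedComplex.{u} π) (g : RiemannianMetric A.K)
    (F : Realization A.cover → A.L2 g) : Prop where
  norm_eq_one : ∀ x, ‖F x‖ = 1
  nonneg : ∀ x, ∀ᵐ y ∂(A.riemannianVolume g), 0 ≤ F x y
  equivariant : ∀ α x,
    ∀ᵐ y ∂(A.riemannianVolume g), F ((A.deck α).map x) y = F x ((A.deck α⁻¹).map y)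
  lipschitz : ∃ C : ℝ≥0, ∀ x y, edist (F x) (F y) ≤ C * A.dist g x y

open scoped Classical in
/-- The map `F` in the chart of a simplex (extended by zero to all of `ℝⁿ`). -/
def inChart (A : MarkedComplex.{u} π) {g : RiemannianMetric A.K} (F : Realization A.cover → A.L2 g)
    {n : ℕ} (e : OrderedSimplex A.cover n) (t : Fin n → ℝ) : A.L2 g :=
  if h : t ∈ corner n then F (chart e ⟨t, h⟩) else 0

/-- The matrix `(g^F(∂ᵢ, ∂ⱼ)) = (⟨DF ∂ᵢ, DF ∂ⱼ⟩)` of the metric `g^F` in the chart of a simplex.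
At the points where `F` is not differentiable we have `fderiv = 0`. -/
def gram (A : MarkedComplex.{u} π) {g : RiemannianMetric A.K} (F : Realization A.cover → A.L2 g)
    {n : ℕ} (e : OrderedSimplex A.cover n) (t : Fin n → ℝ) : Matrix (Fin n) (Fin n) ℝ :=
  Matrix.of fun i j => inner ℝ (fderiv ℝ (A.inChart F e) t (Pi.single i 1))
    (fderiv ℝ (A.inChart F e) t (Pi.single j 1))

/-- The volume `Vol(X, g^F)`. The metric `g^F` on a top-dimensional simplex of `X` is that of a lift
of the simplex. (Again every simplex occurs with its `(n+1)!` orderings.) -/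
def pullbackVolume (A : MarkedComplex.{u} π) {g : RiemannianMetric A.K}
    (F : Realization A.cover → A.L2 g) : ℝ≥0∞ :=
  (Nat.factorial (A.dim + 1) : ℝ≥0∞)⁻¹ * ∑' e : OrderedSimplex A.K A.dim,
    ∫⁻ t in interior (corner A.dim), ENNReal.ofReal √(A.gram F (A.lift e) t).det

/-- The spherical volume `T_φ(X)`, computed with the Riemannian metric `g`. -/
def sphericalVolume (A : MarkedComplex.{u} π) (g : RiemannianMetric A.K) : ℝ≥0∞ :=
  ⨅ (F : Realization A.cover → A.L2 g) (_ : A.IsAdmissible g F), A.pullbackVolume F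

end MarkedComplex

/-! ## The axioms -/

/-- A simplicial map `f` that preserves base points and satisfies `φ = ψ ∘ f_*`. -/
structure MarkedMap {π : Type v} [Group π] (A B : MarkedComplex.{u} π)
    extends SimplicialMap A.K B.K where
  map_base : toSimplicialMap.map A.base = B.base
  hom_eq : A.hom =
    B.hom.comp (FundamentalGroup.mapOfEq ⟨_, toSimplicialMap.continuous_map⟩ map_base)

/-- The homomorphism `π₁(X) / ker φ → π₁(Y) / ker ψ` of Galois groups induced by `f`. -/
def MarkedMap.galoisMap {π : Type v} [Group π] {A B : MarkedComplex.{u} π} (f : MarkedMap A B) :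
    (FundamentalGroup (Realization A.K) A.base ⧸ A.hom.ker) →*
      (FundamentalGroup (Realization B.K) B.base ⧸ B.hom.ker) :=
  QuotientGroup.map _ _ (FundamentalGroup.mapOfEq ⟨_, f.continuous_map⟩ f.map_base) (by
    intro x hx
    rw [MonoidHom.mem_ker, f.hom_eq] at hx
    exact hx)

open scoped Classical in
/-- `Y` is obtained from `X` by attaching a `k`-cell along a simplicial map `h : S^{k-1} → X`
(for some triangulation `L` of the sphere), the complex `Y` is triangulated such that `X` is a
subcomplex and the simplices outside `X` have dimension at most `k`, and `φ'` restricts to `φ` along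
the inclusion. The map `H` is the characteristic map of the cell. Existence of `φ'` means for
`k = 2` that `φ` vanishes on the boundary of the cell; for `k ≥ 2` such a `φ'` is unique. -/
def IsCellAttachment {π : Type v} [Group π] (k : ℕ) (A B : MarkedComplex.{u} π) : Prop :=
  ∃ ι : MarkedMap A B, Function.Injective ι.toFun ∧
    (∀ τ ∈ B.K.faces, (¬ ∃ σ ∈ A.K.faces, σ.image ι.toFun = τ) → τ.card ≤ k + 1) ∧
    ∃ (S : Type) (_ : Fintype S) (L : AbstractSimplicialComplex S)
      (s : Realization L ≃ₜ Metric.sphere (0 : EuclideanSpace ℝ (Fin k)) 1)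
      (h : SimplicialMap L A.K) (H : EuclideanSpace ℝ (Fin k) → Realization B.K),
      ContinuousOn H (Metric.closedBall 0 1) ∧
      (∀ x, H (s x) = ι.map (h.map x)) ∧
      BijOn H (Metric.ball 0 1) (range ι.map)ᶜ

/-- `B` is an extension of `A`: it is obtained by finitely many attachments of cells of dimension
`1 ≤ k < n`, where `n` is the dimension. -/
def IsExtension {π : Type v} [Group π] : MarkedComplex.{u} π → MarkedComplex.{u} π → Prop :=
  Relation.ReflTransGen fun A B => ∃ k, 1 ≤ k ∧ k < A.dim ∧ IsCellAttachment k A B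

/-- Invariants of connected finite simplicial complexes `X` with a homomorphism `φ : π₁(X) → π` to
an arbitrary group. -/
abbrev Invariant := ∀ {π : Type v} [Group π], MarkedComplex.{u} π → ℝ≥0∞

/-- The weak comparison axiom. -/
def WeakComparisonAxiom (I : Invariant.{u, v}) : Prop :=
  ∀ (π : Type v) [Group π] (A B : MarkedComplex.{u} π) (n d : ℕ) (f : MarkedMap A B),
    A.dim = n → B.dim = n → f.IsStrictlyMonotone n d → Function.Bijective f.galoisMap →
      I A ≤ d * I B

/-- The covering axiom. -/
def CoveringAxiom (I : Invariant.{u, v}) : Prop :=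
  ∀ (π : Type v) [Group π] (A B : MarkedComplex.{u} π) (d : ℕ) (f : MarkedMap A B),
    IsCoveringMap f.map → (∀ y, (f.map ⁻¹' {y}).encard = d) → I A ≤ d * I B

/-- The zero axiom. -/
def ZeroAxiom (I : Invariant.{u, v}) : Prop :=
  ∀ (π : Type v) [Group π] (A B : MarkedComplex.{u} π) (n : ℕ) (f : MarkedMap A B),
    A.dim = n → B.dim = n → f.IsMonotone n 0 → I A = 0

/-- The extension axiom. -/
def ExtensionAxiom (I : Invariant.{u, v}) : Prop :=
  ∀ (π : Type v) [Group π] (A B : MarkedComplex.{u} π),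
    Function.Surjective A.hom → IsExtension A B → I B = I A

end SphericalVolume

end

/-! The `L²` space of the covering enters the spherical volume only as a Hilbert space with a cone
of non-negative functions and an isometric action of the Galois group. Equivariant maps can
therefore be moved between the `L²` spaces of different complexes, and most of the proof rests on
one transfer result.

`exists_embedding`: let the Galois groups of `M` and `N` be viewed as subgroups of `π`. If the first
has finite index in the second and `M` has positive dimension, there is a linear isometry from
`L²(Ñ)` to `L²(M̃)` that preserves non-negativity and commutes with the group of `M`. It has the
form `f ↦ √w · (f ∘ θ)`, with `θ` equivariant where `w ≠ 0`. On the open stars of the lifts of one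
vertex, `θ` is, up to the group, a function of a single barycentric coordinate. The distribution of
that coordinate dominates Lebesgue measure on an interval, so a suitable weight turns it into any
prescribed finite measure on a standard Borel space, such as the volume of a fundamental domain in
`Ñ`. Neither the two dimensions nor the metrics have to match.

Comparison (`sphericalVolume_le_mul`): if `F` competes for `Y`, then `Φ ∘ F ∘ f̃` competes for `X`.
Isometries and covering transformations preserve Gram determinants, simplices collapsed by `f`
contribute zero, and each `n`-simplex of `Y` is hit at most `d` times. This gives the weak
comparison axiom, where the two groups coincide in `π`, and the covering axiom, where monodromy on
the finite fibre gives finite index. In dimension zero every vertex simply has volume one.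

Zero axiom: barycentric interpolation between translates of one non-negative function, followed by
normalization, gives an equivariant map from `Ỹ` to the sphere of `L²(X̃)` (`exists_isTest`).
Composed with `f̃` it is degenerate on every `n`-simplex.

Extension axiom: the inclusion is `(n,1)`-monotone, so comparison gives one inequality. For the
other, a competitor on `X̃` is extended to `X̃'` (`IsTest.exists_extension`): a collar function
moves points into the cone over `X̃`, the competitor is extended homogeneously to this cone and
blended with an arbitrary equivariant map, and the result is normalized. Non-negativity keeps all
blends away from zero. Attaching cells of dimension below `n` adds no `n`-simplices, so the volume
is unchanged. -/

open MeasureTheory Set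
open scoped ENNReal NNReal ContDiff

noncomputable section

namespace SphericalVolume

/-! ## Simplicial maps and charts -/

section Simplicial

variable {V W Z : Type*} {K : AbstractSimplicialComplex V} {L : AbstractSimplicialComplex W}
  {M : AbstractSimplicialComplex Z}

namespace SimplicialMap

@[ext]
theorem ext' {f g : SimplicialMap K L} (h : f.toFun = g.toFun) : f = g := by
  cases f; cases g; cases h; rfl

/-- The identity as a simplicial map. -/
def id (K : AbstractSimplicialComplex V) : SimplicialMap K K where
  toFun := fun v => v
  image_mem := by
    intro σ hσ
    simpa using hσ

/-- The composition of simplicial maps. -/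
def comp (g : SimplicialMap L M) (f : SimplicialMap K L) : SimplicialMap K M where
  toFun := g.toFun ∘ f.toFun
  image_mem := by
    classical
    intro σ hσ
    have h := g.image_mem _ (f.image_mem σ hσ)
    rw [Finset.image_image] at h
    convert h

theorem map_comp (g : SimplicialMap L M) (f : SimplicialMap K L) (x : Realization K) :
    (g.comp f).map x = g.map (f.map x) :=
  Realization.ext (Finsupp.mapDomain_comp (v := x.coord) (f := f.toFun) (g := g.toFun))

theorem coord_map_of_injOn (f : SimplicialMap K L) {x : Realization K} {σ : Finset V}
    (hx : x.coord.support ⊆ σ) (hf : Set.InjOn f.toFun σ) {a : V} (ha : a ∈ σ) :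
    (f.map x).coord (f.toFun a) = x.coord a :=
  Finsupp.mapDomain_apply' (σ : Set V) x.coord (by exact_mod_cast hx) hf ha

theorem coord_map_of_notMem (f : SimplicialMap K L) {x : Realization K} {w : W}
    (hw : ∀ v ∈ x.coord.support, f.toFun v ≠ w) : (f.map x).coord w = 0 := by
  classical
  by_contra h
  have := Finsupp.mapDomain_support (Finsupp.mem_support_iff.2 h)
  obtain ⟨v, hv, rfl⟩ := Finset.mem_image.1 this
  exact hw v hv rfl

theorem support_map_subset [DecidableEq W] (f : SimplicialMap K L) {x : Realization K}
    {σ : Finset V} (hx : x.coord.support ⊆ σ) : (f.map x).coord.support ⊆ σ.image f.toFun :=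
  Finsupp.mapDomain_support.trans (Finset.image_subset_image hx)

theorem coord_le_coord_map (f : SimplicialMap K L) (x : Realization K) (v : V) :
    x.coord v ≤ (f.map x).coord (f.toFun v) := by
  classical
  change _ ≤ (Finsupp.mapDomain f.toFun x.coord) _
  by_cases hv : v ∈ x.coord.support
  · rw [Finsupp.mapDomain, Finsupp.sum_apply, Finsupp.sum]
    refine le_trans ?_ (Finset.single_le_sum (f := fun a => (Finsupp.single (f.toFun a) (x.coord a))
      (f.toFun v)) (fun a _ => ?_) hv)
    · simp
    · simp only [Finsupp.single_apply]
      split_ifs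
      · exact x.nonneg a
      · exact le_rfl
  · rw [Finsupp.notMem_support_iff.1 hv]
    exact (f.map x).nonneg _

/-- Barycentric coordinates are non-negative, so nothing cancels when they are added up over the
vertices with a common image. -/
theorem support_map [DecidableEq W] (f : SimplicialMap K L) (x : Realization K) :
    (f.map x).coord.support = x.coord.support.image f.toFun := by
  refine (f.support_map_subset subset_rfl).antisymm ?_
  intro w hw
  obtain ⟨v, hv, rfl⟩ := Finset.mem_image.1 hw
  have h0 := x.nonneg v
  have h1 := Finsupp.mem_support_iff.1 hv
  have := f.coord_le_coord_map x v
  exact Finsupp.mem_support_iff.2 (lt_of_lt_of_le (lt_of_le_of_ne h0 h1.symm) this).ne'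

theorem map_vertex (f : SimplicialMap K L) (v : V) :
    f.map (Realization.vertex K v) = Realization.vertex L (f.toFun v) :=
  Realization.ext Finsupp.mapDomain_single

end SimplicialMap

theorem Realization.support_mem_faces (x : Realization K) : x.coord.support ∈ K.faces := by
  obtain ⟨σ, hσ, h⟩ := x.exists_face
  refine (K.isRelLowerSet_faces hσ).2 h ?_
  by_contra h0
  have h1 := x.sum_eq_one
  rw [Finset.not_nonempty_iff_eq_empty] at h0
  simp [Finsupp.sum, h0] at h1

namespace OrderedSimplex

@[ext]
theorem ext' {n : ℕ} {e e' : OrderedSimplex K n} (h : ∀ i, e.vert i = e'.vert i) : e = e' := by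
  obtain ⟨a, ha⟩ := e
  obtain ⟨b, hb⟩ := e'
  obtain rfl : a = b := Function.Embedding.ext h
  rfl

/-- The vertex set of an ordered simplex. -/
def face {n : ℕ} (e : OrderedSimplex K n) : Finset V := Finset.univ.map e.vert

theorem vert_mem_face {n : ℕ} (e : OrderedSimplex K n) (i : Fin (n + 1)) : e.vert i ∈ e.face := by
  simp [face]

theorem card_face {n : ℕ} (e : OrderedSimplex K n) : e.face.card = n + 1 := by
  simp [face]

theorem face_mem {n : ℕ} (e : OrderedSimplex K n) : e.face ∈ K.faces := e.mem_faces

/-- The image of an ordered simplex under a simplicial map that is injective on it. -/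
def map {n : ℕ} (e : OrderedSimplex K n) (f : SimplicialMap K L)
    (h : Function.Injective (f.toFun ∘ e.vert)) : OrderedSimplex L n where
  vert := ⟨f.toFun ∘ e.vert, h⟩
  mem_faces := by
    classical
    have := f.image_mem _ e.mem_faces
    convert this using 1
    rw [Finset.map_eq_image, Finset.map_eq_image, Finset.image_image]
    rfl

/-- An enumeration of the vertices of a simplex. -/
theorem exists_face_eq {n : ℕ} {σ : Finset V} (hσ : σ ∈ K.faces) (h : σ.card = n + 1) :
    ∃ e : OrderedSimplex K n, e.face = σ := by
  classical
  have hf : Finset.univ.map ((σ.equivFinOfCardEq h).symm.toEmbedding.trans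
      (Function.Embedding.subtype _)) = σ := by
    ext v
    simp only [Finset.mem_map, Finset.mem_univ, true_and]
    constructor
    · rintro ⟨i, rfl⟩
      exact ((σ.equivFinOfCardEq h).symm i).2
    · intro hv
      exact ⟨σ.equivFinOfCardEq h ⟨v, hv⟩, by simp⟩
  exact ⟨⟨_, by rw [← hf] at hσ; exact hσ⟩, hf⟩

end OrderedSimplex

section Chart

variable {n : ℕ} (e : OrderedSimplex K n) (t : corner n)

theorem support_chart_subset : (chart e t).coord.support ⊆ e.face := by
  classical
  refine Finsupp.support_add.trans (Finset.union_subset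
    (Finsupp.support_single_subset.trans (by simp [OrderedSimplex.face])) ?_)
  refine Finsupp.support_finsetSum.trans ?_
  intro v hv
  obtain ⟨i, -, hi⟩ := Finset.mem_biUnion.1 hv
  have := Finset.mem_singleton.1 (Finsupp.support_single_subset hi)
  simp [this, OrderedSimplex.face]

theorem coord_chart_zero : (chart e t).coord (e.vert 0) = 1 - ∑ i, t.1 i := by
  classical
  change (Finsupp.single (e.vert 0) (1 - ∑ i, t.1 i) +
      ∑ i, Finsupp.single (e.vert i.succ) (t.1 i) : V →₀ ℝ) _ = _
  rw [Finsupp.add_apply, Finsupp.finsetSum_apply, Finsupp.single_eq_same, add_eq_left]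
  refine Finset.sum_eq_zero fun i _ => ?_
  rw [Finsupp.single_apply, if_neg]
  exact fun h => Fin.succ_ne_zero i (e.vert.injective h)

theorem coord_chart_succ (i : Fin n) : (chart e t).coord (e.vert i.succ) = t.1 i := by
  classical
  change (Finsupp.single (e.vert 0) (1 - ∑ i, t.1 i) +
      ∑ i, Finsupp.single (e.vert i.succ) (t.1 i) : V →₀ ℝ) _ = _
  rw [Finsupp.add_apply, Finsupp.finsetSum_apply, Finsupp.single_apply, if_neg, zero_add,
    Finset.sum_eq_single i]
  · simp
  · intro j _ hj
    rw [Finsupp.single_apply, if_neg]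
    exact fun h => hj (Fin.succ_injective _ (e.vert.injective h))
  · simp
  · exact fun h => Fin.succ_ne_zero i (e.vert.injective h.symm)

theorem coord_chart_of_notMem {v : V} (hv : v ∉ e.face) : (chart e t).coord v = 0 :=
  Finsupp.notMem_support_iff.1 fun h => hv (support_chart_subset e t h)

theorem coord_map_chart (f : SimplicialMap K L) : (f.map (chart e t)).coord =
    Finsupp.single (f.toFun (e.vert 0)) (1 - ∑ i, t.1 i) +
      ∑ i, Finsupp.single (f.toFun (e.vert i.succ)) (t.1 i) := by
  change Finsupp.mapDomain f.toFun (Finsupp.single (e.vert 0) (1 - ∑ i, t.1 i) +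
      ∑ i, Finsupp.single (e.vert i.succ) (t.1 i)) = _
  rw [Finsupp.mapDomain_add, Finsupp.mapDomain_single, Finsupp.mapDomain_finsetSum]
  simp only [Finsupp.mapDomain_single]

theorem map_chart (f : SimplicialMap K L) (h : Function.Injective (f.toFun ∘ e.vert)) :
    f.map (chart e t) = chart (e.map f h) t :=
  Realization.ext (coord_map_chart e t f)

theorem measurable_chart : Measurable (chart e) := by
  rw [measurable_iff_le_map]
  exact iInf₂_le n e

end Chart

theorem measurable_of_chart {X : Type*} [MeasurableSpace X] {h : Realization K → X}
    (H : ∀ (n : ℕ) (e : OrderedSimplex K n), Measurable (h ∘ chart e)) : Measurable h := by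
  rw [measurable_iff_comap_le]
  refine le_iInf₂ fun n e => ?_
  rw [← measurable_iff_comap_le]
  intro s hs
  exact H n e hs

theorem measurable_coord_chart {n : ℕ} (e : OrderedSimplex K n) (v : V) :
    Measurable fun t => (chart e t).coord v := by
  by_cases hv : v ∈ e.face
  · obtain ⟨i, -, rfl⟩ := Finset.mem_map.1 hv
    refine Fin.cases ?_ (fun i => ?_) i
    · simp only [coord_chart_zero]
      fun_prop
    · simp only [coord_chart_succ]
      exact (measurable_pi_apply i).comp measurable_subtype_coe
  · simp only [coord_chart_of_notMem e _ hv]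
    exact measurable_const

theorem measurable_coord (v : V) : Measurable fun x : Realization K => x.coord v :=
  measurable_of_chart fun _ e => measurable_coord_chart e v

theorem SimplicialMap.measurable_map (f : SimplicialMap K L)
    (hf : ∀ (n : ℕ) (e : OrderedSimplex K n), Function.Injective (f.toFun ∘ e.vert)) :
    Measurable f.map := by
  refine measurable_of_chart fun n e => ?_
  have : f.map ∘ chart e = chart (e.map f (hf n e)) := funext fun t => map_chart e t f (hf n e)
  rw [this]
  exact measurable_chart _

end Simplicial

/-! ## Homotopy classes of paths -/

section Path

open Path.Homotopic

variable {X Y : Type*} [TopologicalSpace X] [TopologicalSpace Y]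

theorem trans_eq_of_symm {x y : X} {p q : Path.Homotopic.Quotient x y}
    (α : Path.Homotopic.Quotient x x) (h : p.trans q.symm = α) : p = α.trans q := by
  rw [← h, Quotient.trans_assoc, Quotient.symm_trans, Quotient.trans_refl]

theorem symm_trans_rev {x y z : X} (p : Path.Homotopic.Quotient x y)
    (q : Path.Homotopic.Quotient y z) : (p.trans q).symm = q.symm.trans p.symm := by
  have h1 : (p.trans q).trans (q.symm.trans p.symm) = Quotient.refl _ := by
    rw [Quotient.trans_assoc, ← Quotient.trans_assoc q, Quotient.trans_symm, Quotient.refl_trans,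
      Quotient.trans_symm]
  have h2 := congrArg (fun r => ((p.trans q).symm).trans r) h1
  simp only [Quotient.trans_refl] at h2
  rw [← Quotient.trans_assoc, Quotient.symm_trans, Quotient.refl_trans] at h2
  exact h2.symm

theorem map_trans {x y z : X} (p : Path.Homotopic.Quotient x y) (q : Path.Homotopic.Quotient y z)
    (f : C(X, Y)) : (p.trans q).map f = (p.map f).trans (q.map f) := by
  induction p using Path.Homotopic.Quotient.ind with | mk p =>
  induction q using Path.Homotopic.Quotient.ind with | mk q =>
  rw [← Quotient.mk_trans, ← Quotient.mk_map, ← Quotient.mk_map, ← Quotient.mk_map,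
    ← Quotient.mk_trans, Path.map_trans]

theorem map_symm {x y : X} (p : Path.Homotopic.Quotient x y)
    (f : C(X, Y)) : p.symm.map f = (p.map f).symm := by
  induction p using Path.Homotopic.Quotient.ind with | mk p =>
  rw [← Quotient.mk_symm, ← Quotient.mk_map, ← Quotient.mk_map, ← Quotient.mk_symm, Path.map_symm]

theorem cast_trans_cast {x y z x' y' z' : X} (p : Path.Homotopic.Quotient x y)
    (q : Path.Homotopic.Quotient y z) (hx : x' = x) (hy : y' = y) (hz : z' = z) :
    (p.cast hx hy).trans (q.cast hy hz) = (p.trans q).cast hx hz := by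
  subst hx hy hz
  simp

theorem cast_symm {x y x' y' : X} (p : Path.Homotopic.Quotient x y)
    (hx : x' = x) (hy : y' = y) : (p.cast hx hy).symm = p.symm.cast hy hx := by
  subst hx hy
  simp

end Path

/-! ## The action on the Galois covering -/

namespace MarkedComplex

variable {π : Type v} [Group π] (A : MarkedComplex.{u} π)

/-- Homotopy classes of paths from the base point to a vertex. -/
abbrev VertexPath (v : A.V) := Path.Homotopic.Quotient A.base (Realization.vertex A.K v)

/-- The vertex of the covering given by a homotopy class of paths. -/
def mkVertex (v : A.V) (p : A.VertexPath v) : A.CoverVertex := ⟨v, Quotient.mk _ p⟩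

theorem mkVertex_eq_iff {v : A.V} {p q : A.VertexPath v} :
    A.mkVertex v p = A.mkVertex v q ↔ A.hom (FundamentalGroup.fromPath (p.trans q.symm)) = 1 := by
  constructor
  · intro h
    have : (Quotient.mk (A.pathSetoid _) p) = Quotient.mk _ q := by
      simpa [mkVertex] using h
    exact Quotient.exact this
  · intro h
    have : (Quotient.mk (A.pathSetoid _) p) = Quotient.mk _ q := Quotient.sound h
    rw [mkVertex, this]
    rfl

theorem exists_mkVertex (a : A.CoverVertex) : ∃ p, a = A.mkVertex a.vert p := by
  obtain ⟨v, q⟩ := a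
  obtain ⟨p, rfl⟩ := Quotient.exists_rep q
  exact ⟨p, rfl⟩

theorem exists_vert_eq (v : A.V) : ∃ a : A.CoverVertex, a.vert = v :=
  ⟨A.mkVertex v (Path.Homotopic.Quotient.mk (PathConnectedSpace.somePath _ _)), rfl⟩

abbrev Loop := FundamentalGroup (Realization A.K) A.base

variable {A}

theorem deckVertex_mkVertex (α : A.Loop) (v : A.V) (p : A.VertexPath v) :
    A.deckVertex α (A.mkVertex v p) = A.mkVertex v ((FundamentalGroup.toPath α).trans p) := rfl

/-- Precomposition with loops is an action from the right. This is why `tr γ` is defined through a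
loop with image `γ⁻¹`: the result is a left action of the image of `φ`. -/
theorem deckVertex_mul (α β : A.Loop) (a : A.CoverVertex) :
    A.deckVertex (α * β) a = A.deckVertex β (A.deckVertex α a) := by
  obtain ⟨p, h⟩ := A.exists_mkVertex a
  rw [h, deckVertex_mkVertex, deckVertex_mkVertex, deckVertex_mkVertex]
  congr 1
  exact Path.Homotopic.Quotient.trans_assoc _ _ _

theorem deckVertex_one (a : A.CoverVertex) : A.deckVertex 1 a = a := by
  obtain ⟨p, h⟩ := A.exists_mkVertex a
  rw [h, deckVertex_mkVertex]
  congr 1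
  exact Path.Homotopic.Quotient.refl_trans _

theorem deckVertex_eq_self_iff (α : A.Loop) (a : A.CoverVertex) :
    A.deckVertex α a = a ↔ A.hom α = 1 := by
  obtain ⟨p, h⟩ := A.exists_mkVertex a
  rw [h, deckVertex_mkVertex, mkVertex_eq_iff, Path.Homotopic.Quotient.trans_assoc,
    Path.Homotopic.Quotient.trans_symm, Path.Homotopic.Quotient.trans_refl]

theorem deckVertex_eq_iff (α β : A.Loop) (a : A.CoverVertex) :
    A.deckVertex α a = A.deckVertex β a ↔ A.hom α = A.hom β := by
  rw [← div_eq_one (G := π), ← map_div, ← deckVertex_eq_self_iff _ a, div_eq_mul_inv,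
    deckVertex_mul]
  constructor
  · intro h
    rw [h, ← deckVertex_mul, mul_inv_cancel, deckVertex_one]
  · intro h
    have := congrArg (A.deckVertex β) h
    rwa [← deckVertex_mul, inv_mul_cancel, deckVertex_one] at this

theorem exists_deckVertex_eq {a b : A.CoverVertex} (h : a.vert = b.vert) :
    ∃ α : A.Loop, A.deckVertex α a = b := by
  obtain ⟨v, a⟩ := a
  obtain ⟨w, b⟩ := b
  obtain rfl : v = w := h
  obtain ⟨p, rfl⟩ := Quotient.exists_rep a
  obtain ⟨q, rfl⟩ := Quotient.exists_rep b
  refine ⟨FundamentalGroup.fromPath (q.trans p.symm), ?_⟩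
  change A.mkVertex v _ = A.mkVertex v q
  congr 1
  exact (trans_eq_of_symm _ rfl).symm

/-- Unique path lifting: appending the same edge to `p` and to `p'` does not change the loop that
compares them, which lies in `ker φ`. -/
theorem IsEdgeLift.unique {a b c : A.CoverVertex} (hb : A.IsEdgeLift a b) (hc : A.IsEdgeLift a c)
    (h : b.vert = c.vert) : b = c := by
  obtain ⟨w, b⟩ := b
  obtain ⟨w', c⟩ := c
  obtain rfl : w = w' := h
  obtain ⟨h1, p, hp, hq⟩ := hb
  obtain ⟨h2, p', hp', hq'⟩ := hc
  have e : A.mkVertex a.vert p = A.mkVertex a.vert p' := by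
    simp only [mkVertex, ← hp, ← hp']
  rw [mkVertex_eq_iff] at e
  have e2 : A.mkVertex w (p.trans (Path.Homotopic.Quotient.mk (Realization.edgePath h1))) =
      A.mkVertex w (p'.trans (Path.Homotopic.Quotient.mk (Realization.edgePath h1))) := by
    rw [mkVertex_eq_iff]
    convert e using 2
    rw [symm_trans_rev, Path.Homotopic.Quotient.trans_assoc, ← Path.Homotopic.Quotient.trans_assoc
      (Path.Homotopic.Quotient.mk (Realization.edgePath h1)), Path.Homotopic.Quotient.trans_symm,
      Path.Homotopic.Quotient.refl_trans]
  simp only at hq hq'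
  rw [hq, hq']
  exact e2

/-- Any edge of `X` lifts, with given starting point. -/
theorem exists_isEdgeLift (a : A.CoverVertex) {w : A.V} (h : ∃ σ ∈ A.K.faces, a.vert ∈ σ ∧ w ∈ σ) :
    ∃ b : A.CoverVertex, b.vert = w ∧ A.IsEdgeLift a b := by
  obtain ⟨v, q⟩ := a
  obtain ⟨p, rfl⟩ := Quotient.exists_rep q
  exact ⟨A.mkVertex w (p.trans (Path.Homotopic.Quotient.mk (Realization.edgePath h))), rfl,
    h, p, rfl, rfl⟩

theorem injOn_vert {σ : Finset A.CoverVertex} (hσ : σ ∈ A.cover.faces) :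
    Set.InjOn CoverVertex.vert (σ : Set A.CoverVertex) := fun a ha b hb h =>
  (hσ.2 a ha a ha).unique (hσ.2 a ha b hb) h

open scoped Classical in
/-- The covering transformation of `X̃` given by an element of the image of `φ`. -/
def tr (A : MarkedComplex.{u} π) (γ : π) : SimplicialMap A.cover A.cover :=
  if h : ∃ α, A.hom α = γ⁻¹ then A.deck h.choose else SimplicialMap.id _

theorem deck_eq_tr (α : A.Loop) {γ : π} (h : A.hom α = γ⁻¹) : A.deck α = A.tr γ := by
  have h' : ∃ α, A.hom α = γ⁻¹ := ⟨α, h⟩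
  rw [tr, dif_pos h']
  apply SimplicialMap.ext'
  funext a
  exact (deckVertex_eq_iff _ _ a).2 (h.trans h'.choose_spec.symm)

theorem tr_toFun (α : A.Loop) {γ : π} (h : A.hom α = γ⁻¹) (a : A.CoverVertex) :
    (A.tr γ).toFun a = A.deckVertex α a := by
  rw [← deck_eq_tr α h]; rfl

theorem exists_hom_eq {γ : π} (h : γ ∈ A.hom.range) : ∃ α, A.hom α = γ⁻¹ :=
  MonoidHom.mem_range.1 (inv_mem h)

theorem tr_vert (γ : π) (a : A.CoverVertex) : ((A.tr γ).toFun a).vert = a.vert := by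
  rw [tr]
  split_ifs <;> rfl

theorem tr_mul {γ δ : π} (hγ : γ ∈ A.hom.range) (hδ : δ ∈ A.hom.range) :
    A.tr (γ * δ) = (A.tr γ).comp (A.tr δ) := by
  obtain ⟨α, hα⟩ := exists_hom_eq hγ
  obtain ⟨β, hβ⟩ := exists_hom_eq hδ
  apply SimplicialMap.ext'
  funext a
  rw [tr_toFun (β * α) (by rw [map_mul, hα, hβ, mul_inv_rev]), deckVertex_mul]
  simp only [SimplicialMap.comp, Function.comp]
  rw [tr_toFun α hα, tr_toFun β hβ]

variable (A) in
theorem tr_one : A.tr 1 = SimplicialMap.id _ := by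
  apply SimplicialMap.ext'
  funext a
  rw [tr_toFun 1 (by rw [inv_one]; exact map_one A.hom), deckVertex_one]
  rfl

theorem tr_eq_iff {γ δ : π} (hγ : γ ∈ A.hom.range) (hδ : δ ∈ A.hom.range) (a : A.CoverVertex) :
    (A.tr γ).toFun a = (A.tr δ).toFun a ↔ γ = δ := by
  obtain ⟨α, hα⟩ := exists_hom_eq hγ
  obtain ⟨β, hβ⟩ := exists_hom_eq hδ
  rw [tr_toFun α hα, tr_toFun β hβ, deckVertex_eq_iff, hα, hβ, inv_inj]

theorem exists_tr_eq {a b : A.CoverVertex} (h : a.vert = b.vert) :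
    ∃ γ ∈ A.hom.range, (A.tr γ).toFun a = b := by
  obtain ⟨α, hα⟩ := exists_deckVertex_eq h
  exact ⟨(A.hom α)⁻¹, inv_mem ⟨α, rfl⟩, by rw [tr_toFun α (inv_inv _).symm, hα]⟩

theorem tr_inv_tr {γ : π} (hγ : γ ∈ A.hom.range) (a : A.CoverVertex) :
    (A.tr γ⁻¹).toFun ((A.tr γ).toFun a) = a := by
  have := congrArg (fun f => SimplicialMap.toFun f a) (tr_mul (inv_mem hγ) hγ)
  simp only [inv_mul_cancel, tr_one] at this
  exact this.symm

theorem tr_map_mul {γ δ : π} (hγ : γ ∈ A.hom.range) (hδ : δ ∈ A.hom.range)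
    (x : Realization A.cover) : (A.tr (γ * δ)).map x = (A.tr γ).map ((A.tr δ).map x) := by
  rw [tr_mul hγ hδ, SimplicialMap.map_comp]

variable (A) in
theorem tr_injective (γ : π) : Function.Injective (A.tr γ).toFun := by
  by_cases hγ : γ ∈ A.hom.range
  · exact Function.LeftInverse.injective (tr_inv_tr hγ)
  · have : ¬ ∃ α, A.hom α = γ⁻¹ := fun ⟨α, h⟩ => hγ (by
      rw [← inv_inv γ, ← h]; exact inv_mem ⟨α, rfl⟩)
    rw [tr, dif_neg this]
    exact fun _ _ h => h

theorem coord_tr_map (γ : π) (x : Realization A.cover) (a : A.CoverVertex) :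
    ((A.tr γ).map x).coord ((A.tr γ).toFun a) = x.coord a :=
  Finsupp.mapDomain_apply (A.tr_injective γ) _ _

theorem coverProj_tr_map (γ : π) (x : Realization A.cover) :
    A.coverProj.map ((A.tr γ).map x) = A.coverProj.map x := by
  rw [← SimplicialMap.map_comp]
  congr 1
  exact SimplicialMap.ext' (funext fun a => tr_vert γ a)

/-- The action of covering transformations on ordered simplices. -/
def trSimplex (γ : π) {n : ℕ} (e : OrderedSimplex A.cover n) : OrderedSimplex A.cover n :=
  e.map (A.tr γ) ((A.tr_injective γ).comp e.vert.injective)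

theorem trSimplex_vert (γ : π) {n : ℕ} (e : OrderedSimplex A.cover n) (i : Fin (n + 1)) :
    (trSimplex γ e).vert i = (A.tr γ).toFun (e.vert i) := rfl

theorem tr_map_chart (γ : π) {n : ℕ} (e : OrderedSimplex A.cover n) (t : corner n) :
    (A.tr γ).map (chart e t) = chart (trSimplex γ e) t := map_chart _ _ _ _

theorem trSimplex_mul {γ δ : π} (hγ : γ ∈ A.hom.range) (hδ : δ ∈ A.hom.range) {n : ℕ}
    (e : OrderedSimplex A.cover n) : trSimplex (γ * δ) e = trSimplex γ (trSimplex δ e) := by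
  apply OrderedSimplex.ext'
  intro i
  simp only [trSimplex_vert, tr_mul hγ hδ]
  rfl

theorem trSimplex_one {n : ℕ} (e : OrderedSimplex A.cover n) : trSimplex 1 e = e := by
  apply OrderedSimplex.ext'
  intro i
  simp only [trSimplex_vert, tr_one]
  rfl

theorem isEdgeLift_vert {n : ℕ} (e : OrderedSimplex A.cover n) (i j : Fin (n + 1)) :
    A.IsEdgeLift (e.vert i) (e.vert j) :=
  e.mem_faces.2 _ (by simp) _ (by simp)

/-- Every vertex of a lifted simplex is joined to a given one by an edge lift, and edge lifts are
unique. With transitivity on the fibres over vertices, this makes the Galois group act simply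
transitively on the lifts of an ordered simplex. -/
theorem simplex_eq_of_vert_eq {n : ℕ} {e e' : OrderedSimplex A.cover n}
    (h : ∀ i, (e.vert i).vert = (e'.vert i).vert) {i : Fin (n + 1)} (hi : e.vert i = e'.vert i) :
    e = e' := by
  apply OrderedSimplex.ext'
  intro j
  refine (isEdgeLift_vert e i j).unique ?_ (h j)
  rw [hi]
  exact isEdgeLift_vert e' i j

theorem trSimplex_eq_iff {γ δ : π} (hγ : γ ∈ A.hom.range) (hδ : δ ∈ A.hom.range) {n : ℕ}
    (e : OrderedSimplex A.cover n) : trSimplex γ e = trSimplex δ e ↔ γ = δ := by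
  refine ⟨fun h => ?_, fun h => by rw [h]⟩
  rw [← tr_eq_iff hγ hδ (e.vert 0), ← trSimplex_vert, h, trSimplex_vert]

theorem exists_trSimplex_eq {n : ℕ} {e e' : OrderedSimplex A.cover n}
    (h : ∀ i, (e.vert i).vert = (e'.vert i).vert) : ∃ γ ∈ A.hom.range, trSimplex γ e = e' := by
  obtain ⟨γ, hγ, h0⟩ := exists_tr_eq (h 0)
  exact ⟨γ, hγ, simplex_eq_of_vert_eq (i := 0) (fun i => (tr_vert _ _).trans (h i)) h0⟩

/-- The projection to `X` of a simplex of the covering. -/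
def projSimplex {n : ℕ} (e : OrderedSimplex A.cover n) : OrderedSimplex A.K n :=
  e.map A.coverProj fun i j h => e.vert.injective (injOn_vert e.mem_faces (by simp) (by simp) h)

theorem projSimplex_vert {n : ℕ} (e : OrderedSimplex A.cover n) (i : Fin (n + 1)) :
    (projSimplex e).vert i = (e.vert i).vert := rfl

theorem projSimplex_trSimplex (γ : π) {n : ℕ} (e : OrderedSimplex A.cover n) :
    projSimplex (trSimplex γ e) = projSimplex e :=
  OrderedSimplex.ext' fun i => tr_vert γ (e.vert i)

theorem lift_vert {n : ℕ} (e : OrderedSimplex A.K n) (i : Fin (n + 1)) :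
    ((A.lift e).vert i).vert = e.vert i := Classical.choose_spec (A.exists_lift e) i

theorem projSimplex_lift {n : ℕ} (e : OrderedSimplex A.K n) : projSimplex (A.lift e) = e :=
  OrderedSimplex.ext' fun i => lift_vert e i

/-- Simplices lift with a prescribed lift of one of the vertices. -/
theorem exists_lift_vert {n : ℕ} (e : OrderedSimplex A.K n) (i : Fin (n + 1)) {a : A.CoverVertex}
    (ha : a.vert = e.vert i) : ∃ e' : OrderedSimplex A.cover n, projSimplex e' = e ∧
      e'.vert i = a := by
  obtain ⟨γ, -, h⟩ := exists_tr_eq ((lift_vert e i).trans ha.symm)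
  exact ⟨trSimplex γ (A.lift e), by rw [projSimplex_trSimplex, projSimplex_lift], h⟩

end MarkedComplex

/-! ## Maps of Galois coverings -/

namespace MarkedMap

variable {π : Type v} [Group π] {A B : MarkedComplex.{u} π} (f : MarkedMap A B)

open MarkedComplex

/-- The continuous map underlying a simplicial map. -/
abbrev cmap : C(Realization A.K, Realization B.K) := ⟨f.map, f.continuous_map⟩

/-- The image of a path from the base point to a vertex. -/
def mapPath {v : A.V} (p : A.VertexPath v) : B.VertexPath (f.toFun v) :=
  (p.map f.cmap).cast f.map_base.symm (f.toSimplicialMap.map_vertex v).symm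

/-- This is where `φ = ψ ∘ f_*` enters: classes modulo `ker φ` go to classes modulo `ker ψ`, so the
map of coverings is well defined. -/
theorem hom_mapPath {v : A.V} (p q : A.VertexPath v) :
    B.hom (FundamentalGroup.fromPath ((f.mapPath p).trans (f.mapPath q).symm)) =
      A.hom (FundamentalGroup.fromPath (p.trans q.symm)) := by
  rw [f.hom_eq, MonoidHom.comp_apply]
  congr 1
  rw [FundamentalGroup.mapOfEq_apply, mapPath, mapPath, cast_symm, cast_trans_cast, ← map_symm,
    ← map_trans]

/-- The map of the vertices of the Galois coverings. -/
def coverVertexMap (a : A.CoverVertex) : B.CoverVertex :=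
  ⟨f.toFun a.vert, Quotient.map (fun p => f.mapPath p) (by
    intro p q h
    exact (f.hom_mapPath p q).trans h) a.path⟩

theorem coverVertexMap_mkVertex (v : A.V) (p : A.VertexPath v) :
    f.coverVertexMap (A.mkVertex v p) = B.mkVertex (f.toFun v) (f.mapPath p) := rfl

theorem isEdgeLift {a b : A.CoverVertex} (h : A.IsEdgeLift a b) :
    B.IsEdgeLift (f.coverVertexMap a) (f.coverVertexMap b) := by
  classical
  obtain ⟨v, a⟩ := a
  obtain ⟨w, b⟩ := b
  obtain ⟨h, p, hp, hq⟩ := h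
  change a = _ at hp
  change b = _ at hq
  change ∃ σ ∈ A.K.faces, v ∈ σ ∧ w ∈ σ at h
  obtain ⟨σ, hσ, hv, hw⟩ := id h
  have hB : σ.image f.toFun ∈ B.K.faces := by convert f.image_mem σ hσ
  have h' : ∃ σ ∈ B.K.faces, f.toFun v ∈ σ ∧ f.toFun w ∈ σ :=
    ⟨_, hB, Finset.mem_image_of_mem _ hv, Finset.mem_image_of_mem _ hw⟩
  refine ⟨h', f.mapPath p, by rw [hp]; rfl, ?_⟩
  rw [hq]
  change Quotient.mk _ (f.mapPath _) = _
  congr 1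
  have : ∀ h : ∃ σ ∈ A.K.faces, v ∈ σ ∧ w ∈ σ,
      ((Path.Homotopic.Quotient.mk (Realization.edgePath h)).map f.cmap).cast
      (f.toSimplicialMap.map_vertex v).symm (f.toSimplicialMap.map_vertex w).symm =
      Path.Homotopic.Quotient.mk (Realization.edgePath h') := by
    intro h
    rw [← Path.Homotopic.Quotient.mk_map, ← Path.Homotopic.Quotient.mk_cast]
    congr 1
    ext1
    funext t
    apply Realization.ext
    change Finsupp.mapDomain f.toFun
      ((1 - (t : ℝ)) • Finsupp.single v 1 + (t : ℝ) • Finsupp.single w 1) =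
      (1 - (t : ℝ)) • Finsupp.single (f.toFun v) 1 + (t : ℝ) • Finsupp.single (f.toFun w) 1
    rw [Finsupp.mapDomain_add, Finsupp.mapDomain_smul, Finsupp.mapDomain_smul,
      Finsupp.mapDomain_single, Finsupp.mapDomain_single]
  rw [mapPath, map_trans, ← cast_trans_cast _ _ _ (f.toSimplicialMap.map_vertex v).symm, this]
  rfl

/-- The map of the Galois coverings. -/
def coverMap : SimplicialMap A.cover B.cover where
  toFun := f.coverVertexMap
  image_mem := by
    classical
    rintro σ ⟨h1, h2⟩
    refine ⟨?_, ?_⟩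
    · have := f.image_mem _ h1
      convert this using 1
      rw [Finset.image_image, Finset.image_image]
      rfl
    · intro a ha b hb
      obtain ⟨a, ha', rfl⟩ := Finset.mem_image.1 ha
      obtain ⟨b, hb', rfl⟩ := Finset.mem_image.1 hb
      exact f.isEdgeLift (h2 a ha' b hb')

theorem coverMap_vert (a : A.CoverVertex) : (f.coverMap.toFun a).vert = f.toFun a.vert := rfl

theorem range_le (f : MarkedMap A B) : A.hom.range ≤ B.hom.range := by
  rintro _ ⟨α, rfl⟩
  rw [f.hom_eq]
  exact ⟨_, rfl⟩

/-- The loops `α` and `f_* α` have the same image in `π`. Labelling covering transformations by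
elements of `π` instead of loops lets the same `γ` act on both coverings. -/
theorem coverVertexMap_tr {γ : π} (hγ : γ ∈ A.hom.range) (a : A.CoverVertex) :
    f.coverVertexMap ((A.tr γ).toFun a) = (B.tr γ).toFun (f.coverVertexMap a) := by
  obtain ⟨α, hα⟩ := exists_hom_eq hγ
  rw [tr_toFun α hα, tr_toFun (FundamentalGroup.mapOfEq f.cmap f.map_base α) (by
    rw [← hα, f.hom_eq]; rfl)]
  obtain ⟨p, hp⟩ := A.exists_mkVertex a
  rw [hp, deckVertex_mkVertex, coverVertexMap_mkVertex, coverVertexMap_mkVertex,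
    deckVertex_mkVertex]
  congr 1
  rw [FundamentalGroup.mapOfEq_apply, mapPath, mapPath, map_trans, cast_trans_cast]

theorem coverMap_comp_tr {γ : π} (hγ : γ ∈ A.hom.range) :
    f.coverMap.comp (A.tr γ) = (B.tr γ).comp f.coverMap :=
  SimplicialMap.ext' (funext fun a => f.coverVertexMap_tr hγ a)

theorem coverMap_tr_map {γ : π} (hγ : γ ∈ A.hom.range) (x : Realization A.cover) :
    f.coverMap.map ((A.tr γ).map x) = (B.tr γ).map (f.coverMap.map x) := by
  rw [← SimplicialMap.map_comp, coverMap_comp_tr f hγ, SimplicialMap.map_comp]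

end MarkedMap

/-! ## Compactness estimates for Riemannian metrics -/

section ChartPoint

variable {V : Type*} {K : AbstractSimplicialComplex V} {n : ℕ} (e : OrderedSimplex K n)

open scoped Classical in
theorem image_vert : Finset.univ.image e.vert = e.face := by
  rw [OrderedSimplex.face, Finset.map_eq_image]

open scoped Classical in
/-- The affine chart of an ordered simplex in barycentric coordinates. -/
def chartPoint (t : Fin n → ℝ) : V → ℝ :=
  Pi.single (e.vert 0) (1 - ∑ k, t k) + ∑ k : Fin n, Pi.single (e.vert k.succ) (t k)

theorem continuous_chartPoint : Continuous (chartPoint e) := by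
  classical
  unfold chartPoint
  refine Continuous.add ?_ (continuous_finsetSum _ fun k _ => ?_)
  · exact (continuous_single (A := fun _ : V => ℝ) (e.vert 0)).comp (by fun_prop)
  · exact (continuous_single (A := fun _ : V => ℝ) (e.vert k.succ)).comp (continuous_apply k)

end ChartPoint

section Metric

variable {V : Type*} [Fintype V] {K : AbstractSimplicialComplex V}

theorem isCompact_closedSimplex (σ : Finset V) : IsCompact (closedSimplex σ) := by
  have h : closedSimplex σ = stdSimplex ℝ V ∩ ⋂ v, ⋂ (_ : v ∉ σ), {x | x v = 0} := by
    ext x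
    simp [closedSimplex, stdSimplex, and_assoc]
  rw [h]
  refine (isCompact_stdSimplex ℝ V).inter_right ?_
  exact isClosed_iInter fun v => isClosed_iInter fun _ =>
    isClosed_eq (continuous_apply v) continuous_const

theorem isClosed_tangent (σ : Finset V) : IsClosed (tangent σ) := by
  have h : tangent σ = {x | ∑ v, x v = 0} ∩ ⋂ v, ⋂ (_ : v ∉ σ), {x | x v = 0} := by
    ext x
    simp [tangent]
  rw [h]
  refine IsClosed.inter (isClosed_eq (by fun_prop) continuous_const) ?_
  exact isClosed_iInter fun v => isClosed_iInter fun _ =>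
    isClosed_eq (continuous_apply v) continuous_const

theorem smul_mem_tangent {σ : Finset V} {w : V → ℝ} (hw : w ∈ tangent σ) (r : ℝ) :
    r • w ∈ tangent σ := by
  refine ⟨?_, fun v hv => by simp [hw.2 v hv]⟩
  simp [← Finset.mul_sum, hw.1]

theorem sub_mem_tangent {σ : Finset V} {x y : V → ℝ} (hx : x ∈ closedSimplex σ)
    (hy : y ∈ closedSimplex σ) : x - y ∈ tangent σ :=
  ⟨by simp [hx.2.1, hy.2.1], fun v hv => by simp [hx.2.2 v hv, hy.2.2 v hv]⟩

theorem single_sub_single_mem_tangent [DecidableEq V] {σ : Finset V} {v w : V} (hv : v ∈ σ)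
    (hw : w ∈ σ) : (Pi.single v 1 - Pi.single w 1 : V → ℝ) ∈ tangent σ := by
  refine ⟨by simp, fun a ha => ?_⟩
  rw [Pi.sub_apply, Pi.single_eq_of_ne (by rintro rfl; exact ha hv),
    Pi.single_eq_of_ne (by rintro rfl; exact ha hw), sub_zero]

theorem tangent_eq_sum [DecidableEq V] {σ : Finset V} {v₀ : V} {w : V → ℝ}
    (hw : w ∈ tangent σ) : w = ∑ v ∈ σ, w v • (Pi.single v 1 - Pi.single v₀ 1 : V → ℝ) := by
  have h0 : ∑ v ∈ σ, w v = 0 := by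
    rw [← hw.1]
    exact Finset.sum_subset (Finset.subset_univ _) fun v _ hv => hw.2 v hv
  simp only [smul_sub, Finset.sum_sub_distrib, ← Finset.sum_smul, h0, zero_smul, sub_zero]
  funext a
  rw [Finset.sum_apply]
  by_cases ha : a ∈ σ
  · rw [Finset.sum_eq_single a (fun b _ hb => by simp [hb.symm]) (fun h => absurd ha h)]
    simp
  · rw [hw.2 a ha]
    refine (Finset.sum_eq_zero fun b hb => ?_).symm
    simp [show a ≠ b by rintro rfl; exact ha hb]

namespace RiemannianMetric

variable (g : RiemannianMetric K)

theorem continuousOn_form_apply {σ : Finset V} (hσ : σ ∈ K.faces) {v w : V → ℝ}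
    (hv : v ∈ tangent σ) (hw : w ∈ tangent σ) :
    ContinuousOn (fun x => g.form σ x v w) (closedSimplex σ) :=
  (g.smooth σ hσ v hv w hw).continuousOn

/-- Smoothness is only assumed for fixed tangent vectors. Joint continuity follows by expanding the
vector in the differences `e_v - e_{v₀}`. -/
theorem continuousOn_form {σ : Finset V} (hσ : σ ∈ K.faces) :
    ContinuousOn (fun q : (V → ℝ) × (V → ℝ) => g.form σ q.1 q.2 q.2)
      (closedSimplex σ ×ˢ tangent σ) := by
  classical
  obtain ⟨v₀, h₀⟩ := (K.isRelLowerSet_faces hσ).1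
  have h : ContinuousOn (fun q : (V → ℝ) × (V → ℝ) => ∑ v ∈ σ, ∑ w ∈ σ, q.2 v * (q.2 w *
      g.form σ q.1 (Pi.single v 1 - Pi.single v₀ 1) (Pi.single w 1 - Pi.single v₀ 1)))
      (closedSimplex σ ×ˢ tangent σ) := by
    refine continuousOn_finsetSum _ fun v hv => continuousOn_finsetSum _ fun w hw => ?_
    refine ContinuousOn.mul (by fun_prop) (ContinuousOn.mul (by fun_prop) ?_)
    exact (g.continuousOn_form_apply hσ (single_sub_single_mem_tangent hv h₀)
      (single_sub_single_mem_tangent hw h₀)).comp continuousOn_fst fun q hq => hq.1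
  refine h.congr fun q hq => ?_
  conv_lhs => rw [tangent_eq_sum (v₀ := v₀) hq.2]
  simp only [map_sum, LinearMap.sum_apply, map_smul, LinearMap.smul_apply, smul_eq_mul,
    Finset.mul_sum]
  rw [Finset.sum_comm]
  refine Finset.sum_congr rfl fun v _ => Finset.sum_congr rfl fun w _ => by ring

/-- The unit tangent vectors over a closed simplex form a compact set on which the Riemannian norm
is continuous and positive. Bounds for it and its inverse extend to all vectors by homogeneity. -/
theorem exists_sqrt_form_le_face {σ : Finset V} (hσ : σ ∈ K.faces) :
    ∃ C : ℝ, 0 ≤ C ∧ ∀ x ∈ closedSimplex σ, ∀ w ∈ tangent σ,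
      √(g.form σ x w w) ≤ C * ‖w‖ ∧ ‖w‖ ≤ C * √(g.form σ x w w) := by
  set S : Set ((V → ℝ) × (V → ℝ)) := closedSimplex σ ×ˢ (tangent σ ∩ Metric.sphere 0 1)
  have hS : IsCompact S := (isCompact_closedSimplex σ).prod
    ((isCompact_sphere 0 1).inter_left (isClosed_tangent σ))
  have hc : ContinuousOn (fun q : (V → ℝ) × (V → ℝ) => √(g.form σ q.1 q.2 q.2)) S :=
    ((g.continuousOn_form hσ).mono (prod_mono subset_rfl inter_subset_left)).sqrt
  have hp : ∀ q ∈ S, 0 < √(g.form σ q.1 q.2 q.2) := fun q hq =>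
    Real.sqrt_pos.2 (g.pos σ hσ _ hq.1 _ hq.2.1 (by
      intro h; have := hq.2.2; rw [h] at this; simp at this))
  obtain ⟨C₁, h₁⟩ := (hS.bddAbove_image hc)
  obtain ⟨C₂, h₂⟩ := (hS.bddAbove_image (hc.inv₀ fun q hq => (hp q hq).ne'))
  refine ⟨max 0 (max C₁ C₂), le_max_left _ _, fun x hx w hw => ?_⟩
  by_cases h : w = 0
  · simp [h]
  have hn : 0 < ‖w‖ := norm_pos_iff.2 h
  have hq : (x, ‖w‖⁻¹ • w) ∈ S := ⟨hx, smul_mem_tangent hw _, by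
    simp [norm_smul, hn.ne']⟩
  have e : √(g.form σ x w w) = ‖w‖ * √(g.form σ x (‖w‖⁻¹ • w) (‖w‖⁻¹ • w)) := by
    simp only [map_smul, LinearMap.smul_apply, smul_eq_mul]
    rw [← mul_assoc, Real.sqrt_mul (by positivity), Real.sqrt_mul_self (by positivity),
      mul_inv_cancel_left₀ hn.ne']
  set r := √(g.form σ x (‖w‖⁻¹ • w) (‖w‖⁻¹ • w))
  have hr : 0 < r := hp _ hq
  have b₁ : r ≤ C₁ := h₁ ⟨_, hq, rfl⟩
  have b₂ : r⁻¹ ≤ C₂ := h₂ ⟨_, hq, rfl⟩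
  rw [e]
  constructor
  · rw [mul_comm]
    gcongr
    exact b₁.trans ((le_max_left _ _).trans (le_max_right _ _))
  · have : r⁻¹ ≤ max 0 (max C₁ C₂) := b₂.trans ((le_max_right _ _).trans (le_max_right _ _))
    calc ‖w‖ = r⁻¹ * (‖w‖ * r) := by field_simp
      _ ≤ _ := by gcongr

theorem exists_sqrt_form_le :
    ∃ C : ℝ, 0 ≤ C ∧ ∀ σ ∈ K.faces, ∀ x ∈ closedSimplex σ, ∀ w ∈ tangent σ,
      √(g.form σ x w w) ≤ C * ‖w‖ ∧ ‖w‖ ≤ C * √(g.form σ x w w) := by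
  classical
  choose C h0 hC using fun σ : K.faces => g.exists_sqrt_form_le_face σ.2
  have h0' : 0 ≤ ∑ σ, C σ := Finset.sum_nonneg fun σ _ => h0 σ
  refine ⟨∑ σ, C σ, h0', fun σ hσ x hx w hw => ?_⟩
  have hle : C ⟨σ, hσ⟩ ≤ ∑ σ, C σ := Finset.single_le_sum (fun σ _ => h0 σ) (Finset.mem_univ _)
  obtain ⟨h1, h2⟩ := hC ⟨σ, hσ⟩ x hx w hw
  exact ⟨h1.trans (by gcongr), h2.trans (by gcongr)⟩

section Density

variable {n : ℕ} (e : OrderedSimplex K n)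

theorem chartPoint_mem {t : Fin n → ℝ} (ht : t ∈ corner n) :
    chartPoint e t ∈ closedSimplex e.face := by
  classical
  refine ⟨fun v => ?_, ?_, fun v hv => ?_⟩
  · rw [chartPoint, Pi.add_apply, Finset.sum_apply]
    refine add_nonneg ?_ (Finset.sum_nonneg fun i _ => ?_)
    · rw [Pi.single_apply]
      split_ifs
      · linarith [ht.2]
      · exact le_rfl
    · rw [Pi.single_apply]
      split_ifs
      · exact ht.1 i
      · exact le_rfl
  · simp only [chartPoint, Pi.add_apply, Finset.sum_apply, Finset.sum_add_distrib]
    rw [Finset.sum_comm]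
    simp
  · rw [chartPoint, Pi.add_apply, Finset.sum_apply, Pi.single_eq_of_ne, zero_add]
    · refine Finset.sum_eq_zero fun i _ => Pi.single_eq_of_ne ?_ _
      rintro rfl; exact hv (e.vert_mem_face _)
    · rintro rfl; exact hv (e.vert_mem_face _)

open scoped Classical in
theorem density_eq (t : Fin n → ℝ) : g.density e.vert t =
    √(Matrix.det (Matrix.of fun i j : Fin n => g.form e.face (chartPoint e t)
      (Pi.single (e.vert i.succ) 1 - Pi.single (e.vert 0) 1)
      (Pi.single (e.vert j.succ) 1 - Pi.single (e.vert 0) 1))) := by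
  rw [density, chartPoint, image_vert]

theorem continuousOn_density : ContinuousOn (g.density e.vert) (corner n) := by
  classical
  rw [funext (g.density_eq e)]
  refine ContinuousOn.sqrt ?_
  have h : ContinuousOn (fun t => Matrix.of fun i j : Fin n => g.form e.face (chartPoint e t)
      (Pi.single (e.vert i.succ) 1 - Pi.single (e.vert 0) 1)
      (Pi.single (e.vert j.succ) 1 - Pi.single (e.vert 0) 1)) (corner n) := by
    refine continuousOn_pi.2 fun i => continuousOn_pi.2 fun j => ?_
    exact (g.continuousOn_form_apply e.mem_faces
      (single_sub_single_mem_tangent (e.vert_mem_face _) (e.vert_mem_face _))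
      (single_sub_single_mem_tangent (e.vert_mem_face _) (e.vert_mem_face _))).comp
      (continuous_chartPoint e).continuousOn fun t ht => chartPoint_mem e ht
  exact (Continuous.matrix_det continuous_id).comp_continuousOn h

/-- The density is the root of the Gram determinant of linearly independent tangent vectors. Its
positivity allows it to be dropped in later arguments about null sets. -/
theorem density_pos {t : Fin n → ℝ} (ht : t ∈ corner n) : 0 < g.density e.vert t := by
  classical
  rw [density_eq]
  refine Real.sqrt_pos.2 (Matrix.PosDef.det_pos ?_)
  set u : Fin n → V → ℝ := fun i => Pi.single (e.vert i.succ) 1 - Pi.single (e.vert 0) 1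
  have hu : ∀ i, u i ∈ tangent e.face := fun i =>
    single_sub_single_mem_tangent (e.vert_mem_face _) (e.vert_mem_face _)
  refine Matrix.PosDef.of_dotProduct_mulVec_pos ?_ fun x hx => ?_
  · ext i j
    exact g.symm _ e.mem_faces _ (chartPoint_mem e ht) _ (hu j) _ (hu i)
  · have h1 : ∑ i, x i • u i ∈ tangent e.face := by
      refine ⟨?_, fun v hv => ?_⟩
      · simp only [Finset.sum_apply, Pi.smul_apply, smul_eq_mul]
        rw [Finset.sum_comm]
        exact Finset.sum_eq_zero fun i _ => by rw [← Finset.mul_sum, (hu i).1, mul_zero]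
      · simp only [Finset.sum_apply, Pi.smul_apply, smul_eq_mul]
        exact Finset.sum_eq_zero fun i _ => by rw [(hu i).2 v hv, mul_zero]
    have h2 : ∑ i, x i • u i ≠ 0 := by
      intro h
      apply hx
      funext j
      have h3 := congrFun h (e.vert j.succ)
      simp only [Finset.sum_apply, Pi.smul_apply, smul_eq_mul, u, Pi.sub_apply, Pi.zero_apply] at h3
      rw [Finset.sum_eq_single j] at h3
      · rw [Pi.single_eq_same, Pi.single_eq_of_ne (fun h => Fin.succ_ne_zero j (e.vert.injective h)),
          sub_zero, mul_one] at h3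
        exact h3
      · intro i _ hi
        rw [Pi.single_eq_of_ne (fun h => hi (Fin.succ_injective _ (e.vert.injective h)).symm),
          Pi.single_eq_of_ne (fun h => Fin.succ_ne_zero j (e.vert.injective h)), sub_zero, mul_zero]
      · simp
    have h4 := g.pos _ e.face_mem _ (chartPoint_mem e ht) _ h1 h2
    have h5 : g.form e.face (chartPoint e t) (∑ i, x i • u i) (∑ i, x i • u i) =
        star x ⬝ᵥ (Matrix.of fun i j : Fin n => g.form e.face (chartPoint e t) (u i) (u j)).mulVec x := by
      simp only [map_sum, LinearMap.sum_apply, map_smul, LinearMap.smul_apply, smul_eq_mul,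
        dotProduct, Matrix.mulVec, Matrix.of_apply, star_trivial, Finset.mul_sum]
      rw [Finset.sum_comm]
      exact Finset.sum_congr rfl fun i _ => Finset.sum_congr rfl fun j _ => by ring
    rw [h5] at h4
    exact h4

theorem isCompact_corner (n : ℕ) : IsCompact (corner n) := by
  have h : corner n = (fun x : Fin n → ℝ => x) ⁻¹' (Icc 0 1) ∩ {t | ∑ i, t i ≤ 1} := by
    ext t
    refine ⟨fun h => ⟨⟨h.1, fun i => ?_⟩, h.2⟩, fun h => ⟨h.1.1, h.2⟩⟩
    exact (Finset.single_le_sum (fun j _ => h.1 j) (Finset.mem_univ i)).trans h.2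
  rw [h]
  exact isCompact_Icc.inter_right (isClosed_le (by fun_prop) continuous_const)

theorem exists_density_le : ∃ C : ℝ, ∀ t ∈ corner n, g.density e.vert t ≤ C := by
  obtain ⟨C, hC⟩ := (isCompact_corner n).bddAbove_image (g.continuousOn_density e)
  exact ⟨C, fun t ht => hC ⟨t, ht, rfl⟩⟩

end Density

end RiemannianMetric

end Metric

/-! ## Lipschitz maps -/

/-- Maps that are Lipschitz continuous in barycentric coordinates, uniformly on all closed
simplices. -/
def SimplexLipschitz {V E : Type*} {K : AbstractSimplicialComplex V} [SeminormedAddCommGroup E]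
    (F : Realization K → E) : Prop :=
  ∃ C : ℝ, 0 ≤ C ∧ ∀ σ ∈ K.faces, ∀ x y : Realization K, x.coord.support ⊆ σ →
    y.coord.support ⊆ σ → ‖F x - F y‖ ≤ C * ∑ a ∈ σ, |x.coord a - y.coord a|

namespace MarkedComplex

variable {π : Type v} [Group π] {A : MarkedComplex.{u} π}

open scoped Classical in
theorem coverProj_mem_closedSimplex {σ : Finset A.CoverVertex} {x : Realization A.cover}
    (hx : x.coord.support ⊆ σ) :
    ⇑(A.coverProj.map x).coord ∈ closedSimplex (σ.image CoverVertex.vert) := by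
  refine ⟨(A.coverProj.map x).nonneg, ?_, fun v hv => ?_⟩
  · rw [← (A.coverProj.map x).sum_eq_one, Finsupp.sum_fintype _ _ (by simp)]
  · exact Finsupp.notMem_support_iff.1 fun h => hv (A.coverProj.support_map_subset hx h)

theorem coord_coverProj {σ : Finset A.CoverVertex} (hσ : σ ∈ A.cover.faces)
    {x : Realization A.cover} (hx : x.coord.support ⊆ σ) {a : A.CoverVertex} (ha : a ∈ σ) :
    (A.coverProj.map x).coord a.vert = x.coord a :=
  A.coverProj.coord_map_of_injOn hx (injOn_vert hσ) ha

theorem sum_abs_sub_le {σ : Finset A.CoverVertex} (hσ : σ ∈ A.cover.faces)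
    {x y : Realization A.cover} (hx : x.coord.support ⊆ σ) (hy : y.coord.support ⊆ σ) :
    ∑ a ∈ σ, |x.coord a - y.coord a| ≤
      Fintype.card A.V * ‖⇑(A.coverProj.map x).coord - ⇑(A.coverProj.map y).coord‖ := by
  classical
  have h1 : ∀ a ∈ σ, |x.coord a - y.coord a| ≤
      ‖⇑(A.coverProj.map x).coord - ⇑(A.coverProj.map y).coord‖ := fun a ha => by
    rw [← coord_coverProj hσ hx ha, ← coord_coverProj hσ hy ha, ← Real.norm_eq_abs]
    exact norm_le_pi_norm (⇑(A.coverProj.map x).coord - ⇑(A.coverProj.map y).coord) a.vert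
  refine (Finset.sum_le_sum h1).trans ?_
  rw [Finset.sum_const, nsmul_eq_mul]
  gcongr
  rw [← Finset.card_image_of_injOn (injOn_vert hσ)]
  exact Finset.card_le_univ _

theorem norm_coverProj_sub_le {σ : Finset A.CoverVertex}
    (hσ : σ ∈ A.cover.faces) {x y : Realization A.cover} (hx : x.coord.support ⊆ σ)
    (hy : y.coord.support ⊆ σ) :
    ‖⇑(A.coverProj.map x).coord - ⇑(A.coverProj.map y).coord‖ ≤
      ∑ a ∈ σ, |x.coord a - y.coord a| := by
  classical
  refine (pi_norm_le_iff_of_nonneg (Finset.sum_nonneg fun _ _ => abs_nonneg _)).2 fun v => ?_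
  by_cases hv : v ∈ σ.image CoverVertex.vert
  · obtain ⟨a, ha, rfl⟩ := Finset.mem_image.1 hv
    rw [Pi.sub_apply, coord_coverProj hσ hx ha, coord_coverProj hσ hy ha, Real.norm_eq_abs]
    exact Finset.single_le_sum (f := fun a => |x.coord a - y.coord a|)
      (fun _ _ => abs_nonneg _) ha
  · rw [Pi.sub_apply, (coverProj_mem_closedSimplex hx).2.2 v hv,
      (coverProj_mem_closedSimplex hy).2.2 v hv, sub_zero, norm_zero]
    exact Finset.sum_nonneg fun _ _ => abs_nonneg _

variable {E : Type*} [SeminormedAddCommGroup E] (g : RiemannianMetric A.K)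

/-- The straight segment between two points of a common simplex is an admissible curve, and its
Riemannian length is bounded by a multiple of its length in barycentric coordinates. -/
theorem simplexLipschitz_of_dist {F : Realization A.cover → E} {C : ℝ≥0}
    (hF : ∀ x y, edist (F x) (F y) ≤ C * A.dist g x y) : SimplexLipschitz F := by
  classical
  obtain ⟨D, hD, hD'⟩ := g.exists_sqrt_form_le
  refine ⟨C * D, by positivity, fun σ hσ x y hx hy => ?_⟩
  set p : A.V → ℝ := ⇑(A.coverProj.map x).coord
  set q : A.V → ℝ := ⇑(A.coverProj.map y).coord
  have hp : p ∈ closedSimplex (σ.image CoverVertex.vert) := coverProj_mem_closedSimplex hx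
  have hq : q ∈ closedSimplex (σ.image CoverVertex.vert) := coverProj_mem_closedSimplex hy
  set c : ℝ → A.V → ℝ := fun t => p + t • (q - p)
  have hc : ContDiffOn ℝ 1 c (Icc 0 1) := by
    apply ContDiff.contDiffOn
    fun_prop
  have hmem : ∀ t ∈ Icc (0 : ℝ) 1, c t ∈ closedSimplex (σ.image CoverVertex.vert) := by
    intro t ht
    refine ⟨fun v => ?_, ?_, fun v hv => ?_⟩
    · have h1 := hp.1 v
      have h2 := hq.1 v
      have : c t v = (1 - t) * p v + t * q v := by
        simp only [c, Pi.add_apply, Pi.smul_apply, Pi.sub_apply, smul_eq_mul]; ring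
      rw [this]
      have h3 : 0 ≤ 1 - t := by linarith [ht.2]
      have h4 := ht.1
      positivity
    · simp [c, Finset.sum_add_distrib, ← Finset.mul_sum, hp.2.1, hq.2.1]
    · simp [c, hp.2.2 v hv, hq.2.2 v hv]
  have hder : ∀ t ∈ Icc (0 : ℝ) 1, derivWithin c (Icc 0 1) t = q - p := by
    intro t ht
    have : HasDerivAt c (q - p) t := by
      have := ((hasDerivAt_id t).smul_const (q - p)).const_add p
      rwa [one_smul] at this
    exact this.hasDerivWithinAt.derivWithin (uniqueDiffOn_Icc zero_lt_one t ht)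
  have hcurve := HasCurve.step (HasCurve.refl (g := g) x) σ hσ c hc hmem hx (by simp [c, p]) hy
    (by simp [c, q])
  set ℓ : ℝ := 0 + ∫ t in (0 : ℝ)..1, √(g.form (σ.image CoverVertex.vert) (c t)
        (derivWithin c (Icc 0 1) t) (derivWithin c (Icc 0 1) t)) with hℓ
  have hle : ℓ ≤ D * ‖q - p‖ := by
    have := intervalIntegral.norm_integral_le_of_norm_le_const (a := 0) (b := 1)
      (C := D * ‖q - p‖) (f := fun t => √(g.form (σ.image CoverVertex.vert) (c t)
        (derivWithin c (Icc 0 1) t) (derivWithin c (Icc 0 1) t))) (by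
      intro t ht
      have ht' : t ∈ Icc (0 : ℝ) 1 := Ioc_subset_Icc_self (by simpa using ht)
      rw [hder t ht', Real.norm_of_nonneg (Real.sqrt_nonneg _)]
      exact (hD' _ hσ.1 _ (hmem t ht') _ (sub_mem_tangent hq hp)).1)
    rw [hℓ, zero_add]
    refine (le_abs_self _).trans ?_
    simpa using this
  have hdist : A.dist g x y ≤ ENNReal.ofReal (D * ‖q - p‖) :=
    (iInf₂_le ℓ hcurve).trans (ENNReal.ofReal_le_ofReal hle)
  have h1 := (hF x y).trans (mul_le_mul_right hdist _)
  rw [edist_dist, ← ENNReal.ofReal_coe_nnreal, ← ENNReal.ofReal_mul C.coe_nonneg,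
    ENNReal.ofReal_le_ofReal_iff (by positivity), dist_eq_norm] at h1
  rw [norm_sub_rev q p] at h1
  refine h1.trans ?_
  change (C : ℝ) * _ ≤ _
  rw [mul_assoc]
  gcongr
  exact norm_coverProj_sub_le hσ hx hy

/-- By induction over the pieces of a curve: the displacement in barycentric coordinates along a
piece is the integral of its velocity, hence at most a constant times its Riemannian length.
Together with the converse this removes the metric from the Lipschitz condition. -/
theorem exists_lipschitz_of_simplexLipschitz {F : Realization A.cover → E}
    (hF : SimplexLipschitz F) : ∃ C : ℝ≥0, ∀ x y, edist (F x) (F y) ≤ C * A.dist g x y := by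
  classical
  obtain ⟨D, hD, hD'⟩ := g.exists_sqrt_form_le
  obtain ⟨C, hC, hC'⟩ := hF
  set B : ℝ := C * (Fintype.card A.V * D)
  have hB : 0 ≤ B := by positivity
  have key : ∀ x y ℓ, A.HasCurve g x y ℓ → ‖F x - F y‖ ≤ B * ℓ := by
    intro x y ℓ h
    induction h with
    | refl => simp
    | @step y z ℓ h σ hσ c hc hmem hy hy' hz hz' ih =>
      have hcont : ContinuousOn (derivWithin c (Icc 0 1)) (Icc 0 1) :=
        hc.continuousOn_derivWithin (uniqueDiffOn_Icc zero_lt_one) le_rfl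
      have hd : ∀ t ∈ Icc (0 : ℝ) 1, HasDerivWithinAt c (derivWithin c (Icc 0 1) t) (Icc 0 1) t :=
        fun t ht => ((hc.differentiableOn one_ne_zero) t ht).hasDerivWithinAt
      -- The curve satisfies the affine equations of the closed simplex, and differentiating them
      -- gives the linear equations of its tangent space.
      have htan : ∀ t ∈ Icc (0 : ℝ) 1,
          derivWithin c (Icc 0 1) t ∈ tangent (σ.image CoverVertex.vert) := by
        intro t ht
        have hu := uniqueDiffOn_Icc (zero_lt_one (α := ℝ)) t ht
        have hv := hasDerivWithinAt_pi.1 (hd t ht)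
        refine ⟨?_, fun v hv' => ?_⟩
        · have h1 := HasDerivWithinAt.fun_sum (u := Finset.univ) fun v _ => hv v
          have h2 : HasDerivWithinAt (fun t => ∑ v, c t v) 0 (Icc 0 1) t :=
            (hasDerivWithinAt_const t _ (1 : ℝ)).congr (fun s hs => (hmem s hs).2.1)
              (hmem t ht).2.1
          exact (h1.derivWithin hu).symm.trans (h2.derivWithin hu)
        · have h2 : HasDerivWithinAt (fun t => c t v) 0 (Icc 0 1) t :=
            (hasDerivWithinAt_const t _ (0 : ℝ)).congr (fun s hs => (hmem s hs).2.2 v hv')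
              ((hmem t ht).2.2 v hv')
          exact ((hv v).derivWithin hu).symm.trans (h2.derivWithin hu)
      have hcs : ContinuousOn (fun t => √(g.form (σ.image CoverVertex.vert) (c t)
          (derivWithin c (Icc 0 1) t) (derivWithin c (Icc 0 1) t))) (Icc 0 1) := by
        refine ContinuousOn.sqrt ?_
        exact (g.continuousOn_form hσ.1).comp (f := fun t => (c t, derivWithin c (Icc 0 1) t))
          (hc.continuousOn.prodMk hcont) fun t ht => ⟨hmem t ht, htan t ht⟩
      have hftc : ∫ t in (0 : ℝ)..1, derivWithin c (Icc 0 1) t = c 1 - c 0 := by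
        refine intervalIntegral.integral_eq_sub_of_hasDerivAt_of_le zero_le_one hc.continuousOn
          (fun t ht => (hd t (Ioo_subset_Icc_self ht)).hasDerivAt (Icc_mem_nhds ht.1 ht.2)) ?_
        exact ContinuousOn.intervalIntegrable (by rwa [uIcc_of_le zero_le_one])
      have hlen : ‖c 1 - c 0‖ ≤ D * ∫ t in (0 : ℝ)..1, √(g.form (σ.image CoverVertex.vert) (c t)
          (derivWithin c (Icc 0 1) t) (derivWithin c (Icc 0 1) t)) := by
        rw [← hftc, ← intervalIntegral.integral_const_mul]
        refine intervalIntegral.norm_integral_le_of_norm_le zero_le_one ?_ ?_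
        · refine Filter.Eventually.of_forall fun t ht => ?_
          exact (hD' _ hσ.1 _ (hmem t (Ioc_subset_Icc_self ht)) _
            (htan t (Ioc_subset_Icc_self ht))).2
        · refine ContinuousOn.intervalIntegrable ?_
          rw [uIcc_of_le zero_le_one]
          exact continuousOn_const.mul hcs
      have h1 := hC' σ hσ y z hy hz
      have h2 := sum_abs_sub_le hσ hy hz
      rw [hy', hz', norm_sub_rev] at h2
      calc ‖F x - F z‖ ≤ ‖F x - F y‖ + ‖F y - F z‖ := norm_sub_le_norm_sub_add_norm_sub _ _ _
        _ ≤ B * ℓ + C * (Fintype.card A.V * (D * ∫ t in (0 : ℝ)..1,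
            √(g.form (σ.image CoverVertex.vert) (c t) (derivWithin c (Icc 0 1) t)
              (derivWithin c (Icc 0 1) t)))) := by
          refine add_le_add ih (h1.trans ?_)
          gcongr
          exact h2.trans (by gcongr)
        _ = _ := by simp only [B]; ring
  -- The added `1` makes the constant nonzero, so that it can be moved inside the infimum defining
  -- the distance, including the case of infinite distance.
  refine ⟨(B + 1).toNNReal, fun x y => ?_⟩
  change _ ≤ ENNReal.ofReal (B + 1) * _
  have hB1 : ENNReal.ofReal (B + 1) ≠ 0 := (ENNReal.ofReal_pos.2 (by positivity)).ne'
  rw [dist, ENNReal.mul_iInf_of_ne hB1 ENNReal.ofReal_ne_top]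
  refine le_iInf fun ℓ => ?_
  rw [ENNReal.mul_iInf_of_ne hB1 ENNReal.ofReal_ne_top]
  refine le_iInf fun h => ?_
  have hk := key x y ℓ h
  rw [edist_dist, ← ENNReal.ofReal_mul (by positivity), dist_eq_norm]
  refine ENNReal.ofReal_le_ofReal (hk.trans ?_)
  have hℓ : 0 ≤ ℓ := by
    clear hk
    induction h with
    | refl => exact le_rfl
    | step h σ hσ c hc hmem hy hy' hz hz' ih =>
      exact add_nonneg ih (intervalIntegral.integral_nonneg zero_le_one
        fun t _ => Real.sqrt_nonneg _)
  nlinarith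

end MarkedComplex

/-! ## Dimension -/

section Dimension

variable {V : Type*} [Finite V] {K : AbstractSimplicialComplex V}

theorem card_le_dimension {σ : Finset V} (hσ : σ ∈ K.faces) : σ.card ≤ dimension K + 1 := by
  have h : σ.card - 1 ≤ dimension K :=
    le_ciSup (f := fun σ : K.faces => σ.1.card - 1) (Set.finite_range _).bddAbove ⟨σ, hσ⟩
  omega

theorem exists_card_eq_dimension [Nonempty V] :
    ∃ σ ∈ K.faces, σ.card = dimension K + 1 := by
  have : Nonempty K.faces := ⟨⟨{Classical.arbitrary V}, K.singleton_mem _⟩⟩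
  obtain ⟨σ, hσ⟩ := exists_eq_ciSup_of_finite (f := fun σ : K.faces => σ.1.card - 1)
  refine ⟨σ.1, σ.2, ?_⟩
  have h1 : 0 < σ.1.card := Finset.card_pos.2 (K.isRelLowerSet_faces σ.2).1
  have h2 : σ.1.card - 1 = dimension K := hσ
  omega

theorem dimension_eq_of_le {m : ℕ} (h : ∀ σ ∈ K.faces, σ.card ≤ m + 1)
    (h' : ∃ σ ∈ K.faces, σ.card = m + 1) : dimension K = m := by
  obtain ⟨σ, hσ, hm⟩ := h'
  have h1 := card_le_dimension hσ
  have : Nonempty V := ⟨(K.isRelLowerSet_faces hσ).1.choose⟩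
  obtain ⟨τ, hτ, h2⟩ := exists_card_eq_dimension (K := K)
  have := h τ hτ
  omega

instance finite_orderedSimplex (n : ℕ) : Finite (OrderedSimplex K n) :=
  Finite.of_injective (β := Fin (n + 1) → V) (fun e => e.vert) fun _ _ h =>
    OrderedSimplex.ext' (congrFun h)

end Dimension

/-! ## The Riemannian volume of the Galois covering -/

/-- Lebesgue measure on the standard simplex. -/
def cornerMeasure (n : ℕ) : Measure (corner n) := Measure.comap Subtype.val volume

theorem measurableSet_corner (n : ℕ) : MeasurableSet (corner n) :=
  (RiemannianMetric.isCompact_corner n).isClosed.measurableSet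

theorem lintegral_cornerMeasure {n : ℕ} (f : (Fin n → ℝ) → ℝ≥0∞) :
    ∫⁻ t, f t.1 ∂cornerMeasure n = ∫⁻ t in corner n, f t :=
  lintegral_subtype_comap (measurableSet_corner n) f

instance isFiniteMeasure_cornerMeasure (n : ℕ) : IsFiniteMeasure (cornerMeasure n) := by
  refine ⟨?_⟩
  rw [← setLIntegral_one, Measure.restrict_univ, lintegral_cornerMeasure (fun _ => 1),
    setLIntegral_one]
  exact (RiemannianMetric.isCompact_corner n).measure_lt_top

section Density

variable {V : Type*} [Fintype V] {K : AbstractSimplicialComplex V} (g : RiemannianMetric K) {n : ℕ}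

/-- The Riemannian volume density in the chart of an ordered simplex. -/
def RiemannianMetric.edensity (e : OrderedSimplex K n) (t : corner n) : ℝ≥0∞ :=
  ENNReal.ofReal (g.density e.vert t.1)

theorem RiemannianMetric.measurable_edensity (e : OrderedSimplex K n) :
    Measurable (g.edensity e) :=
  (continuousOn_iff_continuous_domRestrict.1 (g.continuousOn_density e)).measurable.ennreal_ofReal

theorem RiemannianMetric.edensity_ne_zero (e : OrderedSimplex K n) (t : corner n) :
    g.edensity e t ≠ 0 :=
  (ENNReal.ofReal_pos.2 (g.density_pos e t.2)).ne'

theorem RiemannianMetric.lintegral_edensity_ne_top (e : OrderedSimplex K n) :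
    ∫⁻ t, g.edensity e t ∂cornerMeasure n ≠ ⊤ := by
  obtain ⟨C, hC⟩ := g.exists_density_le e
  have h : ∫⁻ t, g.edensity e t ∂cornerMeasure n ≤ ∫⁻ _, ENNReal.ofReal C ∂cornerMeasure n :=
    lintegral_mono fun t => ENNReal.ofReal_le_ofReal (hC t.1 t.2)
  rw [lintegral_const] at h
  exact ne_top_of_le_ne_top (ENNReal.mul_ne_top ENNReal.ofReal_ne_top (measure_ne_top _ _)) h

end Density

namespace MarkedComplex

variable {π : Type v} [Group π] {A : MarkedComplex.{u} π} (g : RiemannianMetric A.K)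

instance nonempty_V (A : MarkedComplex.{u} π) : Nonempty A.V :=
  ⟨(Realization.support_mem_faces A.base |> fun h => (A.K.isRelLowerSet_faces h).1).choose⟩

theorem lintegral_riemannianVolume {h : Realization A.cover → ℝ≥0∞} (hh : Measurable h) :
    ∫⁻ x, h x ∂A.riemannianVolume g = (Nat.factorial (A.dim + 1) : ℝ≥0∞)⁻¹ *
      ∑' e : OrderedSimplex A.cover A.dim,
        ∫⁻ t, g.edensity (projSimplex e) t * h (chart e t) ∂cornerMeasure A.dim := by
  rw [riemannianVolume, lintegral_smul_measure, lintegral_sum_measure, smul_eq_mul]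
  congr 1
  refine tsum_congr fun e => ?_
  rw [lintegral_map hh (measurable_chart e)]
  exact lintegral_withDensity_eq_lintegral_mul _ (g.measurable_edensity (projSimplex e))
    (hh.comp (measurable_chart e))

/-- The action of a covering transformation on simplices, as an equivalence. -/
def trSimplexEquiv {γ : π} (hγ : γ ∈ A.hom.range) (n : ℕ) :
    OrderedSimplex A.cover n ≃ OrderedSimplex A.cover n where
  toFun := trSimplex γ
  invFun := trSimplex γ⁻¹
  left_inv e := by rw [← trSimplex_mul (inv_mem hγ) hγ, inv_mul_cancel, trSimplex_one]
  right_inv e := by rw [← trSimplex_mul hγ (inv_mem hγ), mul_inv_cancel, trSimplex_one]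

theorem measurable_tr_map (γ : π) : Measurable (A.tr γ).map :=
  (A.tr γ).measurable_map fun _ e => (A.tr_injective γ).comp e.vert.injective

/-- The transformation permutes the simplices of the covering, and the density of each depends only
on its projection to `X`. -/
theorem measurePreserving_tr_map {γ : π} (hγ : γ ∈ A.hom.range) :
    MeasurePreserving (A.tr γ).map (A.riemannianVolume g) (A.riemannianVolume g) := by
  refine ⟨measurable_tr_map γ, Measure.ext_of_lintegral _ fun h hh => ?_⟩
  rw [lintegral_map hh (measurable_tr_map γ)]
  refine (lintegral_riemannianVolume g (hh.comp (measurable_tr_map γ))).trans ?_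
  rw [lintegral_riemannianVolume g hh,
    ← (trSimplexEquiv hγ A.dim).tsum_eq fun e =>
      ∫⁻ t, g.edensity (projSimplex e) t * h (chart e t) ∂cornerMeasure A.dim]
  congr 1
  refine tsum_congr fun e => lintegral_congr fun t => ?_
  change _ = g.edensity (projSimplex (trSimplex γ e)) t * h (chart (trSimplex γ e) t)
  rw [projSimplex_trSimplex, ← tr_map_chart]
  rfl

open scoped Classical in
/-- The unitary representation of the Galois group on the `L²` space of the covering. -/
def koop (γ : π) : A.L2 g →ₗᵢ[ℝ] A.L2 g :=
  if h : γ ∈ A.hom.range then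
    Lp.compMeasurePreservingₗᵢ ℝ (A.tr γ⁻¹).map (measurePreserving_tr_map g (inv_mem h))
  else LinearIsometry.id

variable {g}

theorem koop_ae {γ : π} (hγ : γ ∈ A.hom.range) (f : A.L2 g) :
    koop g γ f =ᵐ[A.riemannianVolume g] fun x => f ((A.tr γ⁻¹).map x) := by
  rw [koop, dif_pos hγ]
  exact Lp.coeFn_compMeasurePreserving f (measurePreserving_tr_map g (inv_mem hγ))

theorem koop_mul {γ δ : π} (hγ : γ ∈ A.hom.range) (hδ : δ ∈ A.hom.range) (f : A.L2 g) :
    koop g (γ * δ) f = koop g γ (koop g δ f) := by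
  refine Lp.ext ?_
  filter_upwards [koop_ae (mul_mem hγ hδ) f, koop_ae hγ (koop g δ f),
    (measurePreserving_tr_map g (inv_mem hγ)).quasiMeasurePreserving.ae (koop_ae hδ f)] with x h1 h2 h3
  rw [h1, h2, h3, mul_inv_rev, tr_map_mul (inv_mem hδ) (inv_mem hγ)]

theorem koop_nonneg {γ : π} (hγ : γ ∈ A.hom.range) {f : A.L2 g} (hf : 0 ≤ f) :
    0 ≤ koop g γ f := by
  rw [← Lp.coeFn_nonneg] at hf ⊢
  filter_upwards [koop_ae hγ f,
    (measurePreserving_tr_map g (inv_mem hγ)).quasiMeasurePreserving.ae hf] with x h1 h2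
  rw [h1]
  exact h2

/-- Two non-negative functions never point in opposite directions. All lower bounds for norms before
normalization rest on this. -/
theorem inner_nonneg {f h : A.L2 g} (hf : 0 ≤ f) (hh : 0 ≤ h) : 0 ≤ inner ℝ f h := by
  rw [← Lp.coeFn_nonneg] at hf hh
  rw [L2.inner_def]
  refine integral_nonneg_of_ae ?_
  filter_upwards [hf, hh] with x h1 h2
  change 0 ≤ inner ℝ (f x) (h x)
  rw [real_inner_eq_re_inner, RCLike.inner_apply]
  simpa using mul_nonneg h2 h1

/-- Equivariant Lipschitz maps from the covering of `B` to the non-negative part of the unit sphere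
of the `L²` space of the covering of `A`. -/
structure IsTest (A B : MarkedComplex.{u} π) (g : RiemannianMetric A.K)
    (F : Realization B.cover → A.L2 g) : Prop where
  norm_eq_one : ∀ x, ‖F x‖ = 1
  nonneg : ∀ x, 0 ≤ F x
  equivariant : ∀ γ ∈ A.hom.range, ∀ x, F ((B.tr γ).map x) = koop g γ (F x)
  lipschitz : SimplexLipschitz F

/-- Loops are replaced by elements of the image of `φ`, pointwise almost everywhere statements by
statements in `L²`, and the lifted metric by barycentric coordinates. From here on only `IsTest` is
used, which also allows source and target to come from different complexes. -/
theorem isAdmissible_iff {F : Realization A.cover → A.L2 g} :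
    A.IsAdmissible g F ↔ IsTest A A g F := by
  constructor
  · intro h
    refine ⟨h.norm_eq_one, fun x => (Lp.coeFn_nonneg _).1 (h.nonneg x), fun γ hγ x => ?_, ?_⟩
    · obtain ⟨α, hα⟩ := exists_hom_eq hγ
      refine Lp.ext ?_
      filter_upwards [h.equivariant α x, koop_ae hγ (F x)] with y h1 h2
      rw [← deck_eq_tr α hα, h1, h2, ← deck_eq_tr α⁻¹ (by rw [map_inv, hα])]
    · obtain ⟨C, hC⟩ := h.lipschitz
      exact simplexLipschitz_of_dist g hC
  · intro h
    refine ⟨h.norm_eq_one, fun x => (Lp.coeFn_nonneg _).2 (h.nonneg x), fun α x => ?_,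
      exists_lipschitz_of_simplexLipschitz g h.lipschitz⟩
    have hγ : (A.hom α)⁻¹ ∈ A.hom.range := inv_mem ⟨α, rfl⟩
    filter_upwards [koop_ae hγ (F x)] with y h1
    rw [deck_eq_tr α (inv_inv (A.hom α)).symm, h.equivariant _ hγ, h1,
      deck_eq_tr α⁻¹ (map_inv A.hom α)]
    rw [inv_inv]

end MarkedComplex

/-! ## Weighted pull-back of square-integrable functions -/

/-- The hypothesis says that `θ` carries `w μ` to `ν`. Preimages of null sets are thus null for `w
μ`, that is, null for `μ` away from the zeros of `w`. -/
theorem ae_weightedPullback {X Y : Type*} [MeasurableSpace X] [MeasurableSpace Y]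
    {μ : Measure X} {ν : Measure Y} {θ : X → Y} (hθ : Measurable θ) {w : X → ℝ≥0}
    (hw : Measurable w)
    (h : ∀ f : Y → ℝ≥0∞, Measurable f → ∫⁻ x, w x * f (θ x) ∂μ = ∫⁻ y, f y ∂ν)
    {p : Y → Prop} (hp : ∀ᵐ y ∂ν, p y) : ∀ᵐ x ∂μ, w x ≠ 0 → p (θ x) := by
  obtain ⟨s, hs, hsm, hs0⟩ := exists_measurable_superset_of_null (ae_iff.1 hp)
  have h1 := h (s.indicator 1) (measurable_one.indicator hsm)
  rw [lintegral_indicator_one hsm, hs0, lintegral_eq_zero_iff (by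
    exact hw.coe_nnreal_ennreal.mul ((measurable_one.indicator hsm).comp hθ))] at h1
  filter_upwards [h1] with x hx hwx
  by_contra hpx
  have : θ x ∈ s := hs hpx
  simp [this, hwx] at hx

/-- A measurable map that maps a weighted measure to another measure induces a positive isometric
embedding of `L²` spaces. -/
theorem exists_weightedPullback {X Y : Type*} [MeasurableSpace X] [MeasurableSpace Y]
    {μ : Measure X} {ν : Measure Y} {θ : X → Y} (hθ : Measurable θ) {w : X → ℝ≥0}
    (hw : Measurable w)
    (h : ∀ f : Y → ℝ≥0∞, Measurable f → ∫⁻ x, w x * f (θ x) ∂μ = ∫⁻ y, f y ∂ν) :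
    ∃ Φ : Lp ℝ 2 ν →ₗᵢ[ℝ] Lp ℝ 2 μ, ∀ f, Φ f =ᵐ[μ] fun x => √(w x : ℝ) * f (θ x) := by
  -- Identities between classes in `L²(ν)` can be pulled back only where `w ≠ 0`; elsewhere the
  -- factor `√w` makes both sides zero.
  have hq := fun p => ae_weightedPullback (p := p) hθ hw h
  have hmeas : ∀ f : Lp ℝ 2 ν, Measurable fun x => √(w x : ℝ) * f (θ x) := fun f =>
    hw.coe_nnreal_real.sqrt.mul ((Lp.stronglyMeasurable f).measurable.comp hθ)
  have hnorm : ∀ f : Lp ℝ 2 ν, eLpNorm (fun x => √(w x : ℝ) * f (θ x)) 2 μ = eLpNorm f 2 ν := by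
    intro f
    rw [eLpNorm_eq_lintegral_rpow_enorm_toReal two_ne_zero ENNReal.ofNat_ne_top,
      eLpNorm_eq_lintegral_rpow_enorm_toReal two_ne_zero ENNReal.ofNat_ne_top,
      ← h _ ((Lp.stronglyMeasurable f).measurable.enorm.pow_const _)]
    congr 1
    refine lintegral_congr fun x => ?_
    rw [enorm_mul, ENNReal.mul_rpow_of_nonneg _ _ (by simp)]
    congr 1
    rw [Real.enorm_eq_ofReal (Real.sqrt_nonneg _), ENNReal.toReal_ofNat, ENNReal.rpow_two,
      ← ENNReal.ofReal_pow (Real.sqrt_nonneg _), Real.sq_sqrt (w x).coe_nonneg]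
    exact ENNReal.ofReal_coe_nnreal
  have hmem : ∀ f : Lp ℝ 2 ν, MemLp (fun x => √(w x : ℝ) * f (θ x)) 2 μ := fun f =>
    ⟨(hmeas f).aestronglyMeasurable, by rw [hnorm]; exact (Lp.memLp f).2⟩
  refine ⟨{ toFun := fun f => (hmem f).toLp _
            map_add' := fun f₁ f₂ => Lp.ext ?_
            map_smul' := fun r f => Lp.ext ?_
            norm_map' := fun f => ?_ }, fun f => (hmem f).coeFn_toLp⟩
  · filter_upwards [(hmem (f₁ + f₂)).coeFn_toLp, (hmem f₁).coeFn_toLp, (hmem f₂).coeFn_toLp,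
      Lp.coeFn_add ((hmem f₁).toLp _) ((hmem f₂).toLp _), hq _ (Lp.coeFn_add f₁ f₂)]
      with x h1 h2 h3 h4 h5
    rw [h1, h4, Pi.add_apply, h2, h3]
    by_cases hx : w x = 0
    · simp [hx]
    · rw [h5 hx, Pi.add_apply, mul_add]
  · filter_upwards [(hmem (r • f)).coeFn_toLp, (hmem f).coeFn_toLp,
      Lp.coeFn_smul r ((hmem f).toLp _), hq _ (Lp.coeFn_smul r f)] with x h1 h2 h4 h5
    rw [h1, RingHom.id_apply, h4, Pi.smul_apply, h2]
    by_cases hx : w x = 0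
    · simp [hx]
    · rw [h5 hx, Pi.smul_apply, smul_eq_mul, smul_eq_mul]
      ring
  · change ‖(hmem f).toLp _‖ = ‖f‖
    rw [Lp.norm_toLp, hnorm, Lp.norm_def]

/-! ## The distribution of a barycentric coordinate -/

section Star

variable {V : Type*} [Fintype V] {K : AbstractSimplicialComplex V} (g : RiemannianMetric K)

/-- The distribution of the barycentric coordinate of a vertex with respect to the Riemannian
volume on the simplices. -/
def starMeasure (v₀ : V) (n : ℕ) : Measure ℝ :=
  (Nat.factorial (n + 1) : ℝ≥0∞)⁻¹ • Measure.sum fun e : OrderedSimplex K n =>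
    Measure.map (fun t => (chart e t).coord v₀) ((cornerMeasure n).withDensity (g.edensity e))

theorem lintegral_starMeasure (v₀ : V) (n : ℕ) {f : ℝ → ℝ≥0∞} (hf : Measurable f) :
    ∫⁻ s, f s ∂starMeasure g v₀ n = (Nat.factorial (n + 1) : ℝ≥0∞)⁻¹ *
      ∑' e : OrderedSimplex K n,
        ∫⁻ t, g.edensity e t * f ((chart e t).coord v₀) ∂cornerMeasure n := by
  rw [starMeasure, lintegral_smul_measure, lintegral_sum_measure, smul_eq_mul]
  congr 1
  refine tsum_congr fun e => ?_
  rw [lintegral_map hf (measurable_coord_chart e v₀)]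
  exact lintegral_withDensity_eq_lintegral_mul _ (g.measurable_edensity e)
    (hf.comp (measurable_coord_chart e v₀))

theorem factorial_inv_ne_top (n : ℕ) : (Nat.factorial n : ℝ≥0∞)⁻¹ ≠ ⊤ :=
  ENNReal.inv_ne_top.2 (by exact_mod_cast Nat.factorial_ne_zero n)

theorem factorial_inv_ne_zero (n : ℕ) : (Nat.factorial n : ℝ≥0∞)⁻¹ ≠ 0 :=
  ENNReal.inv_ne_zero.2 (ENNReal.natCast_ne_top _)

instance isFiniteMeasure_starMeasure (v₀ : V) (n : ℕ) : IsFiniteMeasure (starMeasure g v₀ n) := by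
  refine ⟨?_⟩
  have : Fintype (OrderedSimplex K n) := Fintype.ofFinite _
  rw [← setLIntegral_one, Measure.restrict_univ, lintegral_starMeasure g v₀ n measurable_const,
    tsum_fintype]
  refine ENNReal.mul_lt_top (factorial_inv_ne_top _).lt_top (ENNReal.sum_lt_top.2 fun e _ => ?_)
  simp only [mul_one]
  exact (g.lintegral_edensity_ne_top e).lt_top

/-- Lebesgue measure on a small interval is absolutely continuous with respect to the distribution
of the barycentric coordinate of a vertex of a simplex of positive dimension. -/
theorem absolutelyContinuous_starMeasure {n : ℕ} (e : OrderedSimplex K n) (i₀ : Fin n) :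
    volume.restrict (Ioo (0 : ℝ) (1 / 2)) ≪ starMeasure g (e.vert i₀.succ) n := by
  classical
  refine Measure.AbsolutelyContinuous.mk fun S hS h0 => ?_
  have h1 := lintegral_starMeasure g (e.vert i₀.succ) n (measurable_one.indicator hS)
  rw [lintegral_indicator_one hS, h0] at h1
  have h2 := (mul_eq_zero.1 h1.symm).resolve_left (factorial_inv_ne_zero _)
  have h3 := ENNReal.tsum_eq_zero.1 h2 e
  simp only [coord_chart_succ] at h3
  have hSm : MeasurableSet {t : Fin n → ℝ | t i₀ ∈ S} := measurable_pi_apply i₀ hS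
  have h3' := (lintegral_eq_zero_iff (by
    exact (g.measurable_edensity e).mul ((measurable_one.indicator hS).comp
      ((measurable_pi_apply i₀).comp measurable_subtype_coe)))).1 h3
  have h4 : ∫⁻ t, {t : Fin n → ℝ | t i₀ ∈ S}.indicator 1 t.1 ∂cornerMeasure n = 0 := by
    refine (lintegral_eq_zero_iff (by
      exact (measurable_one.indicator hSm).comp measurable_subtype_coe)).2 ?_
    filter_upwards [h3'] with t ht
    have := (mul_eq_zero.1 ht).resolve_left (g.edensity_ne_zero e t)
    simpa [indicator] using this
  rw [lintegral_cornerMeasure (fun t => {t : Fin n → ℝ | t i₀ ∈ S}.indicator 1 t),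
    lintegral_indicator_one hSm, Measure.restrict_apply hSm] at h4
  have hn : 0 < (n : ℝ) := by exact_mod_cast i₀.pos
  -- A box over `S ∩ (0, 1/2)` inside the corner: the other `n - 1` coordinates are below `1/(2n)`,
  -- so the total stays below `1`. As a subset of a null set it is null, and its other sides have
  -- positive length, so `S ∩ (0, 1/2)` is null.
  set s : Fin n → Set ℝ := fun i => if i = i₀ then S ∩ Ioo 0 (1 / 2) else Ioo 0 (1 / (2 * n))
  have hsub : Set.pi univ s ⊆ {t : Fin n → ℝ | t i₀ ∈ S} ∩ corner n := by
    intro t ht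
    have hti := ht i₀ (mem_univ _)
    simp only [s, if_true] at hti
    have hb : ∀ i, 0 ≤ t i ∧ t i ≤ (if i = i₀ then 1 / 2 else 0) + 1 / (2 * n) := by
      intro i
      have h := ht i (mem_univ _)
      by_cases hi : i = i₀
      · subst hi
        rw [if_pos rfl]
        refine ⟨hti.2.1.le, hti.2.2.le.trans ?_⟩
        have : 0 ≤ 1 / (2 * (n : ℝ)) := by positivity
        linarith
      · simp only [s, if_neg hi] at h
        rw [if_neg hi, zero_add]
        exact ⟨h.1.le, h.2.le⟩
    refine ⟨hti.1, fun i => (hb i).1, (Finset.sum_le_sum fun i _ => (hb i).2).trans ?_⟩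
    rw [Finset.sum_add_distrib, Finset.sum_ite_eq' Finset.univ i₀, Finset.sum_const,
      Finset.card_univ, Fintype.card_fin, nsmul_eq_mul, if_pos (Finset.mem_univ _)]
    apply le_of_eq
    field_simp
    norm_num
  have h5 := measure_mono_null hsub h4
  rw [volume_pi_pi, Finset.prod_eq_zero_iff] at h5
  obtain ⟨i, -, hi⟩ := h5
  by_cases hi' : i = i₀
  · simp only [s, if_pos hi'] at hi
    rwa [Measure.restrict_apply hS]
  · simp only [s, if_neg hi', Real.volume_Ioo] at hi
    rw [ENNReal.ofReal_eq_zero] at hi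
    have : 0 < 1 / (2 * (n : ℝ)) := by positivity
    linarith

end Star

/-- Finite measures on standard Borel spaces are weighted images of any finite measure on the line
that dominates Lebesgue measure on an interval. -/
theorem exists_weighted_map_eq {κ : Measure ℝ} [IsFiniteMeasure κ]
    (hκ : volume.restrict (Ioo (0 : ℝ) (1 / 2)) ≪ κ) {Z : Type*} [MeasurableSpace Z]
    [StandardBorelSpace Z] [Nonempty Z] (ν : Measure Z) [IsFiniteMeasure ν] :
    ∃ (ϑ : ℝ → Z) (W : ℝ → ℝ≥0), Measurable ϑ ∧ Measurable W ∧ W 0 = 0 ∧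
      ∀ f : Z → ℝ≥0∞, Measurable f → ∫⁻ s, W s * f (ϑ s) ∂κ = ∫⁻ z, f z ∂ν := by
  by_cases hν : ν = 0
  · refine ⟨fun _ => Classical.arbitrary Z, 0, measurable_const, measurable_const, rfl,
      fun f _ => ?_⟩
    simp [hν]
  have hν0 : ν univ ≠ 0 := by simpa using hν
  have hνt : ν univ ≠ ⊤ := measure_ne_top _ _
  have : IsProbabilityMeasure ((ν univ)⁻¹ • ν) := ⟨by
    rw [Measure.smul_apply, smul_eq_mul, ENNReal.inv_mul_cancel hν0 hνt]⟩
  -- Every probability measure on a standard Borel space is an image of Lebesgue measure on the unit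
  -- interval.
  obtain ⟨s, hs, hsν⟩ := Measure.exists_measurable_map_eq ((ν univ)⁻¹ • ν)
  set p : ℝ → unitInterval := Set.projIcc 0 1 zero_le_one
  have hp : Measurable p := continuous_projIcc.measurable
  set D := (volume.restrict (Ioo (0 : ℝ) (1 / 2))).rnDeriv κ
  have hD : Measurable D := Measure.measurable_rnDeriv _ _
  -- The density `D` turns `κ` into Lebesgue measure on `(0, 1/2)`, the `2` compensates for
  -- stretching this interval to `(0, 1)`, and `ν univ` undoes the normalization. Setting `W 0 = 0`
  -- will make the weight vanish outside the open stars.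
  set W : ℝ → ℝ≥0 := ({0}ᶜ : Set ℝ).indicator fun r => (2 * ν univ * D r).toNNReal
  have hW : Measurable W := by
    refine Measurable.indicator ?_ (measurableSet_singleton 0).compl
    exact (measurable_const.mul hD).ennreal_toNNReal
  have hϑ : Measurable fun r : ℝ => s (p (2 * r)) := hs.comp (hp.comp (by fun_prop))
  refine ⟨fun r => s (p (2 * r)), W, hϑ, hW, by simp [W], fun f hf => ?_⟩
  have hfp : Measurable fun r : ℝ => f (s (p r)) := hf.comp (hs.comp hp)
  have hfϑ : Measurable fun r : ℝ => f (s (p (2 * r))) := hf.comp hϑ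
  have hκW : ∫⁻ r, W r * f (s (p (2 * r))) ∂κ =
      ∫⁻ r, D r * (2 * ν univ * ({0}ᶜ : Set ℝ).indicator (fun r => f (s (p (2 * r)))) r) ∂κ := by
    refine lintegral_congr_ae ?_
    filter_upwards [Measure.rnDeriv_lt_top (volume.restrict (Ioo (0 : ℝ) (1 / 2))) κ] with r hr
    by_cases h0 : r = 0
    · simp [W, h0]
    · simp only [W, indicator, mem_compl_iff, mem_singleton_iff, h0, not_false_eq_true, if_true]
      rw [ENNReal.coe_toNNReal]
      · ring
      · exact ENNReal.mul_ne_top (ENNReal.mul_ne_top (by simp) hνt) hr.ne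
  rw [hκW, lintegral_rnDeriv_mul hκ]
  swap
  · exact (measurable_const.mul (hfϑ.indicator (measurableSet_singleton 0).compl)).aemeasurable
  rw [lintegral_const_mul _ (hfϑ.indicator (measurableSet_singleton 0).compl)]
  have h1 : ∫⁻ r in Ioo (0 : ℝ) (1 / 2),
      ({0}ᶜ : Set ℝ).indicator (fun r => f (s (p (2 * r)))) r =
      ∫⁻ r in Ioo (0 : ℝ) (1 / 2), f (s (p (2 * r))) := by
    refine setLIntegral_congr_fun measurableSet_Ioo fun r hr => ?_
    have : r ≠ 0 := hr.1.ne'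
    simp [indicator, this]
  have h2 : ∫⁻ r in Ioo (0 : ℝ) (1 / 2), f (s (p (2 * r))) =
      2⁻¹ * ∫⁻ r in Ioo (0 : ℝ) 1, f (s (p r)) := by
    have h3 := lintegral_map (μ := volume) (g := fun r : ℝ => 2 * r)
      (hfp.indicator (measurableSet_Ioo (a := (0 : ℝ)) (b := 1))) (by fun_prop)
    rw [Real.map_volume_mul_left two_ne_zero, lintegral_smul_measure,
      lintegral_indicator measurableSet_Ioo] at h3
    rw [abs_of_pos (by norm_num), ENNReal.ofReal_inv_of_pos two_pos, ENNReal.ofReal_ofNat,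
      smul_eq_mul] at h3
    rw [h3, ← lintegral_indicator measurableSet_Ioo]
    refine lintegral_congr fun r => ?_
    have : r ∈ Ioo (0 : ℝ) (1 / 2) ↔ 2 * r ∈ Ioo (0 : ℝ) 1 := by
      simp only [mem_Ioo]
      constructor <;> rintro ⟨h, h'⟩ <;> constructor <;> linarith
    simp only [indicator, this]
  have h4 : ∫⁻ r in Ioo (0 : ℝ) 1, f (s (p r)) = ∫⁻ t : unitInterval, f (s t) := by
    rw [setLIntegral_congr Ioo_ae_eq_Icc,
      ← lintegral_subtype_comap measurableSet_Icc fun r => f (s (p r))]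
    refine lintegral_congr fun t => ?_
    rw [show p t = t from projIcc_val zero_le_one t]
  rw [h1, h2, h4]
  have h5 : ∫⁻ t : unitInterval, f (s t) = (ν univ)⁻¹ * ∫⁻ z, f z ∂ν := by
    rw [← lintegral_map hf hs, hsν, lintegral_smul_measure, smul_eq_mul]
  rw [h5]
  have h6 : (2 : ℝ≥0∞) * 2⁻¹ = 1 := ENNReal.mul_inv_cancel (by simp) (by simp)
  have h7 := ENNReal.mul_inv_cancel hν0 hνt
  calc 2 * ν univ * (2⁻¹ * ((ν univ)⁻¹ * ∫⁻ z, f z ∂ν)) =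
      (2 * 2⁻¹) * (ν univ * (ν univ)⁻¹) * ∫⁻ z, f z ∂ν := by ring
    _ = _ := by rw [h6, h7, one_mul, one_mul]

namespace MarkedComplex

variable {π : Type v} [Group π]

/-! ## Fundamental domains of simplices -/

section Orbit

variable {M N : MarkedComplex.{u} π}

/-- The action of a subgroup of the Galois group together with orbit representatives enumerates
the simplices. -/
theorem lintegral_riemannianVolume_of_bijective (g : RiemannianMetric N.K)
    {G : Subgroup π} {J : Type*} {r : J → OrderedSimplex N.cover N.dim}
    (hr : Function.Bijective fun q : G × J => trSimplex (q.1 : π) (r q.2))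
    {h : Realization N.cover → ℝ≥0∞} (hh : Measurable h) :
    ∫⁻ x, h x ∂N.riemannianVolume g = ∑' γ : G, (Nat.factorial (N.dim + 1) : ℝ≥0∞)⁻¹ *
      ∑' j : J, ∫⁻ t, g.edensity (projSimplex (r j)) t *
        h ((N.tr γ).map (chart (r j) t)) ∂cornerMeasure N.dim := by
  rw [lintegral_riemannianVolume g hh, ENNReal.tsum_mul_left, ← (Equiv.ofBijective _ hr).tsum_eq,
    ENNReal.tsum_prod']
  simp only [Equiv.ofBijective_apply, projSimplex_trSimplex, tr_map_chart]

theorem bijective_trSimplex_of_projSimplex {n : ℕ}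
    {r : OrderedSimplex M.K n → OrderedSimplex M.cover n} (hr : ∀ e, projSimplex (r e) = e) :
    Function.Bijective fun q : M.hom.range × OrderedSimplex M.K n =>
      trSimplex (q.1 : π) (r q.2) := by
  constructor
  · rintro ⟨γ, e⟩ ⟨δ, e'⟩ h
    have h1 := congrArg projSimplex h
    simp only [projSimplex_trSimplex, hr] at h1
    subst h1
    have h2 := (trSimplex_eq_iff γ.2 δ.2 _).1 h
    rw [Subtype.ext h2]
  · intro e
    obtain ⟨γ, hγ, h⟩ := exists_trSimplex_eq (e := r (projSimplex e)) (e' := e) fun i => by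
      rw [← projSimplex_vert, hr, projSimplex_vert]
    exact ⟨(⟨γ, hγ⟩, projSimplex e), h⟩

/-- A subgroup of finite index of the Galois group has finitely many orbits of simplices. -/
theorem exists_orbit_representatives (n : ℕ) (hMN : M.hom.range ≤ N.hom.range)
    (hfin : (M.hom.range.subgroupOf N.hom.range).FiniteIndex) :
    ∃ (J : Type u) (_ : Finite J) (r : J → OrderedSimplex N.cover n),
      Function.Bijective fun q : M.hom.range × J => trSimplex (q.1 : π) (r q.2) := by
  let S : Setoid (OrderedSimplex N.cover n) :=
    { r := fun e e' => ∃ γ ∈ M.hom.range, trSimplex γ e = e'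
      iseqv := by
        refine ⟨fun e => ⟨1, one_mem _, trSimplex_one e⟩, ?_, ?_⟩
        · rintro e _ ⟨γ, hγ, rfl⟩
          exact ⟨γ⁻¹, inv_mem hγ, by
            rw [← trSimplex_mul (inv_mem (hMN hγ)) (hMN hγ), inv_mul_cancel, trSimplex_one]⟩
        · rintro e _ _ ⟨γ, hγ, rfl⟩ ⟨δ, hδ, rfl⟩
          exact ⟨δ * γ, mul_mem hδ hγ, trSimplex_mul (hMN hδ) (hMN hγ) e⟩ }
  refine ⟨Quotient S, ?_, Quotient.out, ?_, ?_⟩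
  · have : Finite (N.hom.range ⧸ M.hom.range.subgroupOf N.hom.range) :=
      Subgroup.finite_quotient_of_finiteIndex
    -- Orbits of a left action correspond to right cosets, while the quotient consists of left
    -- cosets. The inverse of the representative exchanges the two.
    refine Finite.of_surjective (α := (N.hom.range ⧸ M.hom.range.subgroupOf N.hom.range) ×
      OrderedSimplex N.K n) (fun q => Quotient.mk S (trSimplex
        ((q.1.out⁻¹ : N.hom.range) : π) (N.lift q.2))) ?_
    intro j
    obtain ⟨e, rfl⟩ := Quotient.exists_rep j
    obtain ⟨δ, hδ, hδe⟩ := exists_trSimplex_eq (e := N.lift (projSimplex e)) (e' := e)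
      fun i => by rw [lift_vert, projSimplex_vert]
    refine ⟨(QuotientGroup.mk (⟨δ, hδ⟩⁻¹ : N.hom.range), projSimplex e), Quotient.sound ?_⟩
    obtain ⟨β, hβ⟩ := QuotientGroup.mk_out_eq_mul (M.hom.range.subgroupOf N.hom.range)
      (⟨δ, hδ⟩⁻¹ : N.hom.range)
    refine ⟨β.1.1, β.2, ?_⟩
    simp only [hβ]
    rw [← trSimplex_mul β.1.2 (Subtype.prop _)]
    rw [show (β.1.1 : π) * ((⟨δ, hδ⟩⁻¹ * β.1 : N.hom.range)⁻¹ : N.hom.range) = δ by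
      simp]
    exact hδe
  · rintro ⟨γ, j⟩ ⟨δ, j'⟩ h
    simp only at h
    have h1 : j = j' := by
      rw [← Quotient.out_eq j, ← Quotient.out_eq j']
      refine Quotient.sound ⟨(δ : π)⁻¹ * γ, mul_mem (inv_mem δ.2) γ.2, ?_⟩
      rw [trSimplex_mul (inv_mem (hMN δ.2)) (hMN γ.2), h, ← trSimplex_mul (inv_mem (hMN δ.2))
        (hMN δ.2), inv_mul_cancel, trSimplex_one]
    subst h1
    have h2 := (trSimplex_eq_iff (hMN γ.2) (hMN δ.2) _).1 h
    rw [Subtype.ext h2]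
  · intro e
    obtain ⟨γ, hγ, h⟩ : S.r (Quotient.mk S e).out e := Quotient.mk_out (s := S) e
    exact ⟨(⟨γ, hγ⟩, Quotient.mk S e), h⟩

end Orbit

/-! ## Open stars -/

section Star

variable {M : MarkedComplex.{u} π}

/-- The barycentric coordinate of a vertex of `X`, on the covering. -/
def starCoord (v₀ : M.V) (x : Realization M.cover) : ℝ := (M.coverProj.map x).coord v₀

theorem starCoord_chart (v₀ : M.V) {n : ℕ} (e : OrderedSimplex M.cover n) (t : corner n) :
    starCoord v₀ (chart e t) = (chart (projSimplex e) t).coord v₀ := by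
  exact congrArg (fun y => y.coord v₀) (map_chart e t M.coverProj _)

theorem measurable_starCoord (v₀ : M.V) : Measurable (starCoord (M := M) v₀) :=
  measurable_of_chart fun n e => by
    have : starCoord v₀ ∘ chart e = fun t => (chart (projSimplex e) t).coord v₀ :=
      funext fun t => starCoord_chart v₀ e t
    rw [this]
    exact measurable_coord_chart _ _

theorem starCoord_tr_map (v₀ : M.V) (γ : π) (x : Realization M.cover) :
    starCoord v₀ ((M.tr γ).map x) = starCoord v₀ x := by
  rw [starCoord, coverProj_tr_map, starCoord]

theorem exists_coord_ne_zero {v₀ : M.V} {x : Realization M.cover} (h : starCoord v₀ x ≠ 0) :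
    ∃ a : M.CoverVertex, a.vert = v₀ ∧ x.coord a ≠ 0 := by
  by_contra! h'
  exact h (M.coverProj.coord_map_of_notMem fun a ha hav =>
    Finsupp.mem_support_iff.1 ha (h' a hav))

open scoped Classical in
/-- The element of the Galois group that maps `a₀` to the vertex in whose open star `x` lies. -/
def starElt (a₀ : M.CoverVertex) (x : Realization M.cover) : π :=
  if h : ∃ γ ∈ M.hom.range, x.coord ((M.tr γ).toFun a₀) ≠ 0 then h.choose else 1

/-- The vertices of a lifted simplex have distinct projections, so the open stars of the translates
of `a₀` are disjoint. -/
theorem eq_of_coord_tr_ne_zero {a₀ : M.CoverVertex} {x : Realization M.cover} {γ δ : π}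
    (hγ : γ ∈ M.hom.range) (hδ : δ ∈ M.hom.range) (h : x.coord ((M.tr γ).toFun a₀) ≠ 0)
    (h' : x.coord ((M.tr δ).toFun a₀) ≠ 0) : γ = δ := by
  rw [← tr_eq_iff hγ hδ a₀]
  refine injOn_vert x.support_mem_faces (Finsupp.mem_support_iff.2 h)
    (Finsupp.mem_support_iff.2 h') ?_
  rw [tr_vert, tr_vert]

theorem starElt_eq {a₀ : M.CoverVertex} {x : Realization M.cover} {γ : π} (hγ : γ ∈ M.hom.range)
    (h : x.coord ((M.tr γ).toFun a₀) ≠ 0) : starElt a₀ x = γ := by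
  have h' : ∃ γ ∈ M.hom.range, x.coord ((M.tr γ).toFun a₀) ≠ 0 := ⟨γ, hγ, h⟩
  rw [starElt, dif_pos h']
  exact eq_of_coord_tr_ne_zero h'.choose_spec.1 hγ h'.choose_spec.2 h

/-- If `x` lies in the star of `δ a₀`, then `γ x` lies in the star of `γ δ a₀`. Outside the stars
`starElt` has a default value and is not equivariant. -/
theorem starElt_tr_map {a₀ : M.CoverVertex} {x : Realization M.cover}
    (h : starCoord a₀.vert x ≠ 0) {γ : π} (hγ : γ ∈ M.hom.range) :
    starElt a₀ ((M.tr γ).map x) = γ * starElt a₀ x ∧ starElt a₀ x ∈ M.hom.range := by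
  obtain ⟨a, ha, hax⟩ := exists_coord_ne_zero h
  obtain ⟨δ, hδ, rfl⟩ := exists_tr_eq ha.symm
  rw [starElt_eq hδ hax]
  refine ⟨starElt_eq (mul_mem hγ hδ) ?_, hδ⟩
  rw [tr_mul hγ hδ]
  change ((M.tr γ).map x).coord ((M.tr γ).toFun ((M.tr δ).toFun a₀)) ≠ 0
  rwa [coord_tr_map]

/-- A simplex has at most one vertex over `a₀.vert`. Hence `starElt` is constant on the part of the
simplex in the star, and measurability of `starMap` can be checked chart by chart. -/
theorem starElt_chart {a₀ : M.CoverVertex} {n : ℕ} (e : OrderedSimplex M.cover n) :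
    ∃ γ : π, ∀ t, starCoord a₀.vert (chart e t) ≠ 0 → starElt a₀ (chart e t) = γ := by
  by_cases h : ∃ i, (e.vert i).vert = a₀.vert
  · obtain ⟨i, hi⟩ := h
    obtain ⟨γ, hγ, hγi⟩ := exists_tr_eq hi.symm
    refine ⟨γ, fun t ht => starElt_eq hγ ?_⟩
    obtain ⟨a, ha, hax⟩ := exists_coord_ne_zero ht
    have : a = (M.tr γ).toFun a₀ := by
      rw [hγi]
      refine injOn_vert e.face_mem (support_chart_subset e t (Finsupp.mem_support_iff.2 hax))
        (e.vert_mem_face i) (ha.trans hi.symm)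
    rwa [← this]
  · refine ⟨1, fun t ht => absurd ?_ h⟩
    obtain ⟨a, ha, hax⟩ := exists_coord_ne_zero ht
    obtain ⟨i, -, rfl⟩ := Finset.mem_map.1
      (support_chart_subset e t (Finsupp.mem_support_iff.2 hax))
    exact ⟨i, ha⟩

theorem starElt_chart_of_mem {a₀ : M.CoverVertex} {n : ℕ} {e : OrderedSimplex M.cover n}
    (he : a₀ ∈ e.face) {t : corner n} (ht : starCoord a₀.vert (chart e t) ≠ 0) :
    starElt a₀ (chart e t) = 1 := by
  refine starElt_eq (one_mem _) ?_
  obtain ⟨a, ha, hax⟩ := exists_coord_ne_zero ht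
  have : a = a₀ := injOn_vert e.face_mem
    (support_chart_subset e t (Finsupp.mem_support_iff.2 hax)) he ha
  rw [tr_one]
  rwa [this] at hax

/-- Lifts of all simplices, such that the lifts of the simplices that contain the image of a vertex
contain that vertex. -/
theorem exists_lift_star (a₀ : M.CoverVertex) (n : ℕ) :
    ∃ r : OrderedSimplex M.K n → OrderedSimplex M.cover n, (∀ e, projSimplex (r e) = e) ∧
      ∀ e, a₀.vert ∈ e.face → a₀ ∈ (r e).face := by
  have : ∀ e : OrderedSimplex M.K n, ∃ e' : OrderedSimplex M.cover n, projSimplex e' = e ∧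
      (a₀.vert ∈ e.face → a₀ ∈ e'.face) := by
    intro e
    by_cases h : a₀.vert ∈ e.face
    · obtain ⟨i, -, hi⟩ := Finset.mem_map.1 h
      obtain ⟨e', h1, h2⟩ := exists_lift_vert e i (a := a₀) hi.symm
      exact ⟨e', h1, fun _ => h2 ▸ e'.vert_mem_face i⟩
    · exact ⟨M.lift e, projSimplex_lift e, fun h' => absurd h' h⟩
  choose r h1 h2 using this
  exact ⟨r, h1, h2⟩

end Star

/-! ## Positive equivariant isometric embeddings -/

section Embedding

variable {M N : MarkedComplex.{u} π}

/-- The equivariant extension of a map defined on the star of a vertex. -/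
def starMap (N : MarkedComplex.{u} π) (a₀ : M.CoverVertex) (q : ℝ → Realization N.cover)
    (x : Realization M.cover) : Realization N.cover :=
  (N.tr (starElt a₀ x)).map (q (starCoord a₀.vert x))

open scoped Classical in
theorem measurable_starMap (a₀ : M.CoverVertex) {q : ℝ → Realization N.cover} (hq : Measurable q) :
    Measurable fun x => if starCoord a₀.vert x = 0 then q 0 else starMap N a₀ q x := by
  refine measurable_of_chart fun n e => ?_
  obtain ⟨γ, hγ⟩ := starElt_chart (a₀ := a₀) e
  have h : ((fun x => if starCoord a₀.vert x = 0 then q 0 else starMap N a₀ q x) ∘ chart e) =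
      fun t => if (chart (projSimplex e) t).coord a₀.vert = 0 then q 0 else
        (N.tr γ).map (q ((chart (projSimplex e) t).coord a₀.vert)) := by
    funext t
    simp only [Function.comp, ← starCoord_chart]
    split_ifs with h
    · rfl
    · rw [starMap, hγ t h]
  rw [h]
  refine Measurable.ite ?_ measurable_const ?_
  · exact measurable_coord_chart (projSimplex e) a₀.vert (measurableSet_singleton 0)
  · exact (measurable_tr_map γ).comp (hq.comp (measurable_coord_chart _ _))

/-- The transfer result behind the comparison inequalities. A fundamental domain of `Ñ` for the
group of `M` is parametrized by `J × corner`; finite index makes `J` finite and the volume `ν` of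
the domain finite. One barycentric coordinate on the star of `a₀` is mapped, with weights, onto `(J
× corner, ν)`, and this map is extended equivariantly to the disjoint translates of the star. -/
theorem exists_embedding (gM : RiemannianMetric M.K) (gN : RiemannianMetric N.K)
    (hM : 1 ≤ M.dim) (hMN : M.hom.range ≤ N.hom.range)
    (hfin : (M.hom.range.subgroupOf N.hom.range).FiniteIndex) :
    ∃ Φ : N.L2 gN →ₗᵢ[ℝ] M.L2 gM, (∀ f, 0 ≤ f → 0 ≤ Φ f) ∧
      ∀ γ ∈ M.hom.range, ∀ f, Φ (koop gN γ f) = koop gM γ (Φ f) := by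
  classical
  obtain ⟨σ, hσ, hσc⟩ := exists_card_eq_dimension (K := M.K)
  obtain ⟨e₀, -⟩ := OrderedSimplex.exists_face_eq hσ hσc
  change OrderedSimplex M.K M.dim at e₀
  -- Positive dimension provides a vertex whose barycentric coordinate is one of the chart
  -- coordinates `t i` and so varies continuously.
  set i₀ : Fin M.dim := ⟨0, hM⟩
  obtain ⟨a₀, ha₀⟩ := M.exists_vert_eq (e₀.vert i₀.succ)
  obtain ⟨J, hJ, r, hr⟩ := exists_orbit_representatives N.dim hMN hfin
  obtain ⟨l, hl, hl'⟩ := exists_lift_star a₀ M.dim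
  have hlb := bijective_trSimplex_of_projSimplex hl
  let _ : MeasurableSpace J := ⊤
  have : DiscreteMeasurableSpace J := ⟨fun _ => trivial⟩
  have : StandardBorelSpace (corner N.dim) := (measurableSet_corner N.dim).standardBorel
  have : Fintype J := Fintype.ofFinite J
  obtain ⟨τ, hτ, hτc⟩ := exists_card_eq_dimension (K := N.K)
  obtain ⟨e₁, -⟩ := OrderedSimplex.exists_face_eq hτ hτc
  have : Nonempty J := by
    obtain ⟨q, -⟩ := hr.2 (N.lift e₁)
    exact ⟨q.2⟩
  have : Nonempty (corner N.dim) := ⟨⟨0, fun _ => le_rfl, by simp⟩⟩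
  let νj : J → Measure (corner N.dim) := fun j =>
    (cornerMeasure N.dim).withDensity (gN.edensity (projSimplex (r j)))
  let ν : Measure (J × corner N.dim) := (Nat.factorial (N.dim + 1) : ℝ≥0∞)⁻¹ •
    Measure.sum fun j => (νj j).map (Prod.mk j)
  have hν : ∀ f : J × corner N.dim → ℝ≥0∞, Measurable f → ∫⁻ z, f z ∂ν =
      (Nat.factorial (N.dim + 1) : ℝ≥0∞)⁻¹ * ∑' j : J, ∫⁻ t, gN.edensity (projSimplex (r j)) t *
        f (j, t) ∂cornerMeasure N.dim := by
    intro f hf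
    rw [lintegral_smul_measure, lintegral_sum_measure, smul_eq_mul]
    congr 1
    refine tsum_congr fun j => ?_
    rw [lintegral_map hf measurable_prodMk_left]
    exact lintegral_withDensity_eq_lintegral_mul _ (gN.measurable_edensity _)
      (hf.comp measurable_prodMk_left)
  have : IsFiniteMeasure ν := by
    refine ⟨?_⟩
    rw [← setLIntegral_one, Measure.restrict_univ, hν _ measurable_const, tsum_fintype]
    refine ENNReal.mul_lt_top (factorial_inv_ne_top _).lt_top (ENNReal.sum_lt_top.2 fun j _ => ?_)
    simp only [mul_one]
    exact (gN.lintegral_edensity_ne_top _).lt_top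
  obtain ⟨ϑ, W, hϑ, hW, hW0, hWϑ⟩ := exists_weighted_map_eq
    (absolutelyContinuous_starMeasure gM e₀ i₀) ν
  rw [← ha₀] at hWϑ
  let ξ : J × corner N.dim → Realization N.cover := fun z => chart (r z.1) z.2
  have hξ : Measurable ξ := measurable_from_prod_countable_right fun j => measurable_chart (r j)
  set q : ℝ → Realization N.cover := fun s => ξ (ϑ s)
  have hq : Measurable q := hξ.comp hϑ
  set θ : Realization M.cover → Realization N.cover := fun x =>
    if starCoord a₀.vert x = 0 then q 0 else starMap N a₀ q x
  have hθ : Measurable θ := measurable_starMap a₀ hq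
  set w : Realization M.cover → ℝ≥0 := fun x => W (starCoord a₀.vert x)
  have hw : Measurable w := hW.comp (measurable_starCoord _)
  -- Both volumes split into the translates of fundamental domains under the group of `M`. The
  -- equality holds separately for every `γ`, by the choice of `ϑ` and `W`.
  have hint : ∀ f : Realization N.cover → ℝ≥0∞, Measurable f →
      ∫⁻ x, w x * f (θ x) ∂M.riemannianVolume gM = ∫⁻ y, f y ∂N.riemannianVolume gN := by
    intro f hf
    rw [lintegral_riemannianVolume_of_bijective gM hlb
        (h := fun x => w x * f (θ x)) (hw.coe_nnreal_ennreal.mul (hf.comp hθ)),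
      lintegral_riemannianVolume_of_bijective gN hr hf]
    refine tsum_congr fun γ => ?_
    have hfγ : Measurable fun y => f ((N.tr γ).map y) := hf.comp (measurable_tr_map _)
    rw [← hν (fun z => f ((N.tr γ).map (ξ z))) (hfγ.comp hξ),
      ← hWϑ (fun z => f ((N.tr γ).map (ξ z))) (hfγ.comp hξ), lintegral_starMeasure gM _ _
        (f := fun s => W s * f ((N.tr γ).map (ξ (ϑ s)))) (hW.coe_nnreal_ennreal.mul (hfγ.comp (hξ.comp hϑ)))]
    congr 1
    refine tsum_congr fun e => lintegral_congr fun t => ?_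
    rw [hl]
    congr 1
    simp only [w, starCoord_tr_map]
    have hs : starCoord a₀.vert (chart (l e) t) = (chart e t).coord a₀.vert := by
      rw [starCoord_chart, hl]
    by_cases h0 : starCoord a₀.vert (chart (l e) t) = 0
    · rw [← hs, h0, hW0]
      simp
    · rw [← hs]
      congr 2
      simp only [θ, starCoord_tr_map, if_neg h0, starMap]
      -- The lifts `l e` were chosen to contain `a₀` itself, so `starElt` is `1` on them and equals
      -- `γ` after translation by `γ`.
      have hmem : a₀.vert ∈ e.face := by
        by_contra hne
        exact h0 (by rw [hs]; exact coord_chart_of_notMem e t hne)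
      rw [(starElt_tr_map h0 γ.2).1, starElt_chart_of_mem (hl' e hmem) h0, mul_one]
  obtain ⟨Φ, hΦ⟩ := exists_weightedPullback hθ hw hint
  refine ⟨Φ, fun f hf => ?_, fun γ hγ f => Lp.ext ?_⟩
  · rw [← Lp.coeFn_nonneg] at hf ⊢
    filter_upwards [hΦ f, ae_weightedPullback hθ hw hint hf] with x h1 h2
    rw [h1]
    by_cases hx : w x = 0
    · simp [hx]
    · exact mul_nonneg (Real.sqrt_nonneg _) (h2 hx)
  · filter_upwards [hΦ (koop gN γ f), ae_weightedPullback hθ hw hint (koop_ae (hMN hγ) f),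
      koop_ae hγ (Φ f), (measurePreserving_tr_map gM (inv_mem hγ)).quasiMeasurePreserving.ae (hΦ f)]
      with x h1 h2 h3 h4
    rw [h1, h3, h4]
    simp only [w, starCoord_tr_map]
    by_cases hx : w x = 0
    · simp only [w] at hx
      simp [hx]
    · rw [h2 hx]
      have h0 : starCoord a₀.vert x ≠ 0 := by
        intro h0
        apply hx
        simp only [w, h0, hW0]
      simp only [θ, starCoord_tr_map, if_neg h0, starMap]
      obtain ⟨h5, h6⟩ := starElt_tr_map h0 (inv_mem hγ)
      rw [h5, tr_map_mul (inv_mem (hMN hγ)) (hMN h6)]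

end Embedding

end MarkedComplex

/-! ## Lipschitz maps in barycentric coordinates -/

section Lipschitz

variable {V W : Type*} {K : AbstractSimplicialComplex V} {L : AbstractSimplicialComplex W}

theorem SimplicialMap.coord_map_eq_sum [DecidableEq W] (f : SimplicialMap K L) {x : Realization K}
    {σ : Finset V} (hx : x.coord.support ⊆ σ) (w : W) :
    (f.map x).coord w = ∑ a ∈ σ, if f.toFun a = w then x.coord a else 0 := by
  change (Finsupp.mapDomain f.toFun x.coord) w = _
  rw [Finsupp.mapDomain, Finsupp.sum_apply, Finsupp.sum_of_support_subset _ hx _ (by simp)]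
  exact Finset.sum_congr rfl fun a _ => Finsupp.single_apply

/-- A simplicial map adds up coordinates, so by the triangle inequality it does not increase the
`ℓ¹` distance within a simplex; the constant is unchanged. -/
theorem SimplexLipschitz.comp_map {E : Type*} [SeminormedAddCommGroup E] {F : Realization L → E}
    (hF : SimplexLipschitz F) (f : SimplicialMap K L) :
    SimplexLipschitz fun x => F (f.map x) := by
  classical
  obtain ⟨C, hC, h⟩ := hF
  refine ⟨C, hC, fun σ hσ x y hx hy => ?_⟩
  have hσ' : σ.image f.toFun ∈ L.faces := by convert f.image_mem σ hσ
  refine (h _ hσ' _ _ (f.support_map_subset hx) (f.support_map_subset hy)).trans ?_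
  gcongr
  calc ∑ w ∈ σ.image f.toFun, |(f.map x).coord w - (f.map y).coord w|
      ≤ ∑ w ∈ σ.image f.toFun, ∑ a ∈ σ, if f.toFun a = w then |x.coord a - y.coord a| else 0 := by
        refine Finset.sum_le_sum fun w _ => ?_
        rw [f.coord_map_eq_sum hx, f.coord_map_eq_sum hy, ← Finset.sum_sub_distrib]
        refine (Finset.abs_sum_le_sum_abs _ _).trans (Finset.sum_le_sum fun a _ => ?_)
        split_ifs <;> simp
    _ = ∑ a ∈ σ, |x.coord a - y.coord a| := by
        rw [Finset.sum_comm]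
        refine Finset.sum_congr rfl fun a ha => ?_
        rw [Finset.sum_ite_eq, if_pos (Finset.mem_image_of_mem _ ha)]

theorem norm_normalize_sub_le {E : Type*} [NormedAddCommGroup E] [NormedSpace ℝ E] {u v : E}
    {c : ℝ} (hc : 0 < c) (hu : c ≤ ‖u‖) (hv : c ≤ ‖v‖) :
    ‖‖u‖⁻¹ • u - ‖v‖⁻¹ • v‖ ≤ 2 / c * ‖u - v‖ := by
  have hu0 : 0 < ‖u‖ := hc.trans_le hu
  have hv0 : 0 < ‖v‖ := hc.trans_le hv
  have h1 : ‖u‖⁻¹ • u - ‖v‖⁻¹ • v = ‖u‖⁻¹ • (u - v) + (‖u‖⁻¹ - ‖v‖⁻¹) • v := by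
    rw [smul_sub, sub_smul]; abel
  have h2 : |‖u‖⁻¹ - ‖v‖⁻¹| * ‖v‖ = ‖u‖⁻¹ * |‖v‖ - ‖u‖| := by
    rw [inv_sub_inv hu0.ne' hv0.ne', abs_div, abs_of_pos (mul_pos hu0 hv0)]
    field_simp
  rw [h1]
  refine (norm_add_le _ _).trans ?_
  rw [norm_smul, norm_smul, Real.norm_eq_abs, Real.norm_eq_abs, h2, abs_of_pos (inv_pos.2 hu0)]
  have h3 : |‖v‖ - ‖u‖| ≤ ‖u - v‖ := by
    rw [norm_sub_rev]; exact abs_norm_sub_norm_le v u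
  have h4 : ‖u‖⁻¹ ≤ c⁻¹ := inv_anti₀ hc hu
  calc ‖u‖⁻¹ * ‖u - v‖ + ‖u‖⁻¹ * |‖v‖ - ‖u‖| ≤ c⁻¹ * ‖u - v‖ + c⁻¹ * ‖u - v‖ := by gcongr
    _ = _ := by ring

theorem SimplexLipschitz.normalize {E : Type*} [NormedAddCommGroup E] [NormedSpace ℝ E]
    {F : Realization K → E} (hF : SimplexLipschitz F) {c : ℝ} (hc : 0 < c)
    (h : ∀ x, c ≤ ‖F x‖) : SimplexLipschitz fun x => ‖F x‖⁻¹ • F x := by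
  obtain ⟨C, hC, hF⟩ := hF
  refine ⟨2 / c * C, by positivity, fun σ hσ x y hx hy => ?_⟩
  refine (norm_normalize_sub_le hc (h x) (h y)).trans ?_
  rw [mul_assoc]
  have := hF σ hσ x y hx hy
  gcongr

theorem SimplexLipschitz.comp_isometry {E E' : Type*} [SeminormedAddCommGroup E]
    [SeminormedAddCommGroup E'] [Module ℝ E] [Module ℝ E'] {F : Realization K → E}
    (hF : SimplexLipschitz F) (Φ : E →ₗᵢ[ℝ] E') : SimplexLipschitz fun x => Φ (F x) := by
  obtain ⟨C, hC, hF⟩ := hF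
  refine ⟨C, hC, fun σ hσ x y hx hy => ?_⟩
  rw [← map_sub, Φ.norm_map]
  exact hF σ hσ x y hx hy

end Lipschitz

namespace MarkedComplex

variable {π : Type v} [Group π] {A B : MarkedComplex.{u} π} {g : RiemannianMetric A.K}

/-! ## Construction of equivariant maps -/

theorem smul_nonneg' {r : ℝ} (hr : 0 ≤ r) {f : A.L2 g} (hf : 0 ≤ f) : 0 ≤ r • f := by
  rw [← Lp.coeFn_nonneg] at hf ⊢
  filter_upwards [hf, Lp.coeFn_smul r f] with x h1 h2
  rw [h2]
  exact mul_nonneg hr h1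

theorem isTest_normalize {P : Realization B.cover → A.L2 g} {c : ℝ} (hc : 0 < c)
    (h1 : ∀ x, c ≤ ‖P x‖) (h2 : ∀ x, 0 ≤ P x)
    (h3 : ∀ γ ∈ A.hom.range, ∀ x, P ((B.tr γ).map x) = koop g γ (P x))
    (h4 : SimplexLipschitz P) : IsTest A B g fun x => ‖P x‖⁻¹ • P x where
  norm_eq_one x := by
    rw [norm_smul, norm_inv, norm_norm, inv_mul_cancel₀ (hc.trans_le (h1 x)).ne']
  nonneg x := smul_nonneg' (by positivity) (h2 x)
  equivariant γ hγ x := by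
    rw [h3 γ hγ x, LinearIsometry.norm_map, map_smul]
  lipschitz := h4.normalize hc h1

theorem IsTest.comp {M : MarkedComplex.{u} π} {gM : RiemannianMetric M.K}
    {F : Realization B.cover → M.L2 gM} (hF : IsTest M B gM F) (f : MarkedMap A B)
    (hMA : M.hom.range ≤ A.hom.range) : IsTest M A gM fun x => F (f.coverMap.map x) where
  norm_eq_one x := hF.norm_eq_one _
  nonneg x := hF.nonneg _
  equivariant γ hγ x := by
    rw [f.coverMap_tr_map (hMA hγ), hF.equivariant γ hγ]
  lipschitz := hF.lipschitz.comp_map f.coverMap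

theorem IsTest.embedding {M N : MarkedComplex.{u} π} {gM : RiemannianMetric M.K}
    {gN : RiemannianMetric N.K} {F : Realization B.cover → N.L2 gN} (hF : IsTest N B gN F)
    (hMN : M.hom.range ≤ N.hom.range) {Φ : N.L2 gN →ₗᵢ[ℝ] M.L2 gM} (h1 : ∀ f, 0 ≤ f → 0 ≤ Φ f)
    (h2 : ∀ γ ∈ M.hom.range, ∀ f, Φ (koop gN γ f) = koop gM γ (Φ f)) :
    IsTest M B gM fun x => Φ (F x) where
  norm_eq_one x := (Φ.norm_map _).trans (hF.norm_eq_one x)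
  nonneg x := h1 _ (hF.nonneg x)
  equivariant γ hγ x := by rw [hF.equivariant γ (hMN hγ), h2 γ hγ]
  lipschitz := hF.lipschitz.comp_isometry Φ

/-- Local finiteness of the covering: a simplex through `a` is determined by its projection to the
finite complex `X`. -/
theorem finite_simplices_of_mem (a : A.CoverVertex) (n : ℕ) :
    {e : OrderedSimplex A.cover n | a ∈ e.face}.Finite := by
  refine Set.Finite.of_finite_image (f := projSimplex) (Set.toFinite _) ?_
  intro e he e' he' h
  obtain ⟨i, -, hi⟩ := Finset.mem_map.1 (show a ∈ e.face from he)
  have hv : ∀ i, (e.vert i).vert = (e'.vert i).vert := fun i => by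
    rw [← projSimplex_vert, h, projSimplex_vert]
  refine simplex_eq_of_vert_eq hv (i := i) ?_
  refine injOn_vert e'.face_mem ?_ (e'.vert_mem_face i) (hv i)
  rw [hi]
  exact he'

theorem exists_pos_corner (n : ℕ) :
    ∫⁻ t, {t : Fin n → ℝ | ∑ i, t i < 1}.indicator 1 t.1 ∂cornerMeasure n ≠ 0 := by
  have hm : MeasurableSet {t : Fin n → ℝ | ∑ i, t i < 1} :=
    (isOpen_lt (by fun_prop) continuous_const).measurableSet
  rw [lintegral_cornerMeasure fun t => {t : Fin n → ℝ | ∑ i, t i < 1}.indicator 1 t,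
    lintegral_indicator_one hm, Measure.restrict_apply hm]
  have ho : IsOpen ({t : Fin n → ℝ | ∑ i, t i < 1} ∩ ⋂ i, {t | 0 < t i}) :=
    (isOpen_lt (by fun_prop) continuous_const).inter
      (isOpen_iInter_of_finite fun i => isOpen_lt continuous_const (continuous_apply i))
  have hne : ({t : Fin n → ℝ | ∑ i, t i < 1} ∩ ⋂ i, {t | 0 < t i}).Nonempty := by
    refine ⟨fun _ => 1 / (n + 1), ?_, ?_⟩
    · simp only [mem_ofPred_eq, Finset.sum_const, Finset.card_univ, Fintype.card_fin, nsmul_eq_mul]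
      rw [mul_one_div, div_lt_one (by positivity)]
      linarith
    · simp only [mem_iInter, mem_ofPred_eq]
      intro i
      positivity
  refine ((ho.measure_pos volume hne).trans_le (measure_mono ?_)).ne'
  rintro t ⟨h1, h2⟩
  have h2 := mem_iInter.1 h2
  exact ⟨h1, fun i => (h2 i).le, le_of_lt h1⟩

/-- There is a non-negative function of norm one. -/
theorem exists_nonneg_norm_eq_one (A : MarkedComplex.{u} π) (g : RiemannianMetric A.K) :
    ∃ f : A.L2 g, 0 ≤ f ∧ ‖f‖ = 1 := by
  classical
  obtain ⟨σ, hσ, hσc⟩ := exists_card_eq_dimension (K := A.K)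
  obtain ⟨e₀, -⟩ := OrderedSimplex.exists_face_eq hσ hσc
  change OrderedSimplex A.K A.dim at e₀
  set e := A.lift e₀
  -- The open star of a vertex has finite volume by local finiteness, and positive volume because it
  -- contains the interior of `e`. Its normalized indicator is the desired function.
  set D : Set (Realization A.cover) := {x | x.coord (e.vert 0) ≠ 0}
  have hD : MeasurableSet D := measurable_coord (e.vert 0) (measurableSet_singleton (0 : ℝ)).compl
  have hμ := lintegral_riemannianVolume g ((measurable_one (α := ℝ≥0∞)).indicator hD)
  rw [lintegral_indicator_one hD] at hμ
  have hfin : A.riemannianVolume g D ≠ ⊤ := by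
    rw [hμ, tsum_eq_sum (s := (finite_simplices_of_mem (e.vert 0) A.dim).toFinset)]
    · refine ENNReal.mul_ne_top (factorial_inv_ne_top _) (ENNReal.sum_ne_top.2 fun e' _ => ?_)
      refine ne_top_of_le_ne_top (g.lintegral_edensity_ne_top (projSimplex e'))
        (lintegral_mono fun t => ?_)
      refine (mul_le_mul_right (indicator_le_self' (fun _ _ => zero_le_one) _) _).trans ?_
      simp
    · intro e' he'
      have he'' : e.vert 0 ∉ e'.face := fun h => he' (by simpa using h)
      rw [lintegral_eq_zero_of_ae_eq_zero]
      refine Filter.Eventually.of_forall fun t => ?_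
      have : chart e' t ∉ D := fun h => h (coord_chart_of_notMem e' t he'')
      simp [this]
  have hpos : A.riemannianVolume g D ≠ 0 := by
    rw [hμ]
    refine mul_ne_zero (factorial_inv_ne_zero _) fun h0 => ?_
    have h1 := ENNReal.tsum_eq_zero.1 h0 e
    have h2 := (lintegral_eq_zero_iff (by
      exact (g.measurable_edensity _).mul (((measurable_one (α := ℝ≥0∞)).indicator hD).comp
        (measurable_chart e)))).1 h1
    refine exists_pos_corner A.dim (lintegral_eq_zero_of_ae_eq_zero ?_)
    filter_upwards [h2] with t ht
    have h3 := (mul_eq_zero.1 ht).resolve_left (g.edensity_ne_zero _ t)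
    have h4 : (chart e t).coord (e.vert 0) = 0 := by
      by_contra hne
      have : chart e t ∈ D := hne
      simp [this] at h3
    rw [coord_chart_zero] at h4
    have : t.1 ∉ {t : Fin A.dim → ℝ | ∑ i, t i < 1} := fun h => by
      have : ∑ i, t.1 i < 1 := h
      linarith
    simp [this]
  set f : A.L2 g := indicatorConstLp 2 hD hfin 1
  have hf : 0 ≤ f := by
    rw [← Lp.coeFn_nonneg]
    filter_upwards [indicatorConstLp_coeFn (p := 2) (hs := hD) (hμs := hfin) (c := (1 : ℝ))]
      with x hx
    rw [hx]
    exact indicator_nonneg (fun _ _ => zero_le_one) x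
  have hn : 0 < ‖f‖ := by
    rw [norm_indicatorConstLp two_ne_zero ENNReal.ofNat_ne_top, norm_one, one_mul]
    exact Real.rpow_pos_of_pos (ENNReal.toReal_pos hpos hfin) _
  exact ⟨‖f‖⁻¹ • f, smul_nonneg' (by positivity) hf, by
    rw [norm_smul, norm_inv, norm_norm, inv_mul_cancel₀ hn.ne']⟩

/-- Equivariant maps from the vertices of a free action to the group. -/
theorem exists_equivariant_vertex (hAB : A.hom.range ≤ B.hom.range) :
    ∃ ρ : B.CoverVertex → π, (∀ b, ρ b ∈ A.hom.range) ∧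
      ∀ δ ∈ A.hom.range, ∀ b, ρ ((B.tr δ).toFun b) = δ * ρ b := by
  let S : Setoid B.CoverVertex :=
    { r := fun b b' => ∃ γ ∈ A.hom.range, (B.tr γ).toFun b = b'
      iseqv := by
        refine ⟨fun b => ⟨1, one_mem _, by rw [tr_one]; rfl⟩, ?_, ?_⟩
        · rintro b _ ⟨γ, hγ, rfl⟩
          exact ⟨γ⁻¹, inv_mem hγ, tr_inv_tr (hAB hγ) b⟩
        · rintro b _ _ ⟨γ, hγ, rfl⟩ ⟨δ, hδ, rfl⟩
          exact ⟨δ * γ, mul_mem hδ hγ, by rw [tr_mul (hAB hδ) (hAB hγ)]; rfl⟩ }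
  have h : ∀ b, ∃ γ ∈ A.hom.range, (B.tr γ).toFun (Quotient.mk S b).out = b := fun b =>
    Quotient.mk_out (s := S) b
  choose ρ hρ hρ' using h
  refine ⟨ρ, hρ, fun δ hδ b => ?_⟩
  have h1 : Quotient.mk S ((B.tr δ).toFun b) = Quotient.mk S b :=
    (Quotient.sound ⟨δ, hδ, rfl⟩ : Quotient.mk S b = _).symm
  have h2 := hρ' ((B.tr δ).toFun b)
  rw [h1] at h2
  rw [← tr_eq_iff (hAB (hρ _)) (hAB (mul_mem hδ (hρ b))) (Quotient.mk S b).out, h2,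
    tr_mul (hAB hδ) (hAB (hρ b))]
  exact congrArg (B.tr δ).toFun (hρ' b).symm

/-- Existence of equivariant Lipschitz maps to the non-negative part of the unit sphere. -/
theorem exists_isTest (g : RiemannianMetric A.K) (hAB : A.hom.range ≤ B.hom.range) :
    ∃ F : Realization B.cover → A.L2 g, IsTest A B g F := by
  classical
  obtain ⟨ρ, hρ, hρ'⟩ := exists_equivariant_vertex hAB
  obtain ⟨w, hw, hw1⟩ := exists_nonneg_norm_eq_one A g
  set G : B.CoverVertex → A.L2 g := fun b => koop g (ρ b) w
  have hG : ∀ b, 0 ≤ G b := fun b => koop_nonneg (hρ b) hw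
  have hG1 : ∀ b, ‖G b‖ = 1 := fun b => ((koop g (ρ b)).norm_map w).trans hw1
  set P : Realization B.cover → A.L2 g := fun x => x.coord.sum fun b r => r • G b
  have hP : ∀ (x : Realization B.cover) (σ : Finset B.CoverVertex), x.coord.support ⊆ σ →
      P x = ∑ b ∈ σ, x.coord b • G b := fun x σ h =>
    Finsupp.sum_of_support_subset _ h _ (by simp)
  have hcard : 0 < (Fintype.card B.V : ℝ) := by exact_mod_cast Fintype.card_pos
  refine ⟨_, isTest_normalize (P := P) (c := 1 / Fintype.card B.V) (by positivity) ?_ ?_ ?_ ?_⟩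
  · intro x
    -- Some barycentric coordinate is at least the inverse of the number of vertices of `Y`, since a
    -- lifted simplex has no more vertices than `Y`. Pairing `P x` with the corresponding `G b`
    -- bounds the norm below, all other terms being non-negative.
    have hsum : ∑ b ∈ x.coord.support, (1 : ℝ) / Fintype.card B.V ≤
        ∑ b ∈ x.coord.support, x.coord b := by
      have h1 : ∑ b ∈ x.coord.support, x.coord b = 1 := x.sum_eq_one
      rw [h1, Finset.sum_const, nsmul_eq_mul, mul_one_div, div_le_one hcard]
      norm_cast
      rw [← Finset.card_image_of_injOn (injOn_vert x.support_mem_faces)]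
      exact Finset.card_le_univ _
    obtain ⟨b, hb, hle⟩ := Finset.exists_le_of_sum_le
      (B.cover.isRelLowerSet_faces x.support_mem_faces).1 hsum
    refine hle.trans ?_
    have h2 : x.coord b ≤ inner ℝ (P x) (G b) := by
      rw [hP x _ subset_rfl, sum_inner]
      refine le_trans ?_ (Finset.single_le_sum (f := fun b' => inner ℝ (x.coord b' • G b') (G b))
        (fun b' _ => ?_) hb)
      · simp only [real_inner_smul_left, real_inner_self_eq_norm_sq, hG1]
        simp
      · exact inner_nonneg (smul_nonneg' (x.nonneg b') (hG b')) (hG b)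
    refine h2.trans ((real_inner_le_norm _ _).trans ?_)
    rw [hG1, mul_one]
  · intro x
    exact Finset.sum_nonneg fun b _ => smul_nonneg' (x.nonneg b) (hG b)
  · intro γ hγ x
    change (Finsupp.mapDomain (B.tr γ).toFun x.coord).sum _ = _
    rw [Finsupp.sum_mapDomain_index (by simp) (by intros; rw [add_smul])]
    simp only [P, Finsupp.sum, map_sum, map_smul]
    refine Finset.sum_congr rfl fun b _ => ?_
    simp only [G]
    rw [hρ' γ hγ, koop_mul hγ (hρ b)]
  · refine ⟨1, zero_le_one, fun σ hσ x y hx hy => ?_⟩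
    rw [hP x σ hx, hP y σ hy, ← Finset.sum_sub_distrib, one_mul]
    refine norm_sum_le_of_le _ fun b _ => ?_
    rw [← sub_smul, norm_smul, hG1, mul_one, Real.norm_eq_abs]

end MarkedComplex

/-! ## Volumes of maps in charts -/

section Chart

variable {V W : Type*} {K : AbstractSimplicialComplex V} {L : AbstractSimplicialComplex W}
  {H H' : Type*} [NormedAddCommGroup H] [InnerProductSpace ℝ H] [NormedAddCommGroup H']
  [InnerProductSpace ℝ H'] {n : ℕ}

open scoped Classical in
/-- A map to a Hilbert space in the chart of a simplex, extended by zero. -/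
def chartMap (F : Realization K → H) (e : OrderedSimplex K n) (t : Fin n → ℝ) : H :=
  if h : t ∈ corner n then F (chart e ⟨t, h⟩) else 0

/-- The Gram matrix of the derivative of a function on `ℝⁿ`. -/
def gramOf (φ : (Fin n → ℝ) → H) (t : Fin n → ℝ) : Matrix (Fin n) (Fin n) ℝ :=
  Matrix.of fun i j => inner ℝ (fderiv ℝ φ t (Pi.single i 1)) (fderiv ℝ φ t (Pi.single j 1))

/-- The volume of a simplex in the metric pulled back from a Hilbert space. -/
def chartVolume (F : Realization K → H) (e : OrderedSimplex K n) : ℝ≥0∞ :=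
  ∫⁻ t in interior (corner n), ENNReal.ofReal √(gramOf (chartMap F e) t).det

/-- The adjoint of `Φ` is a left inverse, so `Φ ∘ φ` is differentiable exactly where `φ` is. This
matters because `fderiv` is zero at the other points. -/
theorem gramOf_comp_isometry [CompleteSpace H] [CompleteSpace H'] (Φ : H →ₗᵢ[ℝ] H')
    (φ : (Fin n → ℝ) → H) (t : Fin n → ℝ) : gramOf (fun t => Φ (φ t)) t = gramOf φ t := by
  have h : ∀ w, fderiv ℝ (fun t => Φ (φ t)) t w = Φ (fderiv ℝ φ t w) := by
    intro w
    by_cases hφ : DifferentiableAt ℝ φ t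
    · have := (Φ.toContinuousLinearMap.hasFDerivAt.comp t hφ.hasFDerivAt).fderiv
      change fderiv ℝ (fun t => Φ (φ t)) t = _ at this
      rw [this]
      rfl
    · have hΦ : ¬ DifferentiableAt ℝ (fun t => Φ (φ t)) t := by
        intro h
        apply hφ
        have h1 := (ContinuousLinearMap.norm_map_iff_adjoint_comp_self
          Φ.toContinuousLinearMap).1 Φ.norm_map
        have h2 := (ContinuousLinearMap.adjoint Φ.toContinuousLinearMap).differentiableAt.comp t h
        refine h2.congr_of_eventuallyEq (Filter.Eventually.of_forall fun s => ?_)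
        exact (congrArg (fun T : H →L[ℝ] H => T (φ s)) h1).symm
      rw [fderiv_zero_of_not_differentiableAt hφ, fderiv_zero_of_not_differentiableAt hΦ]
      simp
  ext i j
  simp only [gramOf, Matrix.of_apply, h, LinearIsometry.inner_map_map]

theorem chartVolume_comp_isometry [CompleteSpace H] [CompleteSpace H'] (Φ : H →ₗᵢ[ℝ] H')
    (F : Realization K → H) (e : OrderedSimplex K n) :
    chartVolume (fun x => Φ (F x)) e = chartVolume F e := by
  have h : chartMap (fun x => Φ (F x)) e = fun t => Φ (chartMap F e t) := by
    funext t
    simp only [chartMap]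
    split_ifs
    · rfl
    · exact (map_zero Φ).symm
  simp only [chartVolume, h, gramOf_comp_isometry]

theorem chartVolume_comp_map (f : SimplicialMap K L) (F : Realization L → H)
    (e : OrderedSimplex K n) (h : Function.Injective (f.toFun ∘ e.vert)) :
    chartVolume (fun x => F (f.map x)) e = chartVolume F (e.map f h) := by
  have : chartMap (fun x => F (f.map x)) e = chartMap F (e.map f h) := by
    funext t
    simp only [chartMap, map_chart _ _ f h]
  rw [chartVolume, this, chartVolume]

/-- The direction `d` lies in the kernel of the derivative, hence in the kernel of the Gram matrix.
At points of non-differentiability the derivative is zero by convention. -/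
theorem det_gramOf_eq_zero {φ : (Fin n → ℝ) → H} {t d : Fin n → ℝ} (hd : d ≠ 0)
    (h : ∀ᶠ s in nhds (0 : ℝ), φ (t + s • d) = φ t) : (gramOf φ t).det = 0 := by
  rw [← Matrix.exists_mulVec_eq_zero_iff]
  refine ⟨d, hd, ?_⟩
  have h0 : fderiv ℝ φ t d = 0 := by
    by_cases hφ : DifferentiableAt ℝ φ t
    · rw [← hφ.lineDeriv_eq_fderiv, lineDeriv]
      have : (fun s : ℝ => φ (t + s • d)) =ᶠ[nhds 0] fun _ => φ t := h
      rw [this.deriv_eq, deriv_const]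
    · rw [fderiv_zero_of_not_differentiableAt hφ]
      rfl
  funext i
  have h1 : ∑ j, d j • fderiv ℝ φ t (Pi.single j 1) = 0 := by
    rw [← h0]
    conv_rhs => rw [← Finset.univ_sum_single d, map_sum]
    refine Finset.sum_congr rfl fun j _ => ?_
    rw [← map_smul, ← Pi.single_smul, smul_eq_mul, mul_one]
  calc ∑ j, inner ℝ (fderiv ℝ φ t (Pi.single i 1)) (fderiv ℝ φ t (Pi.single j 1)) * d j
      = inner ℝ (fderiv ℝ φ t (Pi.single i 1)) (∑ j, d j • fderiv ℝ φ t (Pi.single j 1)) := by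
        rw [inner_sum]
        refine Finset.sum_congr rfl fun j _ => ?_
        rw [real_inner_smul_right, mul_comm]
    _ = 0 := by rw [h1, inner_zero_right]

/-- A simplex that is mapped to a simplex of smaller dimension has volume zero. -/
theorem chartVolume_eq_zero (f : SimplicialMap K L) (F : Realization L → H)
    (e : OrderedSimplex K n) (h : ¬ Function.Injective (f.toFun ∘ e.vert)) :
    chartVolume (fun x => F (f.map x)) e = 0 := by
  classical
  obtain ⟨i, j, hij, hne⟩ : ∃ i j, f.toFun (e.vert i) = f.toFun (e.vert j) ∧ i ≠ j := by
    by_contra! h'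
    exact h fun i j hij => h' i j hij
  -- These are the vertices of the corner. If `f` identifies the vertices `i` and `j`, then `f`
  -- composed with the chart is constant in the direction `ε i - ε j`, which the linear part `Λ`
  -- kills.
  set ε : Fin (n + 1) → Fin n → ℝ := Fin.cons 0 fun k => Pi.single k 1
  have hε : ε i - ε j ≠ 0 := by
    rw [sub_ne_zero]
    intro hε
    apply hne
    rcases Fin.eq_zero_or_eq_succ i with rfl | ⟨k, rfl⟩ <;>
      rcases Fin.eq_zero_or_eq_succ j with rfl | ⟨l, rfl⟩
    · rfl
    · have := congrFun hε l
      simp [ε] at this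
    · have := congrFun hε k
      simp [ε] at this
    · by_contra hkl
      have := congrFun hε k
      have hkl' : k ≠ l := fun h => hkl (by rw [h])
      simp [ε, hkl'] at this
  let Λ : (Fin n → ℝ) →ₗ[ℝ] (W →₀ ℝ) :=
    { toFun := fun t => ∑ k, t k • (Finsupp.single (f.toFun (e.vert k.succ)) (1 : ℝ) -
        Finsupp.single (f.toFun (e.vert 0)) 1)
      map_add' := fun s t => by
        simp only [Pi.add_apply, add_smul, Finset.sum_add_distrib]
      map_smul' := fun r t => by
        simp only [Pi.smul_apply, smul_eq_mul, mul_smul, Finset.smul_sum, RingHom.id_apply] }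
  have hΛε : ∀ i, Λ (ε i) = Finsupp.single (f.toFun (e.vert i)) (1 : ℝ) -
      Finsupp.single (f.toFun (e.vert 0)) 1 := by
    intro i
    rcases Fin.eq_zero_or_eq_succ i with rfl | ⟨k, rfl⟩
    · simp [ε]
    · change ∑ l, (Pi.single k 1 : Fin n → ℝ) l • _ = _
      rw [Finset.sum_eq_single k]
      · simp
      · intro l _ hl
        simp [hl]
      · simp
  have hΛ : ∀ t : corner n, (f.map (chart e t)).coord =
      Finsupp.single (f.toFun (e.vert 0)) 1 + Λ t.1 := by
    intro t
    rw [coord_map_chart]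
    change _ = _ + ∑ k, t.1 k • (Finsupp.single (f.toFun (e.vert k.succ)) (1 : ℝ) -
        Finsupp.single (f.toFun (e.vert 0)) 1)
    simp only [smul_sub, Finsupp.smul_single, smul_eq_mul, mul_one, Finset.sum_sub_distrib,
      Finsupp.single_sub, Finsupp.single_finsetSum]
    abel
  rw [chartVolume, setLIntegral_congr_fun (g := fun _ => 0) isOpen_interior.measurableSet]
  · simp
  intro t ht
  have hcont : Continuous fun s : ℝ => t + s • (ε i - ε j) := by fun_prop
  have hev : ∀ᶠ s in nhds (0 : ℝ), t + s • (ε i - ε j) ∈ corner n :=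
    (hcont.tendsto' 0 t (by simp)).eventually (mem_interior_iff_mem_nhds.1 ht)
  simp only
  rw [det_gramOf_eq_zero hε]
  · simp
  filter_upwards [hev] with s hs
  simp only [chartMap, dif_pos hs, dif_pos (interior_subset ht)]
  congr 1
  apply Realization.ext
  rw [hΛ, hΛ, map_add, map_smul, map_sub, hΛε, hΛε, hij]
  simp

theorem abs_det_gramOf_le {φ : (Fin n → ℝ) → H} {t : Fin n → ℝ} {C : ℝ}
    (h : ‖fderiv ℝ φ t‖ ≤ C) : |(gramOf φ t).det| ≤ n.factorial * (C ^ 2) ^ n := by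
  have hC : 0 ≤ C := (norm_nonneg _).trans h
  have h1 : ∀ i : Fin n, ‖fderiv ℝ φ t (Pi.single i 1)‖ ≤ C := fun i => by
    refine ((fderiv ℝ φ t).le_opNorm _).trans ?_
    rw [Pi.norm_single, norm_one, mul_one]
    exact h
  have h2 := Matrix.det_le (A := gramOf φ t) (abv := AbsoluteValue.abs) (x := C ^ 2) fun i j => by
    change |inner ℝ _ _| ≤ _
    refine (abs_real_inner_le_norm _ _).trans ?_
    rw [sq]
    exact mul_le_mul (h1 i) (h1 j) (norm_nonneg _) hC
  simpa [nsmul_eq_mul] using h2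

/-- A Lipschitz bound in the chart bounds the derivative, hence the Gram determinant, and the corner
has finite volume. -/
theorem chartVolume_ne_top {F : Realization K → H} (hF : SimplexLipschitz F)
    (e : OrderedSimplex K n) : chartVolume F e ≠ ⊤ := by
  classical
  obtain ⟨C, hC, h⟩ := hF
  -- The chart coordinates contribute `n` times the sup distance; the coordinate `1 - ∑ tᵢ` varies
  -- by at most as much again, whence `2 * n`.
  have hlip : ∀ s t : corner n, ‖F (chart e s) - F (chart e t)‖ ≤
      C * (2 * n) * ‖s.1 - t.1‖ := by
    intro s t
    refine (h _ e.face_mem _ _ (support_chart_subset e s) (support_chart_subset e t)).trans ?_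
    rw [mul_assoc]
    gcongr
    rw [OrderedSimplex.face, Finset.sum_map, Fin.sum_univ_succ, coord_chart_zero, coord_chart_zero]
    simp only [coord_chart_succ]
    have h1 : ∑ i : Fin n, |s.1 i - t.1 i| ≤ n * ‖s.1 - t.1‖ := by
      refine (Finset.sum_le_card_nsmul _ _ _ fun i _ => norm_le_pi_norm (s.1 - t.1) i).trans ?_
      simp
    have h2 : |1 - ∑ i, s.1 i - (1 - ∑ i, t.1 i)| ≤ ∑ i : Fin n, |s.1 i - t.1 i| := by
      rw [sub_sub_sub_cancel_left, ← Finset.sum_sub_distrib]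
      refine (Finset.abs_sum_le_sum_abs _ _).trans_eq ?_
      exact Finset.sum_congr rfl fun i _ => abs_sub_comm _ _
    linarith
  have hd : ∀ t ∈ interior (corner n), ‖fderiv ℝ (chartMap F e) t‖ ≤ C * (2 * n) := by
    intro t ht
    refine norm_fderiv_le_of_lip' ℝ (by positivity) ?_
    filter_upwards [mem_interior_iff_mem_nhds.1 ht] with s hs
    simp only [chartMap, dif_pos hs, dif_pos (interior_subset ht)]
    exact hlip ⟨s, hs⟩ ⟨t, interior_subset ht⟩
  have hle : chartVolume F e ≤ ∫⁻ _ in interior (corner n),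
      ENNReal.ofReal √(n.factorial * ((C * (2 * n)) ^ 2) ^ n) := by
    refine setLIntegral_mono' isOpen_interior.measurableSet fun t ht => ?_
    refine ENNReal.ofReal_le_ofReal (Real.sqrt_le_sqrt ?_)
    exact (le_abs_self _).trans (abs_det_gramOf_le (hd t ht))
  refine ne_top_of_le_ne_top ?_ hle
  rw [setLIntegral_const]
  refine ENNReal.mul_ne_top ENNReal.ofReal_ne_top (ne_top_of_le_ne_top ?_
    (measure_mono interior_subset))
  exact (RiemannianMetric.isCompact_corner n).measure_lt_top.ne

/-- The determinant of an empty matrix is `1`, so in dimension zero the volume counts vertices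
whatever `F` is. -/
theorem chartVolume_of_dim_eq_zero (hn : n = 0) (F : Realization K → H) (e : OrderedSimplex K n) :
    chartVolume F e = 1 := by
  subst hn
  have : interior (corner 0) = univ := by
    rw [interior_eq_univ]
    ext t
    simp [corner]
  have h1 : volume (univ : Set (Fin 0 → ℝ)) = 1 := by
    rw [volume_pi, Measure.pi_of_empty, Measure.dirac_apply_of_mem (mem_univ _)]
  simp [chartVolume, this, h1]

end Chart

/-! ## Counting simplices -/

/-- An ordering of a simplex of `L` determines the ordering of every simplex lying over it, so
counting ordered simplices amounts to counting simplices. This is why the factor `(n + 1)!` cancels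
in comparisons. -/
theorem encard_orderedSimplices_le {V W : Type*} {K : AbstractSimplicialComplex V}
    {L : AbstractSimplicialComplex W} (f : SimplicialMap K L) {n d : ℕ} (hf : f.IsMonotone n d)
    (e' : OrderedSimplex L n) :
    {e : OrderedSimplex K n | f.toFun ∘ e.vert = e'.vert}.encard ≤ d := by
  classical
  refine le_trans ?_ (hf e'.face e'.face_mem e'.card_face)
  have hinj : Set.InjOn OrderedSimplex.face
      {e : OrderedSimplex K n | f.toFun ∘ e.vert = e'.vert} := by
    intro e₁ he₁ e₂ he₂ h
    have he₁ : f.toFun ∘ e₁.vert = e'.vert := he₁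
    have he₂ : f.toFun ∘ e₂.vert = e'.vert := he₂
    apply OrderedSimplex.ext'
    intro i
    obtain ⟨j, -, hj⟩ := Finset.mem_map.1 (h ▸ e₁.vert_mem_face i : e₁.vert i ∈ e₂.face)
    have h3 : e'.vert j = e'.vert i := by
      rw [← congrFun he₂ j, ← congrFun he₁ i, Function.comp, Function.comp, hj]
    rw [← hj, e'.vert.injective h3]
  rw [← hinj.encard_image]
  refine encard_le_encard ?_
  rintro _ ⟨e, he, rfl⟩
  refine ⟨e.face_mem, e.card_face, ?_⟩
  have he : f.toFun ∘ e.vert = e'.vert := he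
  ext w
  simp only [OrderedSimplex.face, Finset.mem_image, Finset.mem_map, Finset.mem_univ, true_and]
  constructor
  · rintro ⟨_, ⟨i, rfl⟩, rfl⟩
    exact ⟨i, (congrFun he i).symm⟩
  · rintro ⟨i, rfl⟩
    exact ⟨_, ⟨i, rfl⟩, congrFun he i⟩

theorem tsum_simplices_le {V W : Type*} [Finite V] [Finite W] {K : AbstractSimplicialComplex V}
    {L : AbstractSimplicialComplex W} (f : SimplicialMap K L) {n d : ℕ} (hf : f.IsMonotone n d)
    {a : OrderedSimplex K n → ℝ≥0∞} {b : OrderedSimplex L n → ℝ≥0∞}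
    (h1 : ∀ e (h : Function.Injective (f.toFun ∘ e.vert)), a e ≤ b (e.map f h))
    (h2 : ∀ e, ¬ Function.Injective (f.toFun ∘ e.vert) → a e = 0) :
    ∑' e, a e ≤ d * ∑' e, b e := by
  classical
  have : Fintype (OrderedSimplex K n) := Fintype.ofFinite _
  have : Fintype (OrderedSimplex L n) := Fintype.ofFinite _
  let S : OrderedSimplex L n → Finset (OrderedSimplex K n) := fun e' =>
    Finset.univ.filter fun e : OrderedSimplex K n => f.toFun ∘ e.vert = e'.vert
  have hcard : ∀ e' : OrderedSimplex L n, ((S e').card : ℝ≥0∞) ≤ d := by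
    intro e'
    have hs := encard_orderedSimplices_le f hf e'
    have hS : {e : OrderedSimplex K n | f.toFun ∘ e.vert = e'.vert} = (S e' : Set _) := by
      ext e
      simp [S]
    rw [hS, Set.encard_coe_eq_coe_finsetCard] at hs
    exact_mod_cast hs
  rw [tsum_fintype, tsum_fintype]
  have hle : ∀ e, a e ≤ ∑ e' : OrderedSimplex L n, if e ∈ S e' then b e' else 0 := by
    intro e
    by_cases h : Function.Injective (f.toFun ∘ e.vert)
    · have hm : e ∈ S (e.map f h) := Finset.mem_filter.2 ⟨Finset.mem_univ _, rfl⟩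
      calc a e ≤ b (e.map f h) := h1 e h
        _ = if e ∈ S (e.map f h) then b (e.map f h) else 0 := (if_pos hm).symm
        _ ≤ _ := Finset.single_le_sum (f := fun e' => if e ∈ S e' then b e' else 0)
            (fun _ _ => bot_le) (Finset.mem_univ (e.map f h))
    · rw [h2 e h]
      exact bot_le
  calc ∑ e, a e ≤ ∑ e, ∑ e' : OrderedSimplex L n, if e ∈ S e' then b e' else 0 :=
        Finset.sum_le_sum fun e _ => hle e
    _ = ∑ e' : OrderedSimplex L n, ∑ e : OrderedSimplex K n,
          if e ∈ S e' then b e' else 0 := Finset.sum_comm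
    _ ≤ ∑ e' : OrderedSimplex L n, d * b e' := by
        refine Finset.sum_le_sum fun e' _ => ?_
        rw [Finset.sum_ite_mem, Finset.univ_inter, Finset.sum_const, nsmul_eq_mul]
        exact mul_le_mul_left (hcard e') _
    _ = _ := by rw [Finset.mul_sum]

/-! ### Finiteness, comparison and vanishing of the spherical volume -/

namespace MarkedComplex

variable {π : Type v} [Group π] {A B : MarkedComplex.{u} π}

theorem pullbackVolume_eq {g : RiemannianMetric A.K} (F : Realization A.cover → A.L2 g) {n : ℕ}
    (hn : A.dim = n) : A.pullbackVolume F = (Nat.factorial (n + 1) : ℝ≥0∞)⁻¹ *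
      ∑' e : OrderedSimplex A.K n, chartVolume F (A.lift e) := by
  subst hn
  rfl

/-- Two lifts of a simplex differ by a covering transformation, which `F` turns into an isometry of
the `L²` space. Hence the choice of lifts is irrelevant. -/
theorem IsTest.chartVolume_eq {gB : RiemannianMetric A.K} {F : Realization B.cover → A.L2 gB}
    (hF : IsTest A B gB F) (hAB : B.hom.range ≤ A.hom.range) {n : ℕ}
    {e e' : OrderedSimplex B.cover n} (h : projSimplex e = projSimplex e') :
    chartVolume F e = chartVolume F e' := by
  obtain ⟨γ, hγ, rfl⟩ := exists_trSimplex_eq (e := e) (e' := e') fun i => by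
    rw [← projSimplex_vert, h, projSimplex_vert]
  rw [trSimplex, ← chartVolume_comp_map]
  simp only [hF.equivariant γ (hAB hγ)]
  rw [chartVolume_comp_isometry]

theorem sphericalVolume_le {g : RiemannianMetric A.K} {F : Realization A.cover → A.L2 g}
    (hF : IsTest A A g F) : A.sphericalVolume g ≤ A.pullbackVolume F :=
  iInf₂_le F (isAdmissible_iff.2 hF)

theorem le_sphericalVolume {g : RiemannianMetric A.K} {c : ℝ≥0∞}
    (h : ∀ F, IsTest A A g F → c ≤ A.pullbackVolume F) : c ≤ A.sphericalVolume g :=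
  le_iInf₂ fun F hF => h F (isAdmissible_iff.1 hF)

theorem sphericalVolume_ne_top (g : RiemannianMetric A.K) : A.sphericalVolume g ≠ ⊤ := by
  obtain ⟨F, hF⟩ := exists_isTest (A := A) (B := A) g le_rfl
  refine ne_top_of_le_ne_top ?_ (sphericalVolume_le hF)
  have : Fintype (OrderedSimplex A.K A.dim) := Fintype.ofFinite _
  rw [pullbackVolume_eq F rfl, tsum_fintype]
  exact ENNReal.mul_ne_top (factorial_inv_ne_top _)
    (ENNReal.sum_ne_top.2 fun e _ => chartVolume_ne_top hF.lipschitz _)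

theorem injective_cover_iff (f : MarkedMap A B) {n : ℕ} (e : OrderedSimplex A.K n) :
    Function.Injective (f.coverMap.toFun ∘ (A.lift e).vert) ↔
      Function.Injective (f.toFun ∘ e.vert) := by
  classical
  have hf : ∀ i, f.toFun (e.vert i) = (f.coverMap.toFun ((A.lift e).vert i)).vert := fun i => by
    rw [f.coverMap_vert, lift_vert]
  constructor
  · intro h i j hij
    refine h (injOn_vert (f.coverMap.image_mem _ (A.lift e).face_mem) ?_ ?_ ?_)
    · exact Finset.mem_coe.2 (Finset.mem_image_of_mem _ ((A.lift e).vert_mem_face i))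
    · exact Finset.mem_coe.2 (Finset.mem_image_of_mem _ ((A.lift e).vert_mem_face j))
    · simpa only [Function.comp, hf] using hij
  · intro h i j hij
    refine h ?_
    simp only [Function.comp, hf]
    exact congrArg CoverVertex.vert hij

theorem chartVolume_lift {g : RiemannianMetric B.K} {F : Realization B.cover → B.L2 g}
    (hF : IsTest B B g F) (f : MarkedMap A B) {n : ℕ} (e : OrderedSimplex A.K n)
    (h : Function.Injective (f.toFun ∘ e.vert)) :
    chartVolume (fun x => F (f.coverMap.map x)) (A.lift e) =
      chartVolume F (B.lift (e.map f.toSimplicialMap h)) := by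
  rw [chartVolume_comp_map _ _ _ ((injective_cover_iff f e).2 h)]
  refine hF.chartVolume_eq le_rfl ?_
  rw [projSimplex_lift]
  apply OrderedSimplex.ext'
  intro i
  rw [projSimplex_vert]
  change (f.coverMap.toFun ((A.lift e).vert i)).vert = f.toFun (e.vert i)
  rw [f.coverMap_vert, lift_vert]

/-- The comparison theorem for monotone maps. -/
theorem sphericalVolume_le_mul (gA : RiemannianMetric A.K) (gB : RiemannianMetric B.K)
    (f : MarkedMap A B) {n d : ℕ} (hA : A.dim = n) (hB : B.dim = n) (hf : f.IsMonotone n d)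
    (hfin : (A.hom.range.subgroupOf B.hom.range).FiniteIndex) :
    A.sphericalVolume gA ≤ d * B.sphericalVolume gB := by
  have key : ∀ F, IsTest B B gB F → A.sphericalVolume gA ≤ d * B.pullbackVolume F := by
    intro F hF
    rw [pullbackVolume_eq F hB, mul_left_comm]
    -- `exists_embedding` needs positive dimension. In dimension zero any competitor for `A` serves,
    -- since all chart volumes are `1`.
    rcases Nat.eq_zero_or_pos n with h0 | hpos
    · obtain ⟨F', hF'⟩ := exists_isTest (A := A) (B := A) gA le_rfl
      refine (sphericalVolume_le hF').trans ?_
      rw [pullbackVolume_eq F' hA]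
      gcongr
      refine tsum_simplices_le f.toSimplicialMap hf (fun e h => ?_) (fun e h => absurd ?_ h)
      · rw [chartVolume_of_dim_eq_zero h0, chartVolume_of_dim_eq_zero h0]
      · subst h0
        exact fun i j _ => Fin.ext (by omega)
    · obtain ⟨Φ, h1, h2⟩ := exists_embedding gA gB (by omega) f.range_le hfin
      refine (sphericalVolume_le ((hF.embedding f.range_le h1 h2).comp f le_rfl)).trans ?_
      rw [pullbackVolume_eq _ hA]
      gcongr
      refine tsum_simplices_le f.toSimplicialMap hf (fun e h => ?_) (fun e h => ?_)
      · rw [chartVolume_comp_isometry Φ (fun x => F (f.coverMap.map x)), chartVolume_lift hF f e h]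
      · rw [← injective_cover_iff] at h
        exact chartVolume_eq_zero f.coverMap (fun x => Φ (F x)) _ h
  -- A nonzero factor can be moved inside the infimum; for `d = 0` a single competitor already
  -- suffices.
  rcases Nat.eq_zero_or_pos d with rfl | hd
  · obtain ⟨F, hF⟩ := exists_isTest (A := B) (B := B) gB le_rfl
    simpa using key F hF
  change A.sphericalVolume gA ≤ d * ⨅ (F : Realization B.cover → B.L2 gB)
    (_ : B.IsAdmissible gB F), B.pullbackVolume F
  rw [ENNReal.mul_iInf_of_ne (by exact_mod_cast hd.ne') (by simp)]
  refine le_iInf fun F => ?_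
  rw [ENNReal.mul_iInf_of_ne (by exact_mod_cast hd.ne') (by simp)]
  exact le_iInf fun hF => key F (isAdmissible_iff.1 hF)

/-- If all simplices of maximal dimension are collapsed, then the spherical volume vanishes. -/
theorem sphericalVolume_eq_zero (gA : RiemannianMetric A.K) (f : MarkedMap A B) {n : ℕ}
    (hA : A.dim = n) (hf : f.IsMonotone n 0) : A.sphericalVolume gA = 0 := by
  -- The map on the covering of `B` takes values in the `L²` space of `A` from the start, so no
  -- embedding and no condition on the index is needed.
  obtain ⟨F, hF⟩ := exists_isTest (A := A) (B := B) gA f.range_le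
  rw [← nonpos_iff_eq_zero]
  refine (sphericalVolume_le (hF.comp f le_rfl)).trans ?_
  rw [pullbackVolume_eq _ hA]
  refine (mul_le_mul_right (tsum_simplices_le f.toSimplicialMap hf (b := fun _ => ⊤)
    (fun e h => le_top) (fun e h => ?_)) _).trans ?_
  · rw [← injective_cover_iff] at h
    exact chartVolume_eq_zero f.coverMap F _ h
  · simp

end MarkedComplex

/-! ## Simplicial coverings -/

section Covering

theorem exists_barycenter {V : Type*} {K : AbstractSimplicialComplex V} (σ : K.faces) :
    ∃ x : Realization K, x.coord.support = σ.1 ∧ ∀ v ∈ σ.1, x.coord v = (σ.1.card : ℝ)⁻¹ := by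
  classical
  obtain ⟨σ, hσ⟩ := σ
  have hpos : (0 : ℝ) < σ.card :=
    Nat.cast_pos.2 (Finset.card_pos.2 (K.isRelLowerSet_faces hσ).1)
  have hs : (Finsupp.indicator σ fun _ _ => (σ.card : ℝ)⁻¹).support = σ := by
    ext v
    by_cases hv : v ∈ σ <;> simp [Finsupp.indicator_apply, hv, hpos.ne']
  refine ⟨⟨Finsupp.indicator σ fun _ _ => (σ.card : ℝ)⁻¹, fun v => ?_, ?_, σ, hσ, hs.le⟩,
    hs, fun v hv => ?_⟩
  · rw [Finsupp.indicator_apply]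
    split_ifs
    · positivity
    · exact le_rfl
  · rw [Finsupp.sum, hs, Finset.sum_congr rfl (g := fun _ => (σ.card : ℝ)⁻¹) fun v hv => by
      rw [Finsupp.indicator_apply, dif_pos hv]]
    rw [Finset.sum_const, nsmul_eq_mul, mul_inv_cancel₀ hpos.ne']
  · change Finsupp.indicator σ (fun _ _ => (σ.card : ℝ)⁻¹) v = _
    rw [Finsupp.indicator_apply, dif_pos hv]

/-- The barycentre of a simplex. -/
def barycenter {V : Type*} {K : AbstractSimplicialComplex V} (σ : K.faces) : Realization K :=
  (exists_barycenter σ).choose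

variable {V W : Type*} {K : AbstractSimplicialComplex V} {L : AbstractSimplicialComplex W}

theorem support_barycenter (σ : K.faces) : (barycenter σ).coord.support = σ.1 :=
  (exists_barycenter σ).choose_spec.1

theorem coord_barycenter (σ : K.faces) {v : V} (hv : v ∈ σ.1) :
    (barycenter σ).coord v = (σ.1.card : ℝ)⁻¹ :=
  (exists_barycenter σ).choose_spec.2 v hv

theorem map_barycenter [DecidableEq W] (f : SimplicialMap K L) {σ : K.faces} {τ : L.faces}
    (hf : Set.InjOn f.toFun σ.1) (h : σ.1.image f.toFun = τ.1) :
    f.map (barycenter σ) = barycenter τ := by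
  apply Realization.ext
  ext w
  by_cases hw : w ∈ τ.1
  · have hw' := hw
    rw [← h] at hw'
    obtain ⟨v, hv, rfl⟩ := Finset.mem_image.1 hw'
    rw [f.coord_map_of_injOn (support_barycenter σ).le hf hv, coord_barycenter σ hv,
      coord_barycenter τ hw, ← h, Finset.card_image_of_injOn hf]
  · have h0 : (barycenter τ).coord w = 0 := by
      rwa [← Finsupp.notMem_support_iff, support_barycenter]
    rw [h0]
    refine Finsupp.notMem_support_iff.1 ?_
    rwa [f.support_map, support_barycenter, h]

/-- A simplicial map with finite fibres is injective on simplices. -/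
theorem injOn_of_finite_fibres (f : SimplicialMap K L) (hf : ∀ y, (f.map ⁻¹' {y}).Finite)
    {σ : Finset V} (hσ : σ ∈ K.faces) : Set.InjOn f.toFun σ := by
  classical
  intro v hv w hw hvw
  by_contra hne
  have hsub : ∃ σ ∈ K.faces, (Realization.vertex K v).coord.support ⊆ σ ∧
      (Realization.vertex K w).coord.support ⊆ σ :=
    ⟨σ, hσ, Finsupp.support_single_subset.trans (by simpa using hv),
      Finsupp.support_single_subset.trans (by simpa using hw)⟩
  have : Infinite unitInterval := (Set.Icc_infinite zero_lt_one).to_subtype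
  -- If two vertices of a simplex had the same image, the whole segment between them would lie in
  -- one fibre.
  refine Set.infinite_of_injective_forall_mem (s := f.map ⁻¹' {Realization.vertex L (f.toFun v)})
    (f := Realization.combo _ _ hsub) ?_ ?_ (hf _)
  · intro s t hst
    have h := DFunLike.congr_fun (congrArg Realization.coord hst) w
    refine Subtype.ext ?_
    simpa [Realization.combo, Realization.vertex, Finsupp.single_apply, hne] using h
  · intro t
    apply Realization.ext
    change Finsupp.mapDomain f.toFun ((1 - (t : ℝ)) • Finsupp.single v 1 +
      (t : ℝ) • Finsupp.single w 1) = Finsupp.single (f.toFun v) 1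
    rw [Finsupp.mapDomain_add, Finsupp.mapDomain_smul, Finsupp.mapDomain_smul,
      Finsupp.mapDomain_single, Finsupp.mapDomain_single, ← hvw, ← add_smul, sub_add_cancel,
      one_smul]

/-- Simplices over `τ` are mapped isomorphically, so their barycentres are distinct points of the
fibre over the barycentre of `τ`. -/
theorem isMonotone_of_encard_fibres_le (f : SimplicialMap K L) {d : ℕ}
    (hf : ∀ y, (f.map ⁻¹' {y}).encard ≤ d) (n : ℕ) : f.IsMonotone n d := by
  classical
  intro τ hτ hcard
  refine le_trans ?_ (hf (barycenter ⟨τ, hτ⟩))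
  have hfin : ∀ y, (f.map ⁻¹' {y}).Finite := fun y =>
    Set.finite_of_encard_le_coe (hf y)
  let β : f.simplicesOver n τ → f.map ⁻¹' {barycenter ⟨τ, hτ⟩} := fun σ =>
    ⟨barycenter ⟨σ.1, σ.2.1⟩, map_barycenter f (injOn_of_finite_fibres f hfin σ.2.1)
      (by convert σ.2.2.2)⟩
  have hβ : Function.Injective β := by
    intro σ σ' h
    have h1 := congrArg (fun x : f.map ⁻¹' _ => x.1.coord.support) h
    simp only [β, support_barycenter] at h1
    exact Subtype.ext h1
  exact (Function.Embedding.mk β hβ).encard_le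

theorem dimension_eq_of_surjective [Finite V] [Finite W] [Nonempty V] (f : SimplicialMap K L)
    (hf : ∀ y, (f.map ⁻¹' {y}).Finite) (hs : Function.Surjective f.map) :
    dimension L = dimension K := by
  classical
  refine dimension_eq_of_le (fun τ hτ => ?_) ?_
  · obtain ⟨x, hx⟩ := hs (barycenter ⟨τ, hτ⟩)
    have h := f.support_map x
    rw [hx, support_barycenter] at h
    rw [show τ = _ from h]
    exact Finset.card_image_le.trans (card_le_dimension x.support_mem_faces)
  · obtain ⟨σ, hσ, h⟩ := exists_card_eq_dimension (K := K)
    refine ⟨σ.image f.toFun, by convert f.image_mem σ hσ, ?_⟩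
    rw [Finset.card_image_of_injOn (injOn_of_finite_fibres f hf hσ), h]

/-- The kernel of the monodromy action on the finite fibre has finite index. A loop in this kernel
lifts to a loop at `x` and so lies in the range. -/
theorem finiteIndex_range_mapOfEq {X Y : Type*} [TopologicalSpace X] [TopologicalSpace Y]
    {p : C(X, Y)} (hp : IsCoveringMap p) {x : X} {y : Y} (h : p x = y)
    (hfin : (p ⁻¹' {y}).Finite) : (FundamentalGroup.mapOfEq p h).range.FiniteIndex := by
  have : Finite (p ⁻¹' {y}) := hfin
  refine Subgroup.finiteIndex_of_le (H := (hp.monodromyPerm y).ker) fun γ hγ => ?_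
  have hx : hp.monodromy γ ⟨x, h⟩ = ⟨x, h⟩ := congrArg (fun σ : Equiv.Perm _ => σ ⟨x, h⟩) hγ
  refine ⟨(hp.liftPathQuotient γ ⟨x, h⟩).cast rfl (congrArg Subtype.val hx.symm), ?_⟩
  rw [FundamentalGroup.mapOfEq_apply, Path.Homotopic.Quotient.map_cast]
  have := hp.map_liftPathQuotient γ ⟨x, h⟩
  change Path.Homotopic.Quotient.map _ p = _ at this
  rw [this]
  exact eq_of_heq (((Path.Homotopic.Quotient.cast_heq _ _).trans
    (Path.Homotopic.Quotient.cast_heq _ _)).trans (Path.Homotopic.Quotient.cast_heq _ _))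

/-! ### The covering axiom and the weak comparison axiom -/

namespace MarkedComplex

variable {π : Type v} [Group π] {A B : MarkedComplex.{u} π}

/-- Finite index passes from `π₁(Y)` to its image under `ψ`, and `ψ` maps the range of `f_*` into
the image of `φ`. -/
theorem finiteIndex_range (f : MarkedMap A B)
    (h : (FundamentalGroup.mapOfEq f.cmap f.map_base).range.FiniteIndex) :
    (A.hom.range.subgroupOf B.hom.range).FiniteIndex := by
  have h1 := Subgroup.index_map_dvd (FundamentalGroup.mapOfEq f.cmap f.map_base).range
    B.hom.rangeRestrict_surjective
  have h2 : ((FundamentalGroup.mapOfEq f.cmap f.map_base).range.map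
      B.hom.rangeRestrict).FiniteIndex :=
    ⟨fun h0 => h.index_ne_zero (Nat.eq_zero_of_zero_dvd (h0 ▸ h1))⟩
  refine Subgroup.finiteIndex_of_le (H := (FundamentalGroup.mapOfEq f.cmap f.map_base).range.map
      B.hom.rangeRestrict) ?_
  rintro _ ⟨_, ⟨α, rfl⟩, rfl⟩
  rw [Subgroup.mem_subgroupOf, f.hom_eq]
  exact ⟨α, rfl⟩

/-- The covering axiom. -/
theorem sphericalVolume_le_of_covering (gA : RiemannianMetric A.K) (gB : RiemannianMetric B.K)
    (f : MarkedMap A B) {d : ℕ} (hf : IsCoveringMap f.map)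
    (hd : ∀ y, (f.map ⁻¹' {y}).encard = d) : A.sphericalVolume gA ≤ d * B.sphericalVolume gB := by
  have hfin : ∀ y, (f.map ⁻¹' {y}).Finite := fun y => Set.finite_of_encard_eq_coe (hd y)
  have hd0 : (d : ℕ∞) ≠ 0 := by
    rw [← hd B.base]
    exact Set.encard_ne_zero.2 ⟨A.base, f.map_base⟩
  have hs : Function.Surjective f.map := fun y => by
    rw [← hd y] at hd0
    exact Set.encard_ne_zero.1 hd0
  exact sphericalVolume_le_mul gA gB f rfl
    (dimension_eq_of_surjective f.toSimplicialMap hfin hs)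
    (isMonotone_of_encard_fibres_le f.toSimplicialMap (fun y => (hd y).le) _)
    (finiteIndex_range f (finiteIndex_range_mapOfEq (p := f.cmap) hf f.map_base (hfin _)))

/-- The weak comparison axiom. -/
theorem sphericalVolume_le_of_bijective (gA : RiemannianMetric A.K) (gB : RiemannianMetric B.K)
    (f : MarkedMap A B) {n d : ℕ} (hA : A.dim = n) (hB : B.dim = n)
    (hf : f.IsStrictlyMonotone n d) (hs : Function.Surjective f.galoisMap) :
    A.sphericalVolume gA ≤ d * B.sphericalVolume gB := by
  refine sphericalVolume_le_mul gA gB f hA hB (fun τ hτ h => (hf τ hτ h).le) ?_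
  -- Surjectivity on Galois groups means that the two homomorphisms have the same image in `π`, a
  -- subgroup of index one.
  have : A.hom.range = B.hom.range := by
    refine f.range_le.antisymm ?_
    rintro _ ⟨β, rfl⟩
    obtain ⟨α, hα⟩ := hs (QuotientGroup.mk β)
    obtain ⟨α, rfl⟩ := QuotientGroup.mk_surjective α
    refine ⟨α, ?_⟩
    have h1 : (QuotientGroup.mk (FundamentalGroup.mapOfEq f.cmap f.map_base α) :
      _ ⧸ B.hom.ker) = QuotientGroup.mk β := hα
    rw [QuotientGroup.eq, MonoidHom.mem_ker, map_mul, map_inv, inv_mul_eq_one] at h1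
    rw [f.hom_eq]
    exact h1
  rw [this, Subgroup.subgroupOf_self]
  infer_instance

end MarkedComplex

end Covering

/-! ## Homogeneous extension of Lipschitz maps to the cone -/

section Cone

variable {V : Type*} {K : AbstractSimplicialComplex V}

theorem Realization.sum_coord (x : Realization K) {U : Finset V} (h : x.coord.support ⊆ U) :
    ∑ a ∈ U, x.coord a = 1 := by
  rw [← x.sum_eq_one, Finsupp.sum_of_support_subset _ h _ (by simp)]

theorem Realization.coord_eq_zero {x : Realization K} {U : Finset V} (h : x.coord.support ⊆ U)
    {a : V} (ha : a ∉ U) : x.coord a = 0 :=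
  Finsupp.notMem_support_iff.1 fun h' => ha (h h')

theorem Realization.sum_mul_coord (x : Realization K) (s : ℝ) {U : Finset V}
    (h : x.coord.support ⊆ U) : ∑ a ∈ U, s * x.coord a = s := by
  rw [← Finset.mul_sum, x.sum_coord h, mul_one]

/-- Polar coordinates on the cone over a simplex: the radius is the `ℓ¹` norm. At the apex the point
`w` is arbitrary. -/
theorem exists_cone_point {σ : Finset V} (hσ : σ ∈ K.faces) (δ : V → ℝ) (h0 : ∀ v, 0 ≤ δ v)
    (hδ : ∀ v ∉ σ, δ v = 0) : ∃ (t : ℝ) (w : Realization K), 0 ≤ t ∧ w.coord.support ⊆ σ ∧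
      ∀ v, t * w.coord v = δ v := by
  classical
  rcases eq_or_ne (∑ v ∈ σ, δ v) 0 with h | h
  · obtain ⟨v, hv⟩ := (K.isRelLowerSet_faces hσ).1
    refine ⟨0, Realization.vertex K v, le_rfl,
      Finsupp.support_single_subset.trans (by simpa using hv), fun w => ?_⟩
    rw [zero_mul]
    by_cases hw : w ∈ σ
    · exact ((Finset.sum_eq_zero_iff_of_nonneg fun v _ => h0 v).1 h w hw).symm
    · exact (hδ w hw).symm
  · have hpos : 0 < ∑ v ∈ σ, δ v := (Finset.sum_nonneg fun v _ => h0 v).lt_of_ne' h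
    let φ : V →₀ ℝ := Finsupp.onFinset σ (fun v => (∑ v ∈ σ, δ v)⁻¹ * δ v) fun v hv => by
      by_contra hv'
      exact hv (by rw [hδ v hv', mul_zero])
    have hs : φ.support ⊆ σ := Finsupp.support_onFinset_subset
    refine ⟨∑ v ∈ σ, δ v, ⟨φ, fun v => ?_, ?_, σ, hσ, hs⟩, hpos.le, hs, fun v => ?_⟩
    · exact mul_nonneg (by positivity) (h0 v)
    · rw [Finsupp.sum_of_support_subset _ hs _ (by simp)]
      change ∑ v ∈ σ, (∑ v ∈ σ, δ v)⁻¹ * δ v = 1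
      rw [← Finset.mul_sum, inv_mul_cancel₀ h]
    · change (∑ v ∈ σ, δ v) * ((∑ v ∈ σ, δ v)⁻¹ * δ v) = δ v
      rw [mul_inv_cancel_left₀ h]

theorem abs_sub_le_sum_cone (s t : ℝ) (x y : Realization K) {U : Finset V}
    (hx : x.coord.support ⊆ U) (hy : y.coord.support ⊆ U) :
    |s - t| ≤ ∑ a ∈ U, |s * x.coord a - t * y.coord a| := by
  conv_lhs => rw [← x.sum_mul_coord s hx, ← y.sum_mul_coord t hy, ← Finset.sum_sub_distrib]
  exact Finset.abs_sum_le_sum_abs _ _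

variable {E : Type*} [NormedAddCommGroup E] [NormedSpace ℝ E]

/-- The homogeneous extension `t w ↦ t • F w` to the cone is well defined: the radius is recovered
as the sum of the coordinates, and at radius zero the arbitrary choice of the point is multiplied by
zero. -/
theorem cone_eq (F : Realization K → E) {s t : ℝ} {x y : Realization K}
    (h : ∀ a, s * x.coord a = t * y.coord a) : s = t ∧ s • F x = t • F y := by
  classical
  have hst : s = t := by
    rw [← x.sum_mul_coord s (U := x.coord.support ∪ y.coord.support) Finset.subset_union_left,
      ← y.sum_mul_coord t (U := x.coord.support ∪ y.coord.support) Finset.subset_union_right]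
    exact Finset.sum_congr rfl fun a _ => h a
  subst hst
  refine ⟨rfl, ?_⟩
  rcases eq_or_ne s 0 with rfl | hs
  · simp
  · congr 2
    apply Realization.ext
    ext a
    exact mul_left_cancel₀ hs (h a)

/-- The difference splits into an angular part `s • (F x - F y)` and a radial part `(s - t) • F y`.
With `S` the `ℓ¹` distance in the cone, the radial part is at most `S`, and `s` times the distance
of `x` and `y` is at most `2 S`. -/
theorem norm_cone_sub_le_of_face {F : Realization K → E} (h1 : ∀ x, ‖F x‖ = 1) {C : ℝ}
    (hC : 0 ≤ C) {σ : Finset V} (hF : ∀ x y : Realization K, x.coord.support ⊆ σ →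
      y.coord.support ⊆ σ → ‖F x - F y‖ ≤ C * ∑ a ∈ σ, |x.coord a - y.coord a|)
    {s t : ℝ} (hs : 0 ≤ s) {x y : Realization K}
    (hx : x.coord.support ⊆ σ) (hy : y.coord.support ⊆ σ) :
    ‖s • F x - t • F y‖ ≤ (1 + 2 * C) * ∑ a ∈ σ, |s * x.coord a - t * y.coord a| := by
  have h2 := abs_sub_le_sum_cone s t x y hx hy
  have h3 : s * ∑ a ∈ σ, |x.coord a - y.coord a| ≤
      2 * ∑ a ∈ σ, |s * x.coord a - t * y.coord a| := by
    have h4 : s * ∑ a ∈ σ, |x.coord a - y.coord a| ≤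
        ∑ a ∈ σ, (|s * x.coord a - t * y.coord a| + |s - t| * y.coord a) := by
      rw [Finset.mul_sum]
      refine Finset.sum_le_sum fun a _ => ?_
      have : s * |x.coord a - y.coord a| =
          |(s * x.coord a - t * y.coord a) - (s - t) * y.coord a| := by
        rw [← abs_of_nonneg hs, ← abs_mul, abs_of_nonneg hs]
        congr 1
        ring
      rw [this]
      refine (abs_sub _ _).trans ?_
      rw [abs_mul, abs_of_nonneg (y.nonneg a)]
    rw [Finset.sum_add_distrib, y.sum_mul_coord _ hy] at h4
    linarith
  have h5 : s • F x - t • F y = s • (F x - F y) + (s - t) • F y := by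
    rw [smul_sub, sub_smul]; abel
  rw [h5]
  refine (norm_add_le _ _).trans ?_
  rw [norm_smul, norm_smul, h1, mul_one, Real.norm_eq_abs, Real.norm_eq_abs, abs_of_nonneg hs]
  have h6 := mul_le_mul_of_nonneg_left (hF x y hx hy) hs
  have h7 := mul_le_mul_of_nonneg_left h3 hC
  nlinarith

/-- The points need not lie in a common simplex. The coordinatewise minimum of the two cone points
lies in the cones over both supports, and the `ℓ¹` distances to it add up exactly to the distance of
the two points, so the estimate on a single face can be applied twice. -/
theorem norm_cone_sub_le [DecidableEq V] {F : Realization K → E} (h1 : ∀ x, ‖F x‖ = 1) {C : ℝ}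
    (hC : 0 ≤ C) (hF : ∀ σ ∈ K.faces, ∀ x y : Realization K, x.coord.support ⊆ σ →
      y.coord.support ⊆ σ → ‖F x - F y‖ ≤ C * ∑ a ∈ σ, |x.coord a - y.coord a|)
    {s t : ℝ} (hs : 0 ≤ s) (ht : 0 ≤ t) (x y : Realization K) :
    ‖s • F x - t • F y‖ ≤ (1 + 2 * C) *
      ∑ a ∈ x.coord.support ∪ y.coord.support, |s * x.coord a - t * y.coord a| := by
  have hsx : ∀ a, 0 ≤ s * x.coord a := fun a => mul_nonneg hs (x.nonneg a)
  have hty : ∀ a, 0 ≤ t * y.coord a := fun a => mul_nonneg ht (y.nonneg a)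
  obtain ⟨r, w, hr, hw, hrw⟩ := exists_cone_point x.support_mem_faces
    (fun a => min (s * x.coord a) (t * y.coord a)) (fun a => le_min (hsx a) (hty a)) fun a ha => by
      rw [Finsupp.notMem_support_iff.1 ha, mul_zero, min_eq_left (hty a)]
  obtain ⟨r', w', hr', hw', hrw'⟩ := exists_cone_point y.support_mem_faces
    (fun a => min (s * x.coord a) (t * y.coord a)) (fun a => le_min (hsx a) (hty a)) fun a ha => by
      rw [Finsupp.notMem_support_iff.1 ha, mul_zero, min_eq_right (hsx a)]
  have hF' := (cone_eq F fun a => (hrw a).trans (hrw' a).symm).2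
  have e1 := norm_cone_sub_le_of_face (t := r) h1 hC (hF _ x.support_mem_faces) hs subset_rfl hw
  have e2 := norm_cone_sub_le_of_face (t := r') h1 hC (hF _ y.support_mem_faces) ht subset_rfl hw'
  simp only [hrw] at e1
  simp only [hrw'] at e2
  have e3 : s • F x - t • F y = (s • F x - r • F w) - (t • F y - r' • F w') := by
    rw [hF']; abel
  rw [e3]
  refine (norm_sub_le _ _).trans ((add_le_add e1 e2).trans ?_)
  rw [← mul_add]
  refine mul_le_mul_of_nonneg_left ?_ (by positivity)
  refine (add_le_add
    (Finset.sum_le_sum_of_subset_of_nonneg (t := x.coord.support ∪ y.coord.support)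
      Finset.subset_union_left fun _ _ _ => abs_nonneg _)
    (Finset.sum_le_sum_of_subset_of_nonneg (t := x.coord.support ∪ y.coord.support)
      Finset.subset_union_right fun _ _ _ => abs_nonneg _)).trans ?_
  rw [← Finset.sum_add_distrib]
  refine Finset.sum_le_sum fun a _ => le_of_eq ?_
  rcases le_total (s * x.coord a) (t * y.coord a) with h | h
  · rw [min_eq_left h, sub_self, abs_zero, zero_add, abs_sub_comm]
  · rw [min_eq_right h, sub_self, abs_zero, add_zero]

end Cone

/-! ## Collars of subcomplexes -/

section Collar

variable {V W : Type*} {K : AbstractSimplicialComplex V}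
  {L : AbstractSimplicialComplex W}

open scoped Classical in
/-- The smallest barycentric coordinate of a point at the vertices of a simplex. -/
def minCoord (σ : Finset W) (p : W → ℝ) : ℝ := if h : σ.Nonempty then σ.inf' h p else 0

open scoped Classical in
/-- The simplices that do not belong to the image of a simplicial map. -/
def SimplicialMap.outside (f : SimplicialMap K L) : Set (Finset W) :=
  {τ | τ ∈ L.faces ∧ ¬ ∃ σ ∈ K.faces, σ.image f.toFun = τ}

theorem minCoord_nonneg (σ : Finset W) {p : W → ℝ} (hp : ∀ v, 0 ≤ p v) : 0 ≤ minCoord σ p := by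
  rw [minCoord]
  split_ifs with h
  · exact Finset.le_inf' h _ fun v _ => hp v
  · exact le_rfl

theorem minCoord_le_add (σ : Finset W) {p q : W → ℝ} {M : ℝ} (hM : 0 ≤ M)
    (h : ∀ v, |p v - q v| ≤ M) : minCoord σ p ≤ minCoord σ q + M := by
  rw [minCoord, minCoord]
  split_ifs with hσ
  · rw [← sub_le_iff_le_add]
    refine Finset.le_inf' hσ _ fun v hv => ?_
    have h1 := Finset.inf'_le p hv
    have h2 := (abs_le.1 (h v)).2
    linarith
  · simpa using hM

variable [Finite W]

/-- A function that vanishes on the image of `f`. -/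
def SimplicialMap.collar (f : SimplicialMap K L) (p : W → ℝ) : ℝ :=
  ∑ τ ∈ f.outside.toFinite.toFinset, minCoord τ p

variable (f : SimplicialMap K L)

theorem collar_nonneg {p : W → ℝ} (hp : ∀ v, 0 ≤ p v) : 0 ≤ f.collar p :=
  Finset.sum_nonneg fun σ _ => minCoord_nonneg σ hp

/-- The collar is at least the minimal coordinate on each simplex outside the subcomplex.
Consequently the vertices whose coordinates exceed the collar cannot span an outside simplex. -/
theorem exists_coord_le_collar {p : W → ℝ} (hp : ∀ v, 0 ≤ p v) {σ : Finset W}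
    (hσ : σ ∈ f.outside) : ∃ v ∈ σ, p v ≤ f.collar p := by
  have hne : σ.Nonempty := (L.isRelLowerSet_faces hσ.1).1
  obtain ⟨v, hv, h⟩ := Finset.exists_mem_eq_inf' hne p
  refine ⟨v, hv, ?_⟩
  have h1 : minCoord σ p = p v := by rw [minCoord, dif_pos hne, h]
  rw [← h1]
  exact Finset.single_le_sum (f := fun σ => minCoord σ p) (fun σ _ => minCoord_nonneg σ hp)
    (f.outside.toFinite.mem_toFinset.2 hσ)

theorem collar_le_add {p q : W → ℝ} {M : ℝ} (hM : 0 ≤ M) (h : ∀ v, |p v - q v| ≤ M) :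
    f.collar p ≤ f.collar q + f.outside.toFinite.toFinset.card * M := by
  rw [SimplicialMap.collar, SimplicialMap.collar, ← nsmul_eq_mul, ← Finset.sum_const,
    ← Finset.sum_add_distrib]
  exact Finset.sum_le_sum fun σ _ => minCoord_le_add σ hM h

theorem abs_collar_sub_le {p q : W → ℝ} {M : ℝ} (hM : 0 ≤ M) (h : ∀ v, |p v - q v| ≤ M) :
    |f.collar p - f.collar q| ≤ f.outside.toFinite.toFinset.card * M := by
  have h1 := collar_le_add f hM h
  have h2 := collar_le_add f (p := q) (q := p) hM fun v => by rw [abs_sub_comm]; exact h v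
  rw [abs_le]
  constructor <;> linarith

/-- The support of a point in the image is the image of a simplex, as are all nonempty subsets of
it. An outside simplex therefore has a vertex with coordinate zero. -/
theorem collar_map (x : Realization K) : f.collar (f.map x).coord = 0 := by
  classical
  refine Finset.sum_eq_zero fun τ hτ => ?_
  have hτ : τ ∈ f.outside := f.outside.toFinite.mem_toFinset.1 hτ
  have hne : τ.Nonempty := (L.isRelLowerSet_faces hτ.1).1
  refine le_antisymm ?_ (minCoord_nonneg τ (f.map x).nonneg)
  obtain ⟨w, hw, hw'⟩ : ∃ w ∈ τ, w ∉ (f.map x).coord.support := by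
    by_contra! h
    rw [f.support_map] at h
    obtain ⟨σ, hσ, rfl⟩ := Finset.subset_image_iff.1 (show τ ⊆ _ from h)
    refine hτ.2 ⟨σ, (K.isRelLowerSet_faces x.support_mem_faces).2 (by exact_mod_cast hσ)
      (Finset.image_nonempty.1 hne), by congr!⟩
  rw [minCoord, dif_pos hne]
  exact (Finset.inf'_le _ hw).trans_eq (Finsupp.notMem_support_iff.1 hw')

end Collar

/-! ## Extensions -/

namespace MarkedComplex

variable {π : Type v} [Group π] {A B : MarkedComplex.{u} π} (f : MarkedMap A B)

section Retraction

variable (hf : Function.Injective f.toFun)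

include hf

/-- Two vertices with the same image differ by some `γ`, which then fixes a vertex of the covering
of `B` and is trivial because that action is free. -/
theorem coverMap_injective : Function.Injective f.coverMap.toFun := by
  intro a a' h
  have hv : a.vert = a'.vert := hf (by
    rw [← f.coverMap_vert, h, f.coverMap_vert])
  obtain ⟨γ, hγ, rfl⟩ := exists_tr_eq hv
  have h1 : f.coverMap.toFun ((A.tr γ).toFun a) = (B.tr γ).toFun (f.coverMap.toFun a) :=
    f.coverVertexMap_tr hγ a
  have h2 : (B.tr 1).toFun (f.coverMap.toFun a) = (B.tr γ).toFun (f.coverMap.toFun a) := by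
    rw [tr_one, ← h1]
    exact h
  rw [tr_eq_iff (one_mem _) (f.range_le hγ)] at h2
  rw [← h2, tr_one]
  rfl

/-- An edge of `X` lifts to the covering of `A`; by uniqueness of lifts in the covering of `B`, that
lift has the prescribed endpoint. -/
theorem mem_cover_faces [DecidableEq A.V] [DecidableEq B.CoverVertex] {S : Finset A.CoverVertex}
    (h1 : S.image f.coverMap.toFun ∈ B.cover.faces) (h2 : S.image CoverVertex.vert ∈ A.K.faces) :
    S ∈ A.cover.faces := by
  refine ⟨by convert h2, fun a ha b hb => ?_⟩
  obtain ⟨b', hb', hab⟩ := exists_isEdgeLift a (w := b.vert)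
    ⟨_, h2, Finset.mem_image_of_mem _ ha, Finset.mem_image_of_mem _ hb⟩
  have h3 : B.IsEdgeLift (f.coverMap.toFun a) (f.coverMap.toFun b') := f.isEdgeLift hab
  have h4 := h1.2 _ (Finset.mem_image_of_mem _ ha) _ (Finset.mem_image_of_mem _ hb)
  have h5 := h4.unique h3 (by rw [f.coverMap_vert, f.coverMap_vert, hb'])
  rw [coverMap_injective f hf h5]
  exact hab

/-- Points of the covering of `Y` are moved into the cone over the covering of `X`. -/
theorem exists_retraction (x : Realization B.cover) :
    ∃ (s : ℝ) (z : Realization A.cover), 0 ≤ s ∧ s ≤ 1 ∧ ∀ a, s * z.coord a =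
      max (x.coord (f.coverMap.toFun a) - f.collar (B.coverProj.map x).coord) 0 := by
  classical
  set c := f.collar (B.coverProj.map x).coord with hc
  have hc0 : 0 ≤ c := collar_nonneg f.toSimplicialMap (B.coverProj.map x).nonneg
  have hinj := coverMap_injective f hf
  -- The vertices that survive subtraction of the collar. Their projections span a simplex of the
  -- subcomplex, since an outside simplex has a vertex whose coordinate does not exceed the collar.
  set S : Finset A.CoverVertex :=
    (x.coord.support.preimage f.coverMap.toFun hinj.injOn).filter
      fun a => c < x.coord (f.coverMap.toFun a) with hS
  have hmem : ∀ a, a ∈ S ↔ c < x.coord (f.coverMap.toFun a) := fun a => by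
    rw [hS, Finset.mem_filter, Finset.mem_preimage, Finsupp.mem_support_iff]
    exact ⟨fun h => h.2, fun h => ⟨(hc0.trans_lt h).ne', h⟩⟩
  have hface : ∃ σ ∈ A.cover.faces, S ⊆ σ := by
    rcases S.eq_empty_or_nonempty with h | h
    · obtain ⟨a, -⟩ := A.exists_vert_eq (Classical.choice (nonempty_V A))
      exact ⟨{a}, A.cover.singleton_mem a, by rw [h]; exact Finset.empty_subset _⟩
    refine ⟨S, ?_, subset_rfl⟩
    have hsub : S.image f.coverMap.toFun ⊆ x.coord.support := by
      intro b hb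
      obtain ⟨a, ha, rfl⟩ := Finset.mem_image.1 hb
      exact Finsupp.mem_support_iff.2 (hc0.trans_lt ((hmem a).1 ha)).ne'
    have h1 : S.image f.coverMap.toFun ∈ B.cover.faces :=
      (B.cover.isRelLowerSet_faces x.support_mem_faces).2 hsub (h.image _)
    refine mem_cover_faces f hf h1 ?_
    have h2 : (S.image CoverVertex.vert).image f.toFun ∈ B.K.faces := by
      have := h1.1
      rw [Finset.image_image] at this ⊢
      convert this using 1
      rfl
    by_contra h3
    have h4 : (S.image CoverVertex.vert).image f.toFun ∈ f.outside := by
      refine ⟨h2, fun ⟨σ, hσ, h⟩ => h3 ?_⟩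
      have : σ.image f.toFun = (S.image CoverVertex.vert).image f.toFun := by
        convert h
      rwa [← Finset.image_injective hf this]
    obtain ⟨v, hv, hle⟩ := exists_coord_le_collar f.toSimplicialMap (B.coverProj.map x).nonneg h4
    rw [Finset.image_image] at hv
    obtain ⟨a, ha, rfl⟩ := Finset.mem_image.1 hv
    have h5 : (B.coverProj.map x).coord (f.coverMap.toFun a).vert =
        x.coord (f.coverMap.toFun a) :=
      coord_coverProj x.support_mem_faces subset_rfl (hsub (Finset.mem_image_of_mem _ ha))
    rw [f.coverMap_vert] at h5
    have h6 := (hmem a).1 ha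
    rw [← h5] at h6
    exact absurd hle (not_le.2 h6)
  obtain ⟨σ, hσ, hSσ⟩ := hface
  obtain ⟨s, z, hs, hz, hsz⟩ := exists_cone_point hσ
    (fun a => max (x.coord (f.coverMap.toFun a) - c) 0) (fun a => le_max_right _ _) fun a ha => by
      refine max_eq_right ?_
      have := mt (hmem a).2 fun h => ha (hSσ h)
      linarith
  refine ⟨s, z, hs, ?_, hsz⟩
  calc s = ∑ a ∈ z.coord.support, s * z.coord a := (z.sum_mul_coord s subset_rfl).symm
    _ ≤ ∑ a ∈ z.coord.support, x.coord (f.coverMap.toFun a) := by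
      refine Finset.sum_le_sum fun a _ => ?_
      rw [hsz]
      exact max_le (by linarith) (x.nonneg _)
    _ = ∑ b ∈ z.coord.support.image f.coverMap.toFun, x.coord b :=
      (Finset.sum_image fun a _ b _ h => hinj h).symm
    _ ≤ ∑ b ∈ z.coord.support.image f.coverMap.toFun ∪ x.coord.support, x.coord b :=
      Finset.sum_le_sum_of_subset_of_nonneg Finset.subset_union_left fun b _ _ => x.nonneg b
    _ = 1 := x.sum_coord Finset.subset_union_right

theorem exists_sum_retraction_sub_le : ∃ D : ℝ, 0 ≤ D ∧ ∀ τ ∈ B.cover.faces,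
    ∀ x y : Realization B.cover, x.coord.support ⊆ τ → y.coord.support ⊆ τ →
      ∀ U : Finset A.CoverVertex, ∑ a ∈ U,
        |max (x.coord (f.coverMap.toFun a) - f.collar (B.coverProj.map x).coord) 0 -
          max (y.coord (f.coverMap.toFun a) - f.collar (B.coverProj.map y).coord) 0| ≤
        D * ∑ b ∈ τ, |x.coord b - y.coord b| := by
  classical
  set N : ℝ := (f.outside.toFinite.toFinset.card : ℝ)
  -- The collar is a sum of `N` minima, each `1`-Lipschitz for the sup distance, and it is
  -- subtracted at no more than `Fintype.card B.V` vertices of `τ`. At vertices off `τ` the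
  -- coordinates vanish, and so do the truncated differences.
  refine ⟨1 + Fintype.card B.V * N, by positivity, fun τ hτ x y hx hy U => ?_⟩
  have hinj := coverMap_injective f hf
  set M := ∑ b ∈ τ, |x.coord b - y.coord b|
  have hM : 0 ≤ M := Finset.sum_nonneg fun _ _ => abs_nonneg _
  have hc := abs_collar_sub_le f.toSimplicialMap (p := (B.coverProj.map x).coord)
    (q := (B.coverProj.map y).coord) hM fun v =>
      (norm_le_pi_norm (⇑(B.coverProj.map x).coord - ⇑(B.coverProj.map y).coord) v).trans
        (norm_coverProj_sub_le hτ hx hy)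
  have hcx : 0 ≤ f.collar (B.coverProj.map x).coord :=
    collar_nonneg f.toSimplicialMap (B.coverProj.map x).nonneg
  have hcy : 0 ≤ f.collar (B.coverProj.map y).coord :=
    collar_nonneg f.toSimplicialMap (B.coverProj.map y).nonneg
  set cx := f.collar (B.coverProj.map x).coord
  set cy := f.collar (B.coverProj.map y).coord
  calc _ ≤ ∑ a ∈ U, if f.coverMap.toFun a ∈ τ then
        |x.coord (f.coverMap.toFun a) - y.coord (f.coverMap.toFun a)| + N * M else 0 := by
        refine Finset.sum_le_sum fun a _ => ?_
        split_ifs with h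
        · refine (abs_max_sub_max_le_abs _ _ _).trans ?_
          rw [sub_sub_sub_comm]
          exact (abs_sub _ _).trans (add_le_add le_rfl hc)
        · rw [Realization.coord_eq_zero hx h, Realization.coord_eq_zero hy h,
            max_eq_right (by linarith), max_eq_right (by linarith), sub_self, abs_zero]
    _ = ∑ b ∈ U.image f.coverMap.toFun,
          if b ∈ τ then |x.coord b - y.coord b| + N * M else 0 :=
        (Finset.sum_image (f := fun b => if b ∈ τ then |x.coord b - y.coord b| + N * M else 0)
          fun a _ b _ h => hinj h).symm
    _ ≤ ∑ b ∈ τ, (|x.coord b - y.coord b| + N * M) := by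
        rw [Finset.sum_ite_mem]
        exact Finset.sum_le_sum_of_subset_of_nonneg Finset.inter_subset_right
          fun _ _ _ => by positivity
    _ ≤ _ := by
        rw [Finset.sum_add_distrib, Finset.sum_const, nsmul_eq_mul, add_mul, one_mul, mul_assoc]
        have hcard : (τ.card : ℝ) ≤ Fintype.card B.V := by
          rw [← Finset.card_image_of_injOn (injOn_vert hτ)]
          exact_mod_cast Finset.card_le_univ _
        have : 0 ≤ N * M := by positivity
        gcongr

/-- Equivariant maps on the covering of a subcomplex extend. -/
theorem IsTest.exists_extension {g : RiemannianMetric A.K} {F : Realization A.cover → A.L2 g}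
    (hF : IsTest A A g F) : ∃ F' : Realization B.cover → A.L2 g, IsTest A B g F' ∧
      ∀ x, F' (f.coverMap.map x) = F x := by
  classical
  choose s z h0 h1 hz using exists_retraction f hf
  obtain ⟨G, hG⟩ := exists_isTest g f.range_le
  obtain ⟨C, hC, hFC⟩ := hF.lipschitz
  obtain ⟨C', hC', hGC⟩ := hG.lipschitz
  obtain ⟨D, hD, hDs⟩ := exists_sum_retraction_sub_le f hf
  have hinj := coverMap_injective f hf
  -- The homogeneous extension of `F` dies out away from the subcomplex, and `G` fills in the
  -- remaining weight `1 - s`.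
  set P : Realization B.cover → A.L2 g := fun x => s x • F (z x) + (1 - s x) • G x with hP
  have hnn : ∀ x, 0 ≤ inner ℝ (F (z x)) (G x) := fun x => inner_nonneg (hF.nonneg _) (hG.nonneg _)
  -- The inner products of `P x` with the unit vectors `F (z x)` and `G x` are at least `s` and `1 -
  -- s`, and these add up to `1`.
  have hnorm : ∀ x, 1 / 2 ≤ ‖P x‖ := by
    intro x
    have e1 : inner ℝ (P x) (F (z x)) = s x + (1 - s x) * inner ℝ (F (z x)) (G x) := by
      rw [hP, inner_add_left, real_inner_smul_left, real_inner_smul_left,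
        real_inner_self_eq_norm_sq, hF.norm_eq_one, real_inner_comm, one_pow, mul_one]
    have e2 : inner ℝ (P x) (G x) = s x * inner ℝ (F (z x)) (G x) + (1 - s x) := by
      rw [hP, inner_add_left, real_inner_smul_left, real_inner_smul_left,
        real_inner_self_eq_norm_sq, hG.norm_eq_one, one_pow, mul_one]
    have e3 := real_inner_le_norm (P x) (F (z x))
    have e4 := real_inner_le_norm (P x) (G x)
    rw [hF.norm_eq_one, mul_one, e1] at e3
    rw [hG.norm_eq_one, mul_one, e2] at e4
    have e5 := mul_nonneg (h0 x) (hnn x)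
    have e6 := mul_nonneg (sub_nonneg.2 (h1 x)) (hnn x)
    linarith
  refine ⟨_, isTest_normalize (P := P) (c := 1 / 2) (by norm_num) hnorm ?_ ?_ ?_, ?_⟩
  · intro x
    exact add_nonneg (smul_nonneg' (h0 x) (hF.nonneg _))
      (smul_nonneg' (sub_nonneg.2 (h1 x)) (hG.nonneg _))
  · intro γ hγ x
    -- The chosen `z` need not be equivariant where `s = 0`; only the cone point `s z`, and hence `s
    -- • F z`, is determined.
    have e := cone_eq F (s := s ((B.tr γ).map x)) (t := s x) (x := z ((B.tr γ).map x))
      (y := (A.tr γ).map (z x)) fun a => by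
        obtain ⟨a, rfl⟩ : ∃ a', (A.tr γ).toFun a' = a :=
          ⟨(A.tr γ⁻¹).toFun a, by simpa using tr_inv_tr (inv_mem hγ) a⟩
        have e1 : f.coverMap.toFun ((A.tr γ).toFun a) = (B.tr γ).toFun (f.coverMap.toFun a) :=
          f.coverVertexMap_tr hγ a
        rw [hz, coord_tr_map, hz, coverProj_tr_map, e1, coord_tr_map]
    simp only [hP]
    rw [e.2, e.1, hF.equivariant γ hγ, hG.equivariant γ hγ, map_add, map_smul, map_smul]
  · refine ⟨(1 + 2 * C) * D + (D + C'), by positivity, fun τ hτ x y hx hy => ?_⟩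
    set M := ∑ b ∈ τ, |x.coord b - y.coord b|
    have e := hDs τ hτ x y hx hy ((z x).coord.support ∪ (z y).coord.support)
    simp only [← hz] at e
    have e1 := (norm_cone_sub_le hF.norm_eq_one hC hFC (h0 x) (h0 y) (z x) (z y)).trans
      (mul_le_mul_of_nonneg_left e (by positivity))
    have e2 := (abs_sub_le_sum_cone (s x) (s y) (z x) (z y) Finset.subset_union_left
      Finset.subset_union_right).trans e
    have e3 : ‖(1 - s x) • (G x - G y)‖ ≤ C' * M := by
      rw [norm_smul, Real.norm_eq_abs, abs_of_nonneg (sub_nonneg.2 (h1 x))]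
      refine (mul_le_of_le_one_left (norm_nonneg _) (by linarith [h0 x])).trans ?_
      exact hGC τ hτ x y hx hy
    have e4 : ‖(s x - s y) • G y‖ ≤ D * M := by
      rw [norm_smul, hG.norm_eq_one, mul_one]
      exact e2
    have e5 : P x - P y = (s x • F (z x) - s y • F (z y)) + ((1 - s x) • (G x - G y) -
        (s x - s y) • G y) := by
      simp only [hP]
      module
    rw [e5]
    refine (norm_add_le _ _).trans ((add_le_add e1 ((norm_sub_le _ _).trans
      (add_le_add e3 e4))).trans (le_of_eq ?_))
    ring
  · intro x
    have hproj : B.coverProj.map (f.coverMap.map x) = f.map (A.coverProj.map x) := by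
      rw [← SimplicialMap.map_comp, ← SimplicialMap.map_comp]
      rfl
    -- On the subcomplex the collar vanishes, so the cone point is `x` itself at radius one and the
    -- blend has no contribution from `G`.
    have e := cone_eq F (s := s (f.coverMap.map x)) (t := 1) (x := z (f.coverMap.map x))
      (y := x) fun a => by
        have e1 : (f.coverMap.map x).coord (f.coverMap.toFun a) = x.coord a :=
          Finsupp.mapDomain_apply hinj _ _
        rw [hz, hproj, collar_map f.toSimplicialMap, e1, sub_zero, max_eq_left (x.nonneg a),
          one_mul]
    have e1 : P (f.coverMap.map x) = F x := by
      simp only [hP]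
      rw [e.2, e.1, one_smul, sub_self, zero_smul, add_zero]
    simp only [e1, hF.norm_eq_one, inv_one, one_smul]

end Retraction

variable {f}

theorem exists_orderedSimplex_of_image [DecidableEq B.V] {n : ℕ} (e : OrderedSimplex B.K n)
    (h : ∃ σ ∈ A.K.faces, σ.image f.toFun = e.face) :
    ∃ e' : OrderedSimplex A.K n, ∀ i, f.toFun (e'.vert i) = e.vert i := by
  obtain ⟨σ, hσ, hσe⟩ := h
  have h1 : ∀ i, ∃ v ∈ σ, f.toFun v = e.vert i := fun i =>
    Finset.mem_image.1 (hσe ▸ e.vert_mem_face i)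
  choose v hv hve using h1
  have hvi : Function.Injective v := fun i j hij => e.vert.injective (by rw [← hve, hij, hve])
  refine ⟨⟨⟨v, hvi⟩, ?_⟩, hve⟩
  refine (A.K.isRelLowerSet_faces hσ).2 (fun w hw => ?_) (by simp)
  obtain ⟨i, -, rfl⟩ := Finset.mem_map.1 hw
  exact hv i

/-- A competitor on `A` extends to the covering of `B` and is then transferred to the `L²` space of
`B` by an embedding; all `n`-simplices of `B` come from `A`, so the volume does not grow. The other
inequality is the comparison theorem with `d = 1`. -/
theorem sphericalVolume_eq_of_injective [DecidableEq B.V] (gA : RiemannianMetric A.K)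
    (gB : RiemannianMetric B.K) (hf : Function.Injective f.toFun)
    (hBA : B.hom.range ≤ A.hom.range) {n : ℕ} (hn : 1 ≤ n) (hA : A.dim = n) (hB : B.dim = n)
    (h : ∀ τ ∈ B.K.faces, τ.card = n + 1 → ∃ σ ∈ A.K.faces, σ.image f.toFun = τ) :
    B.sphericalVolume gB = A.sphericalVolume gA := by
  have hAB : A.hom.range = B.hom.range := f.range_le.antisymm hBA
  have hfin : (A.hom.range.subgroupOf B.hom.range).FiniteIndex := by
    rw [hAB, Subgroup.subgroupOf_self]
    infer_instance
  refine le_antisymm (le_sphericalVolume fun F hF => ?_) ?_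
  · obtain ⟨F', hF', hFF'⟩ := hF.exists_extension f hf
    obtain ⟨Φ, h1, h2⟩ := exists_embedding gB gA (by omega) hBA (by
      rw [hAB, Subgroup.subgroupOf_self]
      infer_instance)
    refine (sphericalVolume_le (hF'.embedding hBA h1 h2)).trans ?_
    rw [pullbackVolume_eq _ hB, pullbackVolume_eq _ hA]
    gcongr
    choose j hj using fun e : OrderedSimplex B.K n =>
      exists_orderedSimplex_of_image e (h e.face e.face_mem e.card_face)
    have hji : Function.Injective j := fun e e' hee => OrderedSimplex.ext' fun i => by
      rw [← hj, hee, hj]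
    refine le_trans (le_of_eq ?_) (ENNReal.tsum_comp_le_tsum_of_injective hji
      fun e => chartVolume F (A.lift e))
    refine tsum_congr fun e => ?_
    have hinj : Function.Injective (f.coverMap.toFun ∘ (A.lift (j e)).vert) :=
      (coverMap_injective f hf).comp (A.lift (j e)).vert.injective
    rw [chartVolume_comp_isometry Φ F']
    calc chartVolume F' (B.lift e) = chartVolume F' ((A.lift (j e)).map f.coverMap hinj) := by
          refine hF'.chartVolume_eq hBA ?_
          rw [projSimplex_lift]
          apply OrderedSimplex.ext'
          intro i
          rw [← hj e i, ← lift_vert (j e) i, ← f.coverMap_vert]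
          rfl
      _ = chartVolume (fun x => F' (f.coverMap.map x)) (A.lift (j e)) :=
          (chartVolume_comp_map f.coverMap F' _ hinj).symm
      _ = _ := by simp only [hFF']
  · have hmon : f.IsMonotone n 1 := by
      intro τ _ _
      rw [Nat.cast_one, Set.encard_le_one_iff]
      rintro σ σ' ⟨-, -, h⟩ ⟨-, -, h'⟩
      exact Finset.image_injective hf (by convert h.trans h'.symm)
    simpa using sphericalVolume_le_mul gA gB f hA hB hmon hfin

end MarkedComplex

/-! ### Cell attachments and the extension axiom -/

section Extension

open MarkedComplex

variable {π : Type v} [Group π] {A B : MarkedComplex.{u} π}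

theorem IsCellAttachment.surjective {k : ℕ} (h : IsCellAttachment k A B)
    (hA : Function.Surjective A.hom) : Function.Surjective B.hom := by
  obtain ⟨f, -⟩ := h
  intro γ
  obtain ⟨α, rfl⟩ := hA γ
  rw [f.hom_eq]
  exact ⟨_, rfl⟩

/-- New simplices have at most `k + 1` vertices and `k` is below the dimension. The equality also
keeps the bound `k < n` meaningful along a chain of attachments. -/
theorem IsCellAttachment.dim_eq {k : ℕ} (h : IsCellAttachment k A B) (hk : k < A.dim) :
    B.dim = A.dim := by
  classical
  obtain ⟨f, hf, h, -⟩ := h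
  refine dimension_eq_of_le (fun τ hτ => ?_) ?_
  · by_cases hτ' : ∃ σ ∈ A.K.faces, σ.image f.toFun = τ
    · obtain ⟨σ, hσ, rfl⟩ := hτ'
      exact Finset.card_image_le.trans (card_le_dimension hσ)
    · refine (h τ hτ (by convert hτ')).trans ?_
      omega
  · obtain ⟨σ, hσ, hc⟩ := exists_card_eq_dimension (K := A.K)
    exact ⟨σ.image f.toFun, by convert f.image_mem σ hσ, by
      rw [Finset.card_image_of_injective _ hf, hc]; rfl⟩

theorem IsCellAttachment.sphericalVolume_eq {k : ℕ} (h : IsCellAttachment k A B) (hk1 : 1 ≤ k)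
    (hk : k < A.dim) (hA : Function.Surjective A.hom) (gA : RiemannianMetric A.K)
    (gB : RiemannianMetric B.K) : B.sphericalVolume gB = A.sphericalVolume gA := by
  classical
  have hdim := h.dim_eq hk
  obtain ⟨f, hf, h, -⟩ := h
  refine sphericalVolume_eq_of_injective (f := f) gA gB hf ?_ (by omega) rfl hdim ?_
  · rw [MonoidHom.range_eq_top.2 hA]
    exact le_top
  · intro τ hτ hc
    by_contra hτ'
    have := h τ hτ (by convert hτ')
    omega

/-- The extension axiom. -/
theorem IsExtension.sphericalVolume_eq
    (g : ∀ {π : Type v} [Group π] (A : MarkedComplex.{u} π), RiemannianMetric A.K)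
    (h : IsExtension A B) (hA : Function.Surjective A.hom) :
    B.sphericalVolume (g B) = A.sphericalVolume (g A) := by
  suffices H : Function.Surjective B.hom ∧ B.sphericalVolume (g B) = A.sphericalVolume (g A) from
    H.2
  induction h with
  | refl => exact ⟨hA, rfl⟩
  | tail _ h ih =>
    obtain ⟨k, h1, hk, h⟩ := h
    exact ⟨h.surjective ih.1, (h.sphericalVolume_eq h1 hk ih.1 _ _).trans ih.2⟩

end Extension

end SphericalVolume

end

open SphericalVolume in
theorem mainTheorem10
    (g : ∀ {π : Type v} [Group π] (A : MarkedComplex.{u} π), RiemannianMetric A.K) :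
    (∀ (π : Type v) [Group π] (A : MarkedComplex.{u} π), A.sphericalVolume (g A) ≠ ⊤) ∧
    WeakComparisonAxiom.{u, v} (fun A => A.sphericalVolume (g A)) ∧
    CoveringAxiom.{u, v} (fun A => A.sphericalVolume (g A)) ∧
    ZeroAxiom.{u, v} (fun A => A.sphericalVolume (g A)) ∧
    ExtensionAxiom.{u, v} (fun A => A.sphericalVolume (g A)) := by
  refine ⟨?_, ?_, ?_, ?_, ?_⟩
  · intro π _ A
    exact MarkedComplex.sphericalVolume_ne_top (g A)
  · intro π _ A B n d f hA hB hf hs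
    exact MarkedComplex.sphericalVolume_le_of_bijective (g A) (g B) f hA hB hf hs.2
  · intro π _ A B d f hf hd
    exact MarkedComplex.sphericalVolume_le_of_covering (g A) (g B) f hf hd
  · intro π _ A B n f hA _ hf
    exact MarkedComplex.sphericalVolume_eq_zero (g A) f hA hf
  · intro π _ A B hA h
    exact h.sphericalVolume_eq g hA
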